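/- Let $1<p,p'<\infty$ with $\frac1p+\frac1{p'}=1$, let $m>n$, let $\Omega\subset\mathbb R^n$ be open and bounded, and let $Y=\{a+\sum_{i=1}^m t_ib_i : 0\le t_i<1\}\subset\mathbb R^m$ be a parallelotope, where $a\in\mathbb R^m$ and $b_1,\dots,b_m$ is a basis of $\mathbb R^m$. Functions on $\mathbb R^m$ are called $Y$-periodic if they are invariant under translation by $b_1,\dots,b_m$. Let $\Lambda=\{k\in\mathbb R^m : k\cdot b_i\in\mathbb Z \text{ for all } i\}$ be the set of frequencies of $Y$-periodic functions (so $\Lambda=\mathbb Z^m$ when $Y=[0,1)^m$), and let $R\in\mathbb R^{m\times n}$ be a matrix, with transpose $R^*$, such that $$R^*k\neq0\quad\text{for all }k\in\Lambda\setminus\{0\}.$$ Let $\varepsilon$ run through an arbitrary sequence of positive numbers converging to $0$. A sequence $u_\varepsilon\in L^p(\Omega;\mathbb R^n)$ is said to $R$-two-scale converge to $u\in L^p(\Omega\times Y;\mathbb R^n)$ if $$\lim_{\varepsilon\to0^+}\int_\Omega u_\varepsilon(x)\cdot\varphi\Big(x,\frac{Rx}{\varepsilon}\Big)\,dx=\int_\Omega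 \frac1{|Y|}\int_Y u(x,y)\cdot\varphi(x,y)\,dy\,dx$$ for all $\varphi\in L^{p'}(\Omega;C_\#(Y;\mathbb R^n))$, where $C_\#(Y;\mathbb R^n)$ is the space of continuous $Y$-periodic functions $\mathbb R^m\to\mathbb R^n$ with the supremum norm. Let $L^p_\#(Y;\mathbb R^n)$ be the space of $Y$-periodic functions in $L^p_{\rm loc}(\mathbb R^m;\mathbb R^n)$, and let $$\mathcal G_R^p=\Big\{w\in L^p_\#(Y;\mathbb R^n) : \hat w_k=\lambda_kR^*k\ \text{ for all } k\in\Lambda, \text{ for some } \{\lambda_k\}_{k\in\Lambda}\subset\mathbb C\text{ with }\lambda_0=0\Big\},\qquad \hat w_k=\frac1{|Y|}\int_Y w(y)e^{-2\pi i k\cdot y}\,dy .$$ **Theorem.** A function $v\in L^p(\Omega\times Y;\mathbb R^n)$ is the $R$-two-scale limit of $\{\nabla v_\varepsilon\}_\varepsilon$ for some sequence $\{v_\varepsilon\}_\varepsilon$ bounded in $W^{1,p}(\Omega)$ if and only if there exist $v_0\in W^{1,p}(\Omega)$ and $v_1\in L^p(\Omega;\mathcal G_R^p)$ such that $v(x,y)=\nabla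 v_0(x)+v_1(x,y)$ for a.e. $(x,y)\in\Omega\times Y$. -/

import Mathlib

open MeasureTheory Filter Topology
open scoped ENNReal NNReal ContDiff

noncomputable section

/-- `ℝᵈ` with its Euclidean structure. -/
abbrev Eucl (d : ℕ) : Type := EuclideanSpace ℝ (Fin d)

/-! ### Parallelotopes, periodicity and frequencies -/

/-- The parallelotope in `ℝᵐ` with corner `a` and edge vectors `b 0, …, b (m-1)` (a basis of `ℝᵐ`):
the set of all `a + ∑ i, t i • b i` with `0 ≤ t i < 1`. -/
def parallelotope {m : ℕ} (a : Eucl m) (b : Module.Basis (Fin m) ℝ (Eucl m)) : Set (Eucl m) :=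
  {y | y - a ∈ ZSpan.fundamentalDomain b}

/-- Periodicity with respect to a parallelotope with edge vectors `b`: `f` is invariant under
translation by each of the edges. -/
def CellPeriodic {m : ℕ} {F : Type*} (b : Module.Basis (Fin m) ℝ (Eucl m)) (f : Eucl m → F) :
    Prop :=
  ∀ i y, f (y + b i) = f y

/-- The frequencies of periodic functions: the vectors `k` with `k · b i ∈ ℤ` for every edge `b i`,
i.e. the `k` for which `y ↦ exp (2 π i k · y)` is periodic. For the unit cube this is `ℤᵐ`. -/
def dualLattice {m : ℕ} (b : Module.Basis (Fin m) ℝ (Eucl m)) : Set (Eucl m) :=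
  {k | ∀ i, ∃ z : ℤ, inner ℝ k (b i) = (z : ℝ)}

/-- The irrationality condition on `R`: `R* k ≠ 0` for every nonzero frequency `k`. -/
def IrrationalityCondition {n m : ℕ} (R : Matrix (Fin m) (Fin n) ℝ)
    (b : Module.Basis (Fin m) ℝ (Eucl m)) : Prop :=
  ∀ k ∈ dualLattice b, k ≠ 0 → R.transpose.toEuclideanLin k ≠ 0

/-! ### Sobolev functions -/

/-- `g` is the weak (distributional) gradient of `u` in `Ω`:
`∫_Ω u ∂ᵢφ = - ∫_Ω gᵢ φ` for all `φ ∈ C_c^∞(Ω)` and all `i`. -/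
def HasWeakGradient {n : ℕ} (Ω : Set (Eucl n)) (u : Eucl n → ℝ) (g : Eucl n → Eucl n) : Prop :=
  ∀ φ : Eucl n → ℝ, ContDiff ℝ ∞ φ → HasCompactSupport φ → tsupport φ ⊆ Ω → ∀ i : Fin n,
    ∫ x in Ω, u x * fderiv ℝ φ x (EuclideanSpace.single i 1) = - ∫ x in Ω, g x i * φ x

/-- `u ∈ W^{1,p}(Ω)` with `∇u = g`. -/
structure IsSobolevWithGradient {n : ℕ} (Ω : Set (Eucl n)) (p : ℝ≥0∞) (u : Eucl n → ℝ)
    (g : Eucl n → Eucl n) : Prop where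
  memLp : MemLp u p (volume.restrict Ω)
  memLp_gradient : MemLp g p (volume.restrict Ω)
  hasWeakGradient : HasWeakGradient Ω u g

/-- The sequence `u j`, with gradients `g j`, is bounded in `W^{1,p}(Ω)`. -/
def IsBoundedSobolevSeq {n : ℕ} (Ω : Set (Eucl n)) (p : ℝ≥0∞) (u : ℕ → Eucl n → ℝ)
    (g : ℕ → Eucl n → Eucl n) : Prop :=
  (∀ j, IsSobolevWithGradient Ω p (u j) (g j)) ∧
    ∃ C : ℝ≥0, ∀ j, eLpNorm (u j) p (volume.restrict Ω) + eLpNorm (g j) p (volume.restrict Ω) ≤ C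

/-! ### Cut-and-project two-scale convergence -/

/-- The product measure on `Ω × Y`. -/
abbrev prodMeasure {n m : ℕ} (Ω : Set (Eucl n)) (Y : Set (Eucl m)) : Measure (Eucl n × Eucl m) :=
  (volume.restrict Ω).prod (volume.restrict Y)

/-- `φ ∈ L^q(Ω; C_#(Y; ℝᵈ))` (Bochner space), where `C_#(Y; ℝᵈ)` is the space of continuous
periodic functions on `ℝᵐ`, with the supremum norm. -/
def IsTwoScaleTestFunction {n m d : ℕ} (Ω : Set (Eucl n)) (q : ℝ≥0∞)
    (b : Module.Basis (Fin m) ℝ (Eucl m)) (φ : Eucl n → BoundedContinuousFunction (Eucl m) (Eucl d)) :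
    Prop :=
  MemLp φ q (volume.restrict Ω) ∧ ∀ x, CellPeriodic b (φ x)

/-- `R`-two-scale convergence, along the scales `ε j`, of a sequence `u j ∈ L^p(Ω; ℝᵈ)` to
`U ∈ L^p(Ω × Y; ℝᵈ)`, where `Y` is the parallelotope given by `a` and `b`, and `q` is the exponent
conjugate to `p`:
`∫_Ω u j x · φ (x, R x / ε j) dx → ∫_Ω ⨍_Y U (x, y) · φ (x, y) dy dx`
for all `φ ∈ L^q(Ω; C_#(Y; ℝᵈ))`. -/
def RTwoScaleConverges {n m d : ℕ} (Ω : Set (Eucl n)) (p q : ℝ≥0∞) (R : Matrix (Fin m) (Fin n) ℝ)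
    (a : Eucl m) (b : Module.Basis (Fin m) ℝ (Eucl m)) (ε : ℕ → ℝ)
    (u : ℕ → Eucl n → Eucl d) (U : Eucl n × Eucl m → Eucl d) : Prop :=
  (∀ j, MemLp (u j) p (volume.restrict Ω)) ∧
  MemLp U p (prodMeasure Ω (parallelotope a b)) ∧
  ∀ φ : Eucl n → BoundedContinuousFunction (Eucl m) (Eucl d), IsTwoScaleTestFunction Ω q b φ →
    Tendsto (fun j => ∫ x in Ω, inner ℝ (u j x) (φ x ((ε j)⁻¹ • R.toEuclideanLin x))) atTop
      (𝓝 (∫ x in Ω, ⨍ y in parallelotope a b, inner ℝ (U (x, y)) (φ x y)))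

/-! ### The space `G_R^p` -/

/-- The Fourier coefficient `⨍_Y w(y) exp (-2 π i k · y) dy ∈ ℂᵈ`. -/
def cellFourierCoeff {m d : ℕ} (Y : Set (Eucl m)) (w : Eucl m → Eucl d) (k : Eucl m) :
    Fin d → ℂ :=
  fun l => ⨍ y in Y, ((w y l : ℝ) : ℂ) *
    Complex.exp (-(2 * (Real.pi : ℂ) * Complex.I * ((inner ℝ k y : ℝ) : ℂ)))

/-- `w ∈ L^p_#(Y; ℝᵈ)`: a periodic function in `L^p_loc(ℝᵐ; ℝᵈ)`. -/
def MemLpPeriodic {m d : ℕ} (p : ℝ≥0∞) (b : Module.Basis (Fin m) ℝ (Eucl m))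
    (w : Eucl m → Eucl d) : Prop :=
  CellPeriodic b w ∧ ∀ K : Set (Eucl m), IsCompact K → MemLp w p (volume.restrict K)

/-- `w ∈ G_R^p`: a field in `L^p_#(Y; ℝⁿ)` whose Fourier coefficients are of the form
`ŵ_k = c k • R* k` for some complex family `c` with `c 0 = 0`. -/
def MemGR {n m : ℕ} (p : ℝ≥0∞) (R : Matrix (Fin m) (Fin n) ℝ) (a : Eucl m)
    (b : Module.Basis (Fin m) ℝ (Eucl m)) (w : Eucl m → Eucl n) : Prop :=
  MemLpPeriodic p b w ∧
    ∃ c : Eucl m → ℂ, c 0 = 0 ∧ ∀ k ∈ dualLattice b, ∀ l : Fin n,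
      cellFourierCoeff (parallelotope a b) w k l =
        c k * ((R.transpose.toEuclideanLin k l : ℝ) : ℂ)

/-- `v₁ ∈ L^p(Ω; G_R^p)`, as a function of `(x, y)`: it is `L^p` jointly on `Ω × Y`, and
`v₁(x, ·) ∈ G_R^p` for almost every `x ∈ Ω`. -/
def MemLpGR {n m : ℕ} (Ω : Set (Eucl n)) (p : ℝ≥0∞) (R : Matrix (Fin m) (Fin n) ℝ) (a : Eucl m)
    (b : Module.Basis (Fin m) ℝ (Eucl m)) (v₁ : Eucl n × Eucl m → Eucl n) : Prop :=
  MemLp v₁ p (prodMeasure Ω (parallelotope a b)) ∧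
    ∀ᵐ x ∂(volume.restrict Ω), MemGR p R a b (fun y => v₁ (x, y))

end

/-! Pulled back to the torus by `cellSection`, averages over the cell become integrals for
normalized Haar measure, and frequencies become integer vectors. Both implications rest on the mean
value statement `tendsto_integral_oscillating`: for ψ in L¹(Ω; C_#(Y)), the integrals of ψ(x, Rx/ε)
tend to the integral over Ω of the cell averages. Fejér approximation reduces this to single modes
c(x) e^{2πi k·y}. On the plane y = Rx/ε such a mode oscillates in x with frequency R*k/ε, and R*k ≠
0 for k ≠ 0, so the Riemann–Lebesgue lemma removes it.

Necessity. Let k ≠ 0 and η ⟂ R*k. The wave e^{2πi k·Rx/ε} is constant in the direction η.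
Integrating η·∇v_ε against φ times the wave by parts therefore differentiates φ only, and leaves an
integral of v_ε against a wave. A second integration by parts, along R*k, gains a factor ε, because
v_ε is bounded in W^{1,p}. Hence the k-th Fourier coefficient of v(x,·) has no component along any
such η and is a multiple of R*k (`RTwoScaleConverges.ae_exists_mFourierCoeff_eq`). For k = 0,
testing with functions independent of y shows that the cell mean of v is the distributional limit of
the gradients, hence the gradient of a weak limit of v_ε (`exists_isSobolevWithGradient_cellMean`).
Weak convergence suffices here, so no regularity of the boundary of Ω is needed.

Sufficiency. The Fejér means of v₁ in y converge in L^p(Ω × Y) and are finite sums of modes α(x)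
e^{2πi k·y} R*k. Once α is smoothed, the real part of such a mode equals R*∇_yΦ with Φ smooth and
compactly supported in x (`isCellGradientLimit_of_mFourierCoeff`). The function v₀ + εΦ(x, Rx/ε) has
gradient ∇v₀ + R*∇_yΦ + ε∇_xΦ, evaluated at y = Rx/ε, and this two-scale converges to ∇v₀ + R*∇_yΦ.
By the mean value statement for |R*∇_yΦ|^p, L^p(Ω) norms of these oscillating fields are
asymptotically their normalized norms on Ω × Y, so a diagonal choice of potentials stays bounded and
has the right limit (`exists_recovery_sequence`). -/

noncomputable section


/-! ### The torus, with its normalized Haar measure -/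

-- This is the normalization used by `UnitAddTorus.mFourierCoeff`. It makes the torus a probability
-- space, so that `L^p` norms increase with `p`.
local instance : MeasureSpace UnitAddCircle := ⟨AddCircle.haarAddCircle⟩

local instance : Measure.IsAddHaarMeasure (volume : Measure UnitAddCircle) :=
  inferInstanceAs (Measure.IsAddHaarMeasure AddCircle.haarAddCircle)

local instance : IsProbabilityMeasure (volume : Measure UnitAddCircle) :=
  inferInstanceAs (IsProbabilityMeasure AddCircle.haarAddCircle)

/-! ### Frequencies and the projection onto the torus -/

section Cell

variable {m : ℕ} (a : Eucl m) (b : Module.Basis (Fin m) ℝ (Eucl m))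

/-- The frequency with integer coordinates `z` in the basis dual to `b`. -/
def freq (z : Fin m → ℤ) : Eucl m :=
  (InnerProductSpace.toDual ℝ (Eucl m)).symm
    (LinearMap.toContinuousLinearMap (∑ i, (z i : ℝ) • b.coord i))

theorem inner_freq (z : Fin m → ℤ) (y : Eucl m) :
    inner ℝ (freq b z) y = ∑ i, (z i : ℝ) * b.repr y i := by
  simp [freq, -map_sum, -map_smul, LinearMap.sum_apply]

theorem inner_freq_basis (z : Fin m → ℤ) (i : Fin m) : inner ℝ (freq b z) (b i) = (z i : ℝ) := by
  classical
  simp [inner_freq, Finsupp.single_apply]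

theorem freq_mem_dualLattice (z : Fin m → ℤ) : freq b z ∈ dualLattice b :=
  fun i => ⟨z i, inner_freq_basis b z i⟩

/-- A vector is determined by its inner products with a basis. Conditions over the dual lattice
thereby become conditions over integer vectors. -/
theorem exists_freq_eq {k : Eucl m} (hk : k ∈ dualLattice b) : ∃ z, k = freq b z := by
  choose z hz using hk
  refine ⟨z, ?_⟩
  refine ext_inner_right ℝ fun y => ?_
  rw [← b.sum_repr y, inner_sum, inner_sum]
  simp_rw [inner_smul_right, hz, inner_freq_basis]

theorem freq_zero : freq b 0 = 0 := by
  refine ext_inner_right ℝ fun y => ?_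
  simp [inner_freq]

theorem freq_eq_zero_iff {z : Fin m → ℤ} : freq b z = 0 ↔ z = 0 := by
  refine ⟨fun h => ?_, fun h => h ▸ freq_zero b⟩
  ext i
  have := inner_freq_basis b z i
  rw [h, inner_zero_left] at this
  exact_mod_cast this.symm

/-- The projection of `ℝᵐ` onto the torus determined by the edges `b`. -/
def cellProj (y : Eucl m) : UnitAddTorus (Fin m) := fun i => (b.repr y i : UnitAddCircle)

theorem continuous_basis_repr (i : Fin m) : Continuous fun y : Eucl m => b.repr y i :=
  (b.coord i).continuous_of_finiteDimensional

theorem continuous_cellProj : Continuous (cellProj b) :=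
  continuous_pi fun i => (AddCircle.continuous_mk' (1 : ℝ)).comp (continuous_basis_repr b i)

theorem mFourier_cellProj (z : Fin m → ℤ) (y : Eucl m) :
    UnitAddTorus.mFourier z (cellProj b y) =
      Complex.exp (2 * (Real.pi : ℂ) * Complex.I * ((inner ℝ (freq b z) y : ℝ) : ℂ)) := by
  simp only [UnitAddTorus.mFourier, ContinuousMap.coe_mk, cellProj, fourier_coe_apply, inner_freq]
  rw [← Complex.exp_sum]
  congr 1
  push_cast
  rw [Finset.mul_sum]
  exact Finset.sum_congr rfl fun i _ => by ring

theorem mem_parallelotope_iff {y : Eucl m} :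
    y ∈ parallelotope a b ↔ ∀ i, b.repr y i ∈ Set.Ico (b.repr a i) (b.repr a i + 1) := by
  simp only [parallelotope, Set.mem_ofPred_eq, ZSpan.mem_fundamentalDomain, map_sub,
    Finsupp.coe_sub, Pi.sub_apply, Set.mem_Ico]
  exact forall_congr' fun i => by constructor <;> rintro ⟨h1, h2⟩ <;> constructor <;> linarith

theorem measurableSet_parallelotope : MeasurableSet (parallelotope a b) := by
  have : parallelotope a b =
      ⋂ i, (fun y => b.repr y i) ⁻¹' Set.Ico (b.repr a i) (b.repr a i + 1) := by
    ext y; simp [mem_parallelotope_iff]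
  rw [this]
  exact MeasurableSet.iInter fun i => (continuous_basis_repr b i).measurable measurableSet_Ico

/-- The point of the parallelotope over a point of the torus. -/
def cellSection (t : UnitAddTorus (Fin m)) : Eucl m :=
  ∑ i, (AddCircle.equivIco 1 (b.repr a i) (t i) : ℝ) • b i

theorem repr_cellSection (t : UnitAddTorus (Fin m)) (i : Fin m) :
    b.repr (cellSection a b t) i = AddCircle.equivIco 1 (b.repr a i) (t i) := by
  classical
  simp [cellSection, Finsupp.single_apply]

theorem cellSection_mem (t : UnitAddTorus (Fin m)) : cellSection a b t ∈ parallelotope a b := by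
  rw [mem_parallelotope_iff]
  intro i
  rw [repr_cellSection]
  exact (AddCircle.equivIco 1 (b.repr a i) (t i)).2

theorem cellProj_cellSection (t : UnitAddTorus (Fin m)) : cellProj b (cellSection a b t) = t := by
  ext i
  simp only [cellProj, repr_cellSection]
  exact AddCircle.coe_equivIco

theorem cellProj_eq_iff {y y' : Eucl m} :
    cellProj b y = cellProj b y' ↔ ∀ i, ∃ z : ℤ, b.repr y i = b.repr y' i + z := by
  simp only [cellProj, funext_iff]
  refine forall_congr' fun i => ?_
  rw [← sub_eq_zero, ← AddCircle.coe_sub, AddCircle.coe_eq_zero_iff]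
  refine exists_congr fun z => ?_
  simp only [zsmul_eq_mul, mul_one]
  constructor <;> intro h <;> linarith

theorem cellSection_cellProj {y : Eucl m} (hy : y ∈ parallelotope a b) :
    cellSection a b (cellProj b y) = y := by
  refine b.ext_elem fun i => ?_
  rw [repr_cellSection, cellProj]
  have := (mem_parallelotope_iff a b).1 hy i
  rw [AddCircle.equivIco_coe_of_mem this]

theorem measurable_cellSection : Measurable (cellSection a b) := by
  refine Finset.measurable_sum _ fun i _ => Measurable.smul_const ?_ _
  exact measurable_subtype_coe.comp
    ((AddCircle.measurableEquivIco 1 (b.repr a i)).measurable.comp (measurable_pi_apply i))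

theorem range_cellSection : Set.range (cellSection a b) = parallelotope a b := by
  refine Set.Subset.antisymm ?_ fun y hy => ⟨_, cellSection_cellProj a b hy⟩
  rintro _ ⟨t, rfl⟩
  exact cellSection_mem a b t

theorem measurableEmbedding_cellSection : MeasurableEmbedding (cellSection a b) :=
  MeasurableEmbedding.of_measurable_inverse (measurable_cellSection a b)
    (range_cellSection a b ▸ measurableSet_parallelotope a b)
    (continuous_cellProj b).measurable (cellProj_cellSection a b)

-- Points with the same projection differ by an integer combination of the edges, and invariance
-- under the edges propagates to their integer span.
variable {b} in
theorem CellPeriodic.apply_eq {F : Type*} {f : Eucl m → F} (hf : CellPeriodic b f) {y y' : Eucl m}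
    (h : cellProj b y = cellProj b y') : f y = f y' := by
  have key : ∀ v ∈ Submodule.span ℤ (Set.range b), ∀ y, f (y + v) = f y := by
    intro v hv
    induction hv using Submodule.span_induction with
    | mem x hx => obtain ⟨i, rfl⟩ := hx; exact hf i
    | zero => simp
    | add x x' _ _ h h' => intro y; rw [← add_assoc, h', h]
    | smul c x _ h =>
      intro y
      have h' : ∀ n : ℕ, ∀ y, f (y + n • x) = f y := by
        intro n
        induction n with
        | zero => simp
        | succ n ih => intro y; rw [succ_nsmul, ← add_assoc, h, ih]
      obtain ⟨n, rfl | rfl⟩ := c.eq_nat_or_neg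
      · simpa using h' n y
      -- Negative multiples: apply the invariance under `n • x` at the point already shifted by `-n
      -- • x`.
      · have := h' n (y + (-(n : ℤ)) • x)
        rw [← this]; congr 1; simp
  have hz := (cellProj_eq_iff b).1 h
  choose z hz using hz
  have : y = y' + ∑ i, z i • b i := by
    classical
    refine b.ext_elem fun i => ?_
    simp [hz, Finsupp.single_apply]
  rw [this]
  exact key _ (Submodule.sum_mem _ fun i _ => Submodule.smul_mem _ _
    (Submodule.subset_span ⟨i, rfl⟩)) _

variable {b} in
theorem CellPeriodic.section_proj {F : Type*} {f : Eucl m → F} (hf : CellPeriodic b f)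
    (y : Eucl m) : f (cellSection a b (cellProj b y)) = f y :=
  hf.apply_eq (cellProj_cellSection a b _)

theorem cellProj_add_basis (y : Eucl m) (i : Fin m) : cellProj b (y + b i) = cellProj b y := by
  classical
  rw [cellProj_eq_iff]
  intro j
  refine ⟨if j = i then 1 else 0, ?_⟩
  by_cases h : i = j <;> simp [h, eq_comm]

theorem cellPeriodic_comp_cellProj {F : Type*} (g : UnitAddTorus (Fin m) → F) :
    CellPeriodic b fun y => g (cellProj b y) :=
  fun i y => congrArg g (cellProj_add_basis b y i)

/-! ### Averages over the cell as integrals over the torus -/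

/-- Coordinates in `b` carry Lebesgue measure to a multiple of itself by uniqueness of Haar measure,
and the cell to a unit box, which the quotient map sends to the torus preserving measure. The
constant is the volume of the cell; its value is immaterial, as only averages occur later. -/
theorem exists_map_cellProj :
    ∃ c : ℝ≥0∞, c ≠ 0 ∧ c ≠ ⊤ ∧
      (volume.restrict (parallelotope a b)).map (cellProj b) = c • volume := by
  let L : Eucl m ≃L[ℝ] (Fin m → ℝ) := b.equivFun.toContinuousLinearEquiv
  have hL : ∀ y i, L y i = b.repr y i := fun y i => rfl
  have : (Measure.map L volume).IsAddHaarMeasure := L.isAddHaarMeasure_map _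
  set c := Measure.addHaarScalarFactor (Measure.map L volume) (volume : Measure (Fin m → ℝ))
  have hc : Measure.map L volume = c • volume := Measure.isAddLeftInvariant_eq_smul _ _
  have hc0 : c ≠ 0 := by
    intro h
    rw [h, zero_smul] at hc
    exact (NeZero.ne (Measure.map L volume)) hc
  refine ⟨c, by simpa using hc0, ENNReal.coe_ne_top, ?_⟩
  set box : Set (Fin m → ℝ) := Set.univ.pi fun i => Set.Ico (b.repr a i) (b.repr a i + 1)
  have hY : parallelotope a b = L ⁻¹' box := by
    ext y; simp [mem_parallelotope_iff, box, hL]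
  have hbox : MeasurableSet box := MeasurableSet.univ_pi fun i => measurableSet_Ico
  let q : (Fin m → ℝ) → UnitAddTorus (Fin m) := fun x i => (x i : UnitAddCircle)
  have hq : Measurable q := measurable_pi_lambda _ fun i =>
    AddCircle.measurable_mk'.comp (measurable_pi_apply i)
  have hproj : cellProj b = q ∘ L := rfl
  have h1 : (volume.restrict (parallelotope a b)).map L = c • volume.restrict box := by
    rw [hY, ← Measure.restrict_map L.continuous.measurable hbox, hc, Measure.restrict_smul]
  have h2 : (volume.restrict box).map q = volume := by
    -- The sides of the cell are closed on the left, while `AddCircle.measurePreserving_mk` takes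
    -- intervals closed on the right; endpoints are null.
    have hr : (volume.restrict box : Measure (Fin m → ℝ)) =
        Measure.pi fun i => volume.restrict (Set.Ioc (b.repr a i) (b.repr a i + 1)) := by
      rw [volume_pi, Measure.restrict_pi_pi]
      congr 1; ext1 i
      exact (restrict_Ico_eq_restrict_Ioc)
    rw [hr]
    have hmk : ∀ i, MeasurePreserving (fun x : ℝ => (x : UnitAddCircle))
        (volume.restrict (Set.Ioc (b.repr a i) (b.repr a i + 1))) AddCircle.haarAddCircle :=
      fun i => by
        simpa [AddCircle.volume_eq_smul_haarAddCircle] using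
          AddCircle.measurePreserving_mk 1 (b.repr a i)
    have := (measurePreserving_pi (fun i => volume.restrict (Set.Ioc (b.repr a i) (b.repr a i + 1)))
      (fun _ => (volume : Measure UnitAddCircle))
      hmk).map_eq
    simpa [volume_pi] using this
  rw [hproj, ← Measure.map_map hq L.continuous.measurable, h1, Measure.map_smul, h2]
  rfl

theorem volume_parallelotope_pos : volume (parallelotope a b) ≠ 0 := by
  obtain ⟨c, hc, -, h⟩ := exists_map_cellProj a b
  have := congrArg (fun μ => μ Set.univ) h
  simp only [Measure.map_apply (continuous_cellProj b).measurable MeasurableSet.univ] at this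
  simp at this
  rwa [this]

theorem volume_parallelotope_ne_top : volume (parallelotope a b) ≠ ⊤ := by
  obtain ⟨c, -, hc, h⟩ := exists_map_cellProj a b
  have := congrArg (fun μ => μ Set.univ) h
  simp only [Measure.map_apply (continuous_cellProj b).measurable MeasurableSet.univ] at this
  simp at this
  rwa [this]

/-- On the cell, `cellSection` inverts `cellProj`, so pushing the previous identity forward once
more returns the restricted Lebesgue measure. This is what turns cell averages into torus integrals.
-/
theorem map_cellSection :
    Measure.map (cellSection a b) volume =
      (volume (parallelotope a b))⁻¹ • volume.restrict (parallelotope a b) := by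
  obtain ⟨c, hc0, hc, h⟩ := exists_map_cellProj a b
  have hvol : volume (parallelotope a b) = c := by
    have := congrArg (fun μ => μ Set.univ) h
    simp only [Measure.map_apply (continuous_cellProj b).measurable MeasurableSet.univ] at this
    simpa using this
  have hid : ((volume.restrict (parallelotope a b)).map (cellProj b)).map (cellSection a b) =
      volume.restrict (parallelotope a b) := by
    rw [Measure.map_map (measurable_cellSection a b) (continuous_cellProj b).measurable]
    conv_rhs => rw [← Measure.map_id (μ := volume.restrict (parallelotope a b))]
    refine Measure.map_congr ?_
    filter_upwards [ae_restrict_mem (measurableSet_parallelotope a b)] with y hy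
    exact cellSection_cellProj a b hy
  rw [h, Measure.map_smul] at hid
  rw [hvol, ← hid, smul_smul, ENNReal.inv_mul_cancel hc0 hc, one_smul]

theorem average_cell_eq {E : Type*} [NormedAddCommGroup E] [NormedSpace ℝ E] (f : Eucl m → E) :
    ⨍ y in parallelotope a b, f y = ∫ t, f (cellSection a b t) := by
  rw [← (measurableEmbedding_cellSection a b).integral_map, map_cellSection, average,
    Measure.restrict_apply_univ]

theorem cellFourierCoeff_freq {d : ℕ} (w : Eucl m → Eucl d) (z : Fin m → ℤ) (l : Fin d) :
    cellFourierCoeff (parallelotope a b) w (freq b z) l =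
      UnitAddTorus.mFourierCoeff (fun t => ((w (cellSection a b t) l : ℝ) : ℂ)) z := by
  rw [cellFourierCoeff, average_cell_eq, UnitAddTorus.mFourierCoeff]
  refine integral_congr_ae (ae_of_all _ fun t => ?_)
  -- The sign appears because a Fourier coefficient pairs with the conjugate character `mFourier
  -- (-z)`.
  have := mFourier_cellProj b (-z) (cellSection a b t)
  rw [cellProj_cellSection] at this
  simp only [this, smul_eq_mul]
  rw [mul_comm]
  congr 2
  simp only [inner_freq, Pi.neg_apply]
  push_cast
  simp only [neg_mul, Finset.sum_neg_distrib]
  ring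

end Cell

/-! ### Fejér means on the torus -/

section Fejer

open UnitAddTorus

variable {m : ℕ}

local instance : (volume : Measure UnitAddCircle).IsNegInvariant := inferInstance

theorem integral_mFourier (z : Fin m → ℤ) :
    ∫ t : UnitAddTorus (Fin m), mFourier z t = if z = 0 then 1 else 0 := by
  have h := (orthonormal_iff_ite.1 (orthonormal_mFourier (d := Fin m))) 0 z
  rw [ContinuousMap.inner_toLp] at h
  simp only [mFourier_zero, ContinuousMap.one_apply, map_one, mul_one] at h
  rw [h]
  simp [eq_comm]

theorem mFourierCoeff_mFourier (z w : Fin m → ℤ) :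
    mFourierCoeff (mFourier z) w = if z = w then 1 else 0 := by
  have : ∀ t : UnitAddTorus (Fin m), mFourier (-w) t • mFourier z t = mFourier (-w + z) t :=
    fun t => by rw [mFourier_add, smul_eq_mul]
  simp only [mFourierCoeff, this, integral_mFourier]
  congr 1
  rw [neg_add_eq_sub, sub_eq_zero]

theorem mFourier_sub_apply (z : Fin m → ℤ) (t u : UnitAddTorus (Fin m)) :
    mFourier z (t - u) = mFourier z t * mFourier (-z) u := by
  simp only [mFourier, ContinuousMap.coe_mk, ← Finset.prod_mul_distrib]
  refine Finset.prod_congr rfl fun i _ => ?_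
  simp [fourier_apply, sub_eq_add_neg, AddCircle.toCircle_add]

/-- The frequencies `0 ≤ j i ≤ N`. -/
def fejerBox (m N : ℕ) : Finset (Fin m → ℤ) := Fintype.piFinset fun _ => Finset.Ico 0 (N + 1 : ℤ)

theorem card_fejerBox (N : ℕ) : (fejerBox m N).card = (N + 1) ^ m := by
  simp only [fejerBox, Fintype.card_piFinset, Int.card_Ico, sub_zero, Finset.prod_const,
    Finset.card_univ, Fintype.card_fin]
  norm_cast

/-- The frequencies occurring in the Fejér kernel. -/
def fejerSupport (m N : ℕ) : Finset (Fin m → ℤ) :=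
  (fejerBox m N ×ˢ fejerBox m N).image fun q => q.1 - q.2

/-- The Fourier coefficients of the Fejér kernel. -/
def fejerWeight (N : ℕ) (z : Fin m → ℤ) : ℝ :=
  ((N + 1 : ℝ) ^ m)⁻¹ * ((fejerBox m N ×ˢ fejerBox m N).filter fun q => q.1 - q.2 = z).card

/-- The Fejér kernel. -/
def fejerKernel (N : ℕ) (t : UnitAddTorus (Fin m)) : ℝ :=
  ((N + 1 : ℝ) ^ m)⁻¹ * ‖∑ j ∈ fejerBox m N, mFourier j t‖ ^ 2

theorem fejerKernel_nonneg (N : ℕ) (t : UnitAddTorus (Fin m)) : 0 ≤ fejerKernel N t := by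
  unfold fejerKernel; positivity

theorem continuous_fejerKernel (N : ℕ) : Continuous (fejerKernel (m := m) N) := by
  unfold fejerKernel; fun_prop

theorem fejerWeight_eq_zero {N : ℕ} {z : Fin m → ℤ} (hz : z ∉ fejerSupport m N) :
    fejerWeight N z = 0 := by
  rw [fejerWeight, Finset.filter_eq_empty_iff.2, Finset.card_empty]
  · simp
  · intro q hq h
    exact hz (Finset.mem_image.2 ⟨q, hq, h⟩)

/-- Expanding the square gives one character for each difference of two frequencies in the box;
`fejerWeight` counts how often each difference occurs. -/
theorem fejerKernel_eq_sum (N : ℕ) (t : UnitAddTorus (Fin m)) :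
    (fejerKernel N t : ℂ) =
      ∑ z ∈ fejerSupport m N, (fejerWeight N z : ℂ) * mFourier z t := by
  have h1 : ((‖∑ j ∈ fejerBox m N, mFourier j t‖ ^ 2 : ℝ) : ℂ) =
      ∑ q ∈ fejerBox m N ×ˢ fejerBox m N, mFourier (q.1 - q.2) t := by
    rw [Finset.sum_product]
    push_cast
    rw [← Complex.mul_conj', map_sum, Finset.sum_mul_sum]
    refine Finset.sum_congr rfl fun i _ => Finset.sum_congr rfl fun j _ => ?_
    rw [sub_eq_add_neg, mFourier_add, mFourier_neg]
  rw [fejerKernel, Complex.ofReal_mul, h1,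
    Finset.sum_comp (fun z => mFourier z t) (fun q : (Fin m → ℤ) × (Fin m → ℤ) => q.1 - q.2),
    Finset.mul_sum]
  refine Finset.sum_congr rfl fun z _ => ?_
  simp only [fejerWeight, nsmul_eq_mul]
  push_cast
  ring

theorem fejerWeight_zero (N : ℕ) : fejerWeight N (0 : Fin m → ℤ) = 1 := by
  have : ((fejerBox m N ×ˢ fejerBox m N).filter fun q => q.1 - q.2 = 0) = (fejerBox m N).diag := by
    ext q
    simp only [Finset.mem_filter, Finset.mem_product, sub_eq_zero, Finset.mem_diag]
    constructor
    · rintro ⟨⟨h, -⟩, h'⟩; exact ⟨h, h'⟩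
    · rintro ⟨h, h'⟩; exact ⟨⟨h, h' ▸ h⟩, h'⟩
  rw [fejerWeight, this, Finset.diag_card, card_fejerBox]
  push_cast
  exact inv_mul_cancel₀ (by positivity)

/-- A pair with difference `z` is determined by its first member, which ranges over a box with sides
N + 1 - |z_i|. For large `N` the weight is thus the product of the factors 1 - |z_i|/(N + 1). -/
theorem tendsto_fejerWeight (z : Fin m → ℤ) :
    Tendsto (fun N : ℕ => fejerWeight N z) atTop (𝓝 1) := by
  have hcard : ∀ N : ℕ, ((fejerBox m N ×ˢ fejerBox m N).filter fun q => q.1 - q.2 = z).card =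
      ∏ i, (min (N + 1 : ℤ) (N + 1 + z i) - max 0 (z i)).toNat := by
    intro N
    rw [← Finset.prod_congr rfl fun i _ => Int.card_Ico (max 0 (z i)) (min (N + 1 : ℤ) (N + 1 + z i)),
      ← Fintype.card_piFinset]
    refine Finset.card_bij' (fun q _ => q.1) (fun i _ => (i, i - z)) ?_ ?_ ?_ ?_
    · rintro ⟨i, j⟩ h
      simp only [fejerBox, Finset.mem_filter, Finset.mem_product, Fintype.mem_piFinset,
        Finset.mem_Ico] at h ⊢
      obtain ⟨⟨h1, h2⟩, rfl⟩ := h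
      intro l
      have := h1 l; have := h2 l
      simp only [Pi.sub_apply]
      omega
    · intro i h
      simp only [fejerBox, Finset.mem_filter, Finset.mem_product, Fintype.mem_piFinset,
        Finset.mem_Ico, Pi.sub_apply] at h ⊢
      refine ⟨⟨fun l => ?_, fun l => ?_⟩, by simp⟩ <;> have := h l <;> omega
    · rintro ⟨i, j⟩ h
      simp only [Finset.mem_filter] at h
      simp [← h.2]
    · intros; rfl
  have hrew : ∀ N : ℕ, fejerWeight N z =
      ∏ i, ((min (N + 1 : ℤ) (N + 1 + z i) - max 0 (z i)).toNat : ℝ) / (N + 1 : ℝ) := by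
    intro N
    rw [fejerWeight, hcard, Finset.prod_div_distrib]
    push_cast
    simp [div_eq_inv_mul]
  simp_rw [hrew]
  have : ∀ i ∈ Finset.univ, Tendsto (fun N : ℕ =>
      ((min (N + 1 : ℤ) (N + 1 + z i) - max 0 (z i)).toNat : ℝ) / (N + 1 : ℝ)) atTop (𝓝 1) := by
    intro i _
    have h0 : Tendsto (fun N : ℕ => 1 - ((z i).natAbs : ℝ) * (1 / ((N : ℝ) + 1))) atTop (𝓝 1) := by
      simpa using (tendsto_one_div_add_atTop_nhds_zero_nat.const_mul ((z i).natAbs : ℝ)).const_sub 1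
    refine h0.congr' ?_
    -- From here on the side length is nonnegative, so `toNat` truncates nothing.
    filter_upwards [eventually_ge_atTop (z i).natAbs] with N hN
    have h1 : (min (N + 1 : ℤ) (N + 1 + z i) - max 0 (z i)).toNat = (N + 1 : ℤ) - (z i).natAbs := by
      omega
    have h2 : ((min (N + 1 : ℤ) (N + 1 + z i) - max 0 (z i)).toNat : ℝ) = (N + 1 : ℝ) - (z i).natAbs := by
      exact_mod_cast h1
    rw [h2]
    have : (N + 1 : ℝ) ≠ 0 := by positivity
    field_simp
  simpa using tendsto_finsetProd Finset.univ this

theorem integral_fejerKernel (N : ℕ) :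
    ∫ t : UnitAddTorus (Fin m), fejerKernel N t = 1 := by
  have h : ∫ t : UnitAddTorus (Fin m), (fejerKernel N t : ℂ) = 1 := by
    simp_rw [fejerKernel_eq_sum]
    rw [integral_finsetSum _ fun z _ =>
      ((mFourier z).continuous.integrable_of_hasCompactSupport
        (HasCompactSupport.of_compactSpace _)).const_mul _]
    simp_rw [integral_const_mul, integral_mFourier]
    simp only [mul_ite, mul_one, mul_zero, Finset.sum_ite_eq']
    split_ifs with h
    · simp [fejerWeight_zero]
    · have := fejerWeight_eq_zero h
      simp [fejerWeight_zero] at this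
  rw [integral_complex_ofReal] at h
  exact_mod_cast h

/-- The Fejér mean of `f`. -/
def fejerSum (N : ℕ) (f : UnitAddTorus (Fin m) → ℂ) : C(UnitAddTorus (Fin m), ℂ) :=
  ∑ z ∈ fejerSupport m N, ((fejerWeight N z : ℂ) * mFourierCoeff f z) • mFourier z

theorem fejerSum_apply (N : ℕ) (f : UnitAddTorus (Fin m) → ℂ) (t : UnitAddTorus (Fin m)) :
    fejerSum N f t =
      ∑ z ∈ fejerSupport m N, (fejerWeight N z : ℂ) * mFourierCoeff f z * mFourier z t := by
  simp [fejerSum, ContinuousMap.sum_apply]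

theorem integrable_mFourier_smul (z : Fin m → ℤ) {f : UnitAddTorus (Fin m) → ℂ}
    (hf : Integrable f) : Integrable fun t => mFourier z t • f t := by
  refine hf.bdd_mul (c := 1) (mFourier z).continuous.aestronglyMeasurable (ae_of_all _ fun t => ?_)
  exact ((mFourier z).norm_coe_le_norm t).trans_eq mFourier_norm

/-- The convolution form makes positivity of the kernel available; every norm bound on Fejér means
below comes from it. -/
theorem fejerSum_eq_integral (N : ℕ) {f : UnitAddTorus (Fin m) → ℂ} (hf : Integrable f)
    (t : UnitAddTorus (Fin m)) : fejerSum N f t = ∫ u, (fejerKernel N u : ℂ) * f (t - u) := by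
  have hft : Integrable fun u => f (t - u) := hf.comp_sub_left t
  simp_rw [fejerKernel_eq_sum, Finset.sum_mul]
  rw [fejerSum_apply, integral_finsetSum]
  · refine Finset.sum_congr rfl fun z _ => ?_
    simp_rw [mul_assoc]
    rw [integral_const_mul, ← integral_sub_left_eq_self (fun u => mFourier z u * f (t - u)) _ t]
    congr 1
    rw [mul_comm, mFourierCoeff, ← integral_const_mul]
    refine integral_congr_ae (ae_of_all _ fun u => ?_)
    simp only [sub_sub_cancel, smul_eq_mul, ← mul_assoc]
    rw [mFourier_sub_apply]
  · intro z _
    simp_rw [mul_assoc]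
    exact (integrable_mFourier_smul z hft).const_mul _

theorem mFourierCoeff_sub {f g : UnitAddTorus (Fin m) → ℂ} (hf : Integrable f)
    (hg : Integrable g) (z : Fin m → ℤ) :
    mFourierCoeff (f - g) z = mFourierCoeff f z - mFourierCoeff g z := by
  simp only [mFourierCoeff, Pi.sub_apply, smul_sub]
  exact integral_sub (integrable_mFourier_smul _ hf) (integrable_mFourier_smul _ hg)

theorem fejerSum_sub (N : ℕ) {f g : UnitAddTorus (Fin m) → ℂ} (hf : Integrable f)
    (hg : Integrable g) : fejerSum N (f - g) = fejerSum N f - fejerSum N g := by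
  ext t
  simp only [ContinuousMap.sub_apply, fejerSum_apply, mFourierCoeff_sub hf hg, mul_sub, sub_mul,
    Finset.sum_sub_distrib]

theorem continuousMap_integrable (f : C(UnitAddTorus (Fin m), ℂ)) : Integrable f :=
  f.continuous.integrable_of_hasCompactSupport (HasCompactSupport.of_compactSpace _)

/-- The kernel is a probability density, so a Fejér mean is an average of translates. -/
theorem norm_fejerSum_le (N : ℕ) (f : C(UnitAddTorus (Fin m), ℂ)) : ‖fejerSum N f‖ ≤ ‖f‖ := by
  rw [ContinuousMap.norm_le _ (norm_nonneg _)]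
  intro t
  rw [fejerSum_eq_integral N (continuousMap_integrable f)]
  calc ‖∫ u, (fejerKernel N u : ℂ) * f (t - u)‖ ≤ ∫ u, fejerKernel N u * ‖f‖ := by
        refine norm_integral_le_of_norm_le ?_ (ae_of_all _ fun u => ?_)
        · exact ((continuous_fejerKernel N).integrable_of_hasCompactSupport
            (HasCompactSupport.of_compactSpace _)).mul_const _
        · rw [norm_mul, Complex.norm_real, Real.norm_of_nonneg (fejerKernel_nonneg N u)]
          exact mul_le_mul_of_nonneg_left (f.norm_coe_le_norm _) (fejerKernel_nonneg N u)
    _ = ‖f‖ := by rw [integral_mul_const, integral_fejerKernel, one_mul]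

theorem fejerSum_mFourier (N : ℕ) (z : Fin m → ℤ) :
    fejerSum N (mFourier z) = (fejerWeight N z : ℂ) • mFourier z := by
  ext t
  simp only [fejerSum_apply, mFourierCoeff_mFourier, mul_ite, mul_one, mul_zero, ite_mul, zero_mul,
    Finset.sum_ite_eq, ContinuousMap.smul_apply, smul_eq_mul]
  split_ifs with h
  · rfl
  · simp [fejerWeight_eq_zero h]

/-- Convergence is clear on characters since the weights tend to 1. It extends from their dense span
because the means are uniformly contractive. -/
theorem tendsto_fejerSum (g : C(UnitAddTorus (Fin m), ℂ)) :
    Tendsto (fun N : ℕ => fejerSum N g) atTop (𝓝 g) := by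
  have hspan : ∀ g ∈ Submodule.span ℂ (Set.range (mFourier (d := Fin m))),
      Tendsto (fun N : ℕ => fejerSum N g) atTop (𝓝 g) := by
    intro g hg
    induction hg using Submodule.span_induction with
    | mem x hx =>
      obtain ⟨z, rfl⟩ := hx
      simp_rw [fejerSum_mFourier]
      have := ((Complex.continuous_ofReal.tendsto _).comp (tendsto_fejerWeight z)).smul_const
        (mFourier z)
      simpa using this
    | zero =>
      refine tendsto_const_nhds.congr fun N => ?_
      ext t
      simp [fejerSum_apply, mFourierCoeff]
    | add x y _ _ hx hy =>
      refine (hx.add hy).congr fun N => ?_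
      ext t
      rw [ContinuousMap.add_apply]
      simp only [fejerSum_apply, ← Finset.sum_add_distrib, ← add_mul, ← mul_add]
      refine Finset.sum_congr rfl fun z _ => ?_
      congr 2
      simp only [mFourierCoeff, ContinuousMap.coe_add, Pi.add_apply, smul_add]
      exact (integral_add (integrable_mFourier_smul _ (continuousMap_integrable x))
        (integrable_mFourier_smul _ (continuousMap_integrable y))).symm
    | smul c x _ hx =>
      refine (hx.const_smul c).congr fun N => ?_
      simp only [fejerSum, Finset.smul_sum, smul_smul]
      refine Finset.sum_congr rfl fun z _ => ?_
      congr 1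
      rw [mul_left_comm]
      congr 1
      simp only [mFourierCoeff, ContinuousMap.coe_smul, Pi.smul_apply]
      rw [← smul_eq_mul, ← integral_smul]
      exact integral_congr_ae (ae_of_all _ fun t => smul_comm _ _ _)
  have hdense : g ∈ closure (Submodule.span ℂ (Set.range (mFourier (d := Fin m))) : Set _) := by
    rw [← Submodule.topologicalClosure_coe, span_mFourier_closure_eq_top]; trivial
  rw [Metric.tendsto_atTop]
  intro δ hδ
  obtain ⟨h, hh, hgh⟩ := Metric.mem_closure_iff.1 hdense (δ / 3) (by positivity)
  obtain ⟨N₀, hN₀⟩ := Metric.tendsto_atTop.1 (hspan h hh) (δ / 3) (by positivity)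
  refine ⟨N₀, fun N hN => ?_⟩
  have h1 : dist (fejerSum N g) (fejerSum N h) ≤ dist g h := by
    rw [dist_eq_norm, dist_eq_norm, ← fejerSum_sub N (continuousMap_integrable g)
      (continuousMap_integrable h)]
    exact norm_fejerSum_le N (g - h)
  calc dist (fejerSum N g) g
      ≤ dist (fejerSum N g) (fejerSum N h) + dist (fejerSum N h) h + dist h g :=
        dist_triangle4 _ _ _ _
    _ < δ := by rw [dist_comm h g]; linarith [hN₀ N hN]

theorem fejerSum_congr_ae (N : ℕ) {f g : UnitAddTorus (Fin m) → ℂ} (h : f =ᵐ[volume] g) :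
    fejerSum N f = fejerSum N g := by
  have : mFourierCoeff f = mFourierCoeff g := by
    ext z
    refine integral_congr_ae ?_
    filter_upwards [h] with t ht
    rw [ht]
  rw [fejerSum, this, fejerSum]

/-- Jensen's inequality for the density `fejerKernel N`, then Tonelli and translation invariance. -/
theorem eLpNorm_fejerSum_le (N : ℕ) {p : ℝ≥0∞} (hp : 1 ≤ p) (hp' : p ≠ ⊤)
    {f : UnitAddTorus (Fin m) → ℂ} (hf : MemLp f p) :
    eLpNorm (fejerSum N f) p volume ≤ eLpNorm f p volume := by
  -- Genuine measurability makes `f (t - u)` jointly measurable in `(t, u)`, as the exchange of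
  -- integrals requires.
  wlog hm : StronglyMeasurable f generalizing f
  · have hae := hf.aestronglyMeasurable.ae_eq_mk
    rw [fejerSum_congr_ae N hae, eLpNorm_congr_ae hae]
    exact this (hf.ae_eq hae) hf.aestronglyMeasurable.stronglyMeasurable_mk
  have hp0 : p ≠ 0 := (zero_lt_one.trans_le hp).ne'
  have hpr : 0 < p.toReal := ENNReal.toReal_pos hp0 hp'
  have hfi : Integrable f := hf.integrable hp
  have hKm : Measurable fun u : UnitAddTorus (Fin m) => ENNReal.ofReal (fejerKernel N u) :=
    (continuous_fejerKernel N).measurable.ennreal_ofReal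
  set ρ : Measure (UnitAddTorus (Fin m)) :=
    volume.withDensity fun u => ENNReal.ofReal (fejerKernel N u) with hρ
  have hKi : Integrable (fejerKernel (m := m) N) :=
    (continuous_fejerKernel N).integrable_of_hasCompactSupport (HasCompactSupport.of_compactSpace _)
  have hK1 : ∫⁻ u : UnitAddTorus (Fin m), ENNReal.ofReal (fejerKernel N u) = 1 := by
    rw [← ofReal_integral_eq_lintegral_ofReal hKi (ae_of_all _ (fejerKernel_nonneg N)),
      integral_fejerKernel, ENNReal.ofReal_one]
  have : IsProbabilityMeasure ρ := ⟨by
    rw [hρ, withDensity_apply _ MeasurableSet.univ, Measure.restrict_univ, hK1]⟩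
  have hpt : ∀ t, ‖fejerSum N f t‖ₑ ^ p.toReal ≤
      ∫⁻ u, ENNReal.ofReal (fejerKernel N u) * ‖f (t - u)‖ₑ ^ p.toReal := by
    intro t
    have hmt : StronglyMeasurable fun u => f (t - u) :=
      hm.comp_measurable (measurable_const.sub measurable_id)
    -- Monotonicity of `L^p` norms in the exponent, for the probability measure `ρ`, plays the role
    -- of Jensen's inequality.
    have h1 : ‖fejerSum N f t‖ₑ ≤ eLpNorm (fun u => f (t - u)) p ρ := by
      refine le_trans ?_ (eLpNorm_le_eLpNorm_of_exponent_le hp hmt.aestronglyMeasurable)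
      rw [eLpNorm_one_eq_lintegral_enorm, hρ, lintegral_withDensity_eq_lintegral_mul _ hKm
        hmt.enorm, fejerSum_eq_integral N hfi]
      refine (enorm_integral_le_lintegral_enorm _).trans_eq (lintegral_congr fun u => ?_)
      rw [enorm_mul, Pi.mul_apply]
      congr 1
      rw [← ofReal_norm, Complex.norm_real, Real.norm_of_nonneg (fejerKernel_nonneg N u)]
    refine (ENNReal.rpow_le_rpow h1 hpr.le).trans_eq ?_
    rw [eLpNorm_eq_lintegral_rpow_enorm_toReal hp0 hp', ← ENNReal.rpow_mul, one_div,
      inv_mul_cancel₀ hpr.ne', ENNReal.rpow_one, hρ,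
      lintegral_withDensity_eq_lintegral_mul _ hKm (hmt.enorm.pow_const _)]
    rfl
  rw [eLpNorm_eq_lintegral_rpow_enorm_toReal hp0 hp', eLpNorm_eq_lintegral_rpow_enorm_toReal hp0 hp']
  refine ENNReal.rpow_le_rpow ?_ (by positivity)
  calc ∫⁻ t, ‖fejerSum N f t‖ₑ ^ p.toReal
      ≤ ∫⁻ t, ∫⁻ u, ENNReal.ofReal (fejerKernel N u) * ‖f (t - u)‖ₑ ^ p.toReal := lintegral_mono hpt
    _ = ∫⁻ u, ∫⁻ t, ENNReal.ofReal (fejerKernel N u) * ‖f (t - u)‖ₑ ^ p.toReal := by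
        refine lintegral_lintegral_swap (Measurable.aemeasurable ?_)
        exact (hKm.comp measurable_snd).mul
          ((hm.comp_measurable (measurable_fst.sub measurable_snd)).enorm.pow_const _)
    _ = ∫⁻ u, ENNReal.ofReal (fejerKernel N u) * ∫⁻ t, ‖f t‖ₑ ^ p.toReal := by
        refine lintegral_congr fun u => ?_
        have hmu : StronglyMeasurable fun t => f (t - u) :=
          hm.comp_measurable (measurable_id.sub measurable_const)
        rw [lintegral_const_mul _ (hmu.enorm.pow_const _)]
        congr 1
        exact lintegral_sub_right_eq_self (fun t => ‖f t‖ₑ ^ p.toReal) u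
    _ = ∫⁻ t, ‖f t‖ₑ ^ p.toReal := by
        rw [lintegral_mul_const _ hKm, hK1, one_mul]

/-- Approximate `f` by a continuous `g`: contractivity controls the means of `f - g`, and uniform
convergence handles `g`. -/
theorem tendsto_eLpNorm_fejerSum_sub {p : ℝ≥0∞} (hp : 1 ≤ p) (hp' : p ≠ ⊤)
    {f : UnitAddTorus (Fin m) → ℂ} (hf : MemLp f p) :
    Tendsto (fun N : ℕ => eLpNorm (⇑(fejerSum N f) - f) p volume) atTop (𝓝 0) := by
  rw [ENNReal.tendsto_nhds_zero]
  intro δ hδ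
  have hδ3 : δ / 3 ≠ 0 := (ENNReal.div_pos hδ.ne' (by norm_num)).ne'
  obtain ⟨g', hg', hgm⟩ := hf.exists_boundedContinuous_eLpNorm_sub_le hp' hδ3
  set g : C(UnitAddTorus (Fin m), ℂ) := g'.toContinuousMap
  have hgg : ⇑g = ⇑g' := rfl
  rw [← hgg] at hg' hgm
  have hlim : Tendsto (fun N : ℕ => ENNReal.ofReal ‖fejerSum N g - g‖) atTop (𝓝 0) := by
    have := (tendsto_iff_norm_sub_tendsto_zero.1 (tendsto_fejerSum g))
    simpa using ENNReal.tendsto_ofReal this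
  filter_upwards [ENNReal.tendsto_nhds_zero.1 hlim (δ / 3) (pos_iff_ne_zero.2 hδ3)] with N hN
  have hdec : ⇑(fejerSum N f) - f =
      (⇑(fejerSum N (f - ⇑g)) + ⇑(fejerSum N g - g)) - (f - ⇑g) := by
    rw [fejerSum_sub N (hf.integrable hp) (hgm.integrable hp)]
    ext t
    simp
  have hm1 : ∀ h : C(UnitAddTorus (Fin m), ℂ), AEStronglyMeasurable h volume :=
    fun h => h.continuous.aestronglyMeasurable
  have hmid : eLpNorm ⇑(fejerSum N g - g) p volume ≤ δ / 3 := by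
    refine le_trans ?_ hN
    refine (eLpNorm_le_of_ae_bound (C := ‖fejerSum N g - g‖)
      (ae_of_all _ fun t => ContinuousMap.norm_coe_le_norm _ t)).trans_eq ?_
    simp
  calc eLpNorm (⇑(fejerSum N f) - f) p volume
      ≤ eLpNorm (⇑(fejerSum N (f - ⇑g)) + ⇑(fejerSum N g - g)) p volume +
          eLpNorm (f - ⇑g) p volume := by
        rw [hdec]
        exact eLpNorm_sub_le ((hm1 _).add (hm1 _))
          (hf.aestronglyMeasurable.sub hgm.aestronglyMeasurable) hp
    _ ≤ (eLpNorm ⇑(fejerSum N (f - ⇑g)) p volume + eLpNorm ⇑(fejerSum N g - g) p volume) +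
          eLpNorm (f - ⇑g) p volume := by
        gcongr
        exact eLpNorm_add_le (hm1 _) (hm1 _) hp
    _ ≤ (δ / 3 + δ / 3) + δ / 3 := by
        gcongr
        exact (eLpNorm_fejerSum_le N hp hp' (hf.sub hgm)).trans hg'
    _ = δ := ENNReal.add_thirds δ

end Fejer

/-! ### Bounded continuous periodic functions -/

section BoundedPeriodic

open UnitAddTorus BoundedContinuousFunction

variable {n m : ℕ} (a : Eucl m) (b : Module.Basis (Fin m) ℝ (Eucl m))

/-- Open quotient maps, unlike general quotient maps, are stable under products; the next lemma
needs the product with a parameter space. -/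
theorem isOpenQuotientMap_cellProj : IsOpenQuotientMap (cellProj b) := by
  have h1 : IsOpenQuotientMap (Pi.map fun (_ : Fin m) (x : ℝ) => (x : UnitAddCircle)) :=
    IsOpenQuotientMap.piMap fun _ => QuotientAddGroup.isOpenQuotientMap_mk
  exact h1.comp b.equivFun.toContinuousLinearEquiv.toHomeomorph.isOpenQuotientMap

/-- Periodicity lets `F` descend along `id × cellProj`. Currying then gives continuity in `x` for
the compact-open topology, which on the compact torus is uniform convergence. -/
theorem exists_torus_continuousMap {E X : Type*} [TopologicalSpace E] [TopologicalSpace X]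
    {F : X × Eucl m → E} (hF : Continuous F) (hper : ∀ x, CellPeriodic b fun y => F (x, y)) :
    ∃ G : C(X, C(UnitAddTorus (Fin m), E)), ∀ x y, G x (cellProj b y) = F (x, y) := by
  have hq : IsOpenQuotientMap (Prod.map (id : X → X) (cellProj b)) :=
    IsOpenQuotientMap.id.prodMap (isOpenQuotientMap_cellProj b)
  let G : X × UnitAddTorus (Fin m) → E := fun z => F (z.1, cellSection 0 b z.2)
  have hG : ∀ x y, G (x, cellProj b y) = F (x, y) := fun x y => (hper x).section_proj 0 y
  have hGc : Continuous G := by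
    rw [hq.isQuotientMap.continuous_iff]
    exact hF.congr fun z => (hG z.1 z.2).symm
  exact ⟨(ContinuousMap.mk G hGc).curry, hG⟩

/-- A continuous function of `(x, y)`, periodic in `y`, is a continuous family of bounded continuous
functions of `y`. -/
theorem exists_continuous_boundedFamily {E X : Type*} [NormedAddCommGroup E] [TopologicalSpace X]
    {F : X × Eucl m → E} (hF : Continuous F) (hper : ∀ x, CellPeriodic b fun y => F (x, y)) :
    ∃ G : X → BoundedContinuousFunction (Eucl m) E, Continuous G ∧ ∀ x y, G x y = F (x, y) := by
  obtain ⟨G, hG⟩ := exists_torus_continuousMap b hF hper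
  refine ⟨fun x => (mkOfCompact (G x)).compContinuous ⟨cellProj b, continuous_cellProj b⟩, ?_, hG⟩
  refine (continuous_compContinuous _).comp ?_
  exact (ContinuousMap.isUniformEmbedding_equivBoundedOfCompact _ _).uniformContinuous.continuous.comp
    G.continuous

/-- The character with frequency `freq b z`, as a bounded continuous function. -/
def cellExp (z : Fin m → ℤ) : BoundedContinuousFunction (Eucl m) ℂ :=
  (mkOfCompact (mFourier z)).compContinuous ⟨cellProj b, continuous_cellProj b⟩

theorem cellExp_apply (z : Fin m → ℤ) (y : Eucl m) : cellExp b z y = mFourier z (cellProj b y) :=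
  rfl

/-- The Fourier coefficient of a bounded continuous function over the cell. -/
def cellCoeff (z : Fin m → ℤ) (f : BoundedContinuousFunction (Eucl m) ℂ) : ℂ :=
  mFourierCoeff (fun t => f (cellSection a b t)) z

theorem integrable_comp_cellSection (f : BoundedContinuousFunction (Eucl m) ℂ) :
    Integrable fun t => f (cellSection a b t) :=
  Integrable.of_bound ((f.continuous.measurable.comp
    (measurable_cellSection a b)).aestronglyMeasurable) ‖f‖ (ae_of_all _ fun _ => f.norm_coe_le_norm _)

theorem norm_cellCoeff_sub_le (z : Fin m → ℤ) (f g : BoundedContinuousFunction (Eucl m) ℂ) :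
    ‖cellCoeff a b z f - cellCoeff a b z g‖ ≤ ‖f - g‖ := by
  rw [cellCoeff, cellCoeff, ← mFourierCoeff_sub (integrable_comp_cellSection a b f)
    (integrable_comp_cellSection a b g), mFourierCoeff]
  refine (norm_integral_le_of_norm_le_const (C := ‖f - g‖) (ae_of_all _ fun t => ?_)).trans_eq
    (by simp)
  rw [norm_smul]
  have h1 : ‖mFourier (-z) t‖ ≤ 1 := ((mFourier (-z)).norm_coe_le_norm t).trans_eq mFourier_norm
  have h2 : ‖((fun t => f (cellSection a b t)) - fun t => g (cellSection a b t)) t‖ ≤ ‖f - g‖ :=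
    (f - g).norm_coe_le_norm (cellSection a b t)
  calc _ ≤ 1 * ‖f - g‖ := mul_le_mul h1 h2 (norm_nonneg _) zero_le_one
    _ = _ := one_mul _

theorem cellCoeff_zero_fun (z : Fin m → ℤ) : cellCoeff a b z 0 = 0 := by
  simp [cellCoeff, mFourierCoeff]

theorem norm_cellCoeff_le (z : Fin m → ℤ) (f : BoundedContinuousFunction (Eucl m) ℂ) :
    ‖cellCoeff a b z f‖ ≤ ‖f‖ := by
  simpa [cellCoeff_zero_fun] using norm_cellCoeff_sub_le a b z f 0

theorem continuous_cellCoeff (z : Fin m → ℤ) : Continuous (cellCoeff a b z) :=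
  (LipschitzWith.of_dist_le_mul (K := 1) fun f g => by
    simpa [dist_eq_norm] using norm_cellCoeff_sub_le a b z f g).continuous

/-- The Fejér mean of a bounded continuous periodic function. -/
def cellFejer (N : ℕ) (f : BoundedContinuousFunction (Eucl m) ℂ) :
    BoundedContinuousFunction (Eucl m) ℂ :=
  ∑ z ∈ fejerSupport m N, ((fejerWeight N z : ℂ) * cellCoeff a b z f) • cellExp b z

theorem cellFejer_apply (N : ℕ) (f : BoundedContinuousFunction (Eucl m) ℂ) (y : Eucl m) :
    cellFejer a b N f y = ∑ z ∈ fejerSupport m N,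
      (fejerWeight N z : ℂ) * (cellCoeff a b z f * mFourier z (cellProj b y)) := by
  simp [cellFejer, cellExp_apply, mul_assoc]

theorem continuous_cellFejer (N : ℕ) : Continuous (cellFejer a b N) := by
  unfold cellFejer
  exact continuous_finsetSum _ fun z _ =>
    ((continuous_const.mul (continuous_cellCoeff a b z)).smul continuous_const)

-- A periodic `f` is a continuous function on the torus read through `cellProj`, so uniform Fejér
-- estimates transfer. They give the domination and the pointwise convergence used in the mean value
-- statement.
variable {b} in
theorem exists_norm_cellFejer_sub {f : BoundedContinuousFunction (Eucl m) ℂ}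
    (hf : CellPeriodic b f) : ∃ g : C(UnitAddTorus (Fin m), ℂ), ‖g‖ ≤ ‖f‖ ∧
      ∀ N, ‖cellFejer a b N f - f‖ ≤ ‖fejerSum N g - g‖ := by
  obtain ⟨G, hG⟩ := exists_torus_continuousMap (X := Unit) b (F := fun z => f z.2)
    (f.continuous.comp continuous_snd) fun _ => hf
  have hGs : ∀ t, G () t = f (cellSection a b t) := fun t => by
    rw [← hG () (cellSection a b t), cellProj_cellSection]
  refine ⟨G (), (ContinuousMap.norm_le _ (norm_nonneg _)).2 fun t => ?_, fun N => ?_⟩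
  · rw [hGs]; exact f.norm_coe_le_norm _
  · rw [BoundedContinuousFunction.norm_le (norm_nonneg _)]
    intro y
    have : (cellFejer a b N f - f) y = (fejerSum N (G ()) - G ()) (cellProj b y) := by
      rw [BoundedContinuousFunction.coe_sub, Pi.sub_apply, ContinuousMap.sub_apply, hG,
        cellFejer_apply, fejerSum_apply]
      simp only [cellCoeff, ← hGs, mul_assoc]
    rw [this]
    exact ContinuousMap.norm_coe_le_norm _ _

variable {b} in
theorem norm_cellFejer_sub_le {f : BoundedContinuousFunction (Eucl m) ℂ} (hf : CellPeriodic b f)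
    (N : ℕ) : ‖cellFejer a b N f - f‖ ≤ 2 * ‖f‖ := by
  obtain ⟨g, hg, h⟩ := exists_norm_cellFejer_sub a hf
  calc _ ≤ ‖fejerSum N g - g‖ := h N
    _ ≤ ‖fejerSum N g‖ + ‖g‖ := norm_sub_le _ _
    _ ≤ 2 * ‖f‖ := by linarith [norm_fejerSum_le N g]

variable {b} in
theorem tendsto_norm_cellFejer_sub {f : BoundedContinuousFunction (Eucl m) ℂ}
    (hf : CellPeriodic b f) : Tendsto (fun N => ‖cellFejer a b N f - f‖) atTop (𝓝 0) := by
  obtain ⟨g, hg, h⟩ := exists_norm_cellFejer_sub a hf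
  exact squeeze_zero (fun _ => norm_nonneg _) h
    (tendsto_iff_norm_sub_tendsto_zero.1 (tendsto_fejerSum g))

/-! ### Mean values of oscillating functions -/

theorem inner_toEuclideanLin (R : Matrix (Fin m) (Fin n) ℝ) (k : Eucl m) (x : Eucl n) :
    inner ℝ k (R.toEuclideanLin x) = inner ℝ (R.transpose.toEuclideanLin k) x := by
  rw [← Matrix.conjTranspose_eq_transpose_of_trivial, Matrix.toEuclideanLin_conjTranspose_eq_adjoint,
    LinearMap.adjoint_inner_left]

theorem continuous_toEuclideanLin (R : Matrix (Fin m) (Fin n) ℝ) :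
    Continuous fun x => R.toEuclideanLin x :=
  LinearMap.continuous_of_finiteDimensional _

/-- The Riemann–Lebesgue lemma along the frequencies `s j • ξ`, which leave every compact set. No
integrability of `c` is needed: otherwise all the integrals take the default value 0. -/
theorem tendsto_integral_mul_exp {ι : Type*} {l : Filter ι} {s : ι → ℝ}
    (hs : Tendsto s l atTop) {ξ : Eucl n} (hξ : ξ ≠ 0) {Ω : Set (Eucl n)}
    (hΩ : MeasurableSet Ω) (c : Eucl n → ℂ) :
    Tendsto (fun j => ∫ x in Ω, c x *
      Complex.exp (2 * (Real.pi : ℂ) * Complex.I * ((inner ℝ ξ (s j • x) : ℝ) : ℂ))) l (𝓝 0) := by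
  have h := tendsto_integral_exp_inner_smul_cocompact (V := Eucl n) (Ω.indicator c)
  have h2 : Tendsto (fun j => -(s j • ξ)) l (cocompact (Eucl n)) := by
    rw [← Metric.cobounded_eq_cocompact, ← tendsto_norm_atTop_iff_cobounded]
    simp only [norm_neg, norm_smul]
    exact (tendsto_norm_atTop_atTop.comp hs).atTop_mul_const (norm_pos_iff.2 hξ)
  refine (h.comp h2).congr fun j => ?_
  rw [Function.comp_apply, ← integral_indicator hΩ]
  refine integral_congr_ae (ae_of_all _ fun x => ?_)
  by_cases hx : x ∈ Ω
  · simp only [Set.indicator_of_mem hx]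
    rw [Circle.smul_def, Real.fourierChar_apply, smul_eq_mul, mul_comm]
    congr 2
    simp only [inner_neg_right, neg_neg, inner_smul_right, real_inner_comm x ξ]
    push_cast
    ring
  · simp [hx]

theorem mFourier_cellProj_oscillating (R : Matrix (Fin m) (Fin n) ℝ) (z : Fin m → ℤ) (s : ℝ)
    (x : Eucl n) : mFourier z (cellProj b (s • R.toEuclideanLin x)) =
      Complex.exp (2 * (Real.pi : ℂ) * Complex.I *
        ((inner ℝ (R.transpose.toEuclideanLin (freq b z)) (s • x) : ℝ) : ℂ)) := by
  rw [mFourier_cellProj, ← map_smul, inner_toEuclideanLin]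

theorem continuous_oscillation (R : Matrix (Fin m) (Fin n) ℝ) (s : ℝ) :
    Continuous fun x : Eucl n => s • R.toEuclideanLin x :=
  (continuous_toEuclideanLin R).const_smul s

/-- Evaluation is jointly continuous in the function and the point, so Bochner measurability of `ψ`
makes its trace along a plane measurable. -/
theorem aestronglyMeasurable_eval {E : Type*} [NormedAddCommGroup E] {μ : Measure (Eucl n)}
    {ψ : Eucl n → BoundedContinuousFunction (Eucl m) E} (hψ : AEStronglyMeasurable ψ μ)
    {g : Eucl n → Eucl m} (hg : Continuous g) : AEStronglyMeasurable (fun x => ψ x (g x)) μ :=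
  (continuous_eval (F := BoundedContinuousFunction (Eucl m) E)).comp_aestronglyMeasurable
    (hψ.prodMk hg.aestronglyMeasurable)

theorem integrable_eval {E : Type*} [NormedAddCommGroup E] {μ : Measure (Eucl n)}
    {ψ : Eucl n → BoundedContinuousFunction (Eucl m) E} (hψ : Integrable ψ μ)
    {g : Eucl n → Eucl m} (hg : Continuous g) : Integrable (fun x => ψ x (g x)) μ :=
  hψ.norm.mono' (aestronglyMeasurable_eval hψ.aestronglyMeasurable hg)
    (ae_of_all _ fun x => (ψ x).norm_coe_le_norm _)

theorem integrable_cellCoeff {μ : Measure (Eucl n)} (z : Fin m → ℤ)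
    {ψ : Eucl n → BoundedContinuousFunction (Eucl m) ℂ} (hψ : Integrable ψ μ) :
    Integrable (fun x => cellCoeff a b z (ψ x)) μ :=
  hψ.norm.mono' ((continuous_cellCoeff a b z).comp_aestronglyMeasurable hψ.aestronglyMeasurable)
    (ae_of_all _ fun x => norm_cellCoeff_le a b z (ψ x))

theorem integrable_coeff_mul_mFourier {μ : Measure (Eucl n)} (z : Fin m → ℤ) {c : Eucl n → ℂ}
    (hc : Integrable c μ) {g : Eucl n → Eucl m} (hg : Continuous g) :
    Integrable (fun x => c x * mFourier z (cellProj b (g x))) μ := by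
  refine hc.mul_bdd (c := 1) (((mFourier z).continuous.comp
    ((continuous_cellProj b).comp hg)).aestronglyMeasurable) (ae_of_all _ fun x => ?_)
  exact ((mFourier z).norm_coe_le_norm _).trans_eq mFourier_norm

variable {b} in
/-- Functions in `L¹(Ω; C_#(Y))`, evaluated along the plane `y = R x / ε`, have mean values converging
to the average over `Ω × Y`. -/
theorem tendsto_integral_oscillating {R : Matrix (Fin m) (Fin n) ℝ} (hR : IrrationalityCondition R b)
    {s : ℕ → ℝ} (hs : Tendsto s atTop atTop) {Ω : Set (Eucl n)} (hΩ : MeasurableSet Ω)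
    {ψ : Eucl n → BoundedContinuousFunction (Eucl m) ℂ} (hψ : Integrable ψ (volume.restrict Ω))
    (hper : ∀ x, CellPeriodic b (ψ x)) :
    Tendsto (fun j => ∫ x in Ω, ψ x (s j • R.toEuclideanLin x)) atTop
      (𝓝 (∫ x in Ω, ⨍ y in parallelotope a b, ψ x y)) := by
  have hlimeq : ∫ x in Ω, ⨍ y in parallelotope a b, ψ x y = ∫ x in Ω, cellCoeff a b 0 (ψ x) := by
    refine integral_congr_ae (ae_of_all _ fun x => ?_)
    simp only [average_cell_eq, cellCoeff, mFourierCoeff]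
    simp [mFourier_zero]
  rw [hlimeq]
  -- The Fejér means converge in `L¹(Ω; C_#)`. The sup norm in `y` is essential: it bounds the error
  -- on the plane `y = Rx/ε` uniformly in `ε`.
  have happrox : Tendsto (fun N => ∫ x in Ω, ‖cellFejer a b N (ψ x) - ψ x‖) atTop (𝓝 0) := by
    have := tendsto_integral_of_dominated_convergence (μ := volume.restrict Ω)
      (F := fun N x => ‖cellFejer a b N (ψ x) - ψ x‖) (f := fun _ => (0 : ℝ))
      (fun x => 2 * ‖ψ x‖)
      (fun N => (((continuous_cellFejer a b N).comp_aestronglyMeasurable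
        hψ.aestronglyMeasurable).sub hψ.aestronglyMeasurable).norm)
      (hψ.norm.const_mul 2)
      (fun N => ae_of_all _ fun x => by
        rw [norm_norm]; exact norm_cellFejer_sub_le a (hper x) N)
      (ae_of_all _ fun x => tendsto_norm_cellFejer_sub a (hper x))
    simpa using this
  have htrig : ∀ N, Tendsto (fun j => ∫ x in Ω, cellFejer a b N (ψ x) (s j • R.toEuclideanLin x))
      atTop (𝓝 (∫ x in Ω, cellCoeff a b 0 (ψ x))) := by
    intro N
    have hsum : ∀ j, ∫ x in Ω, cellFejer a b N (ψ x) (s j • R.toEuclideanLin x) =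
        ∑ z ∈ fejerSupport m N, (fejerWeight N z : ℂ) * ∫ x in Ω, cellCoeff a b z (ψ x) *
          mFourier z (cellProj b (s j • R.toEuclideanLin x)) := by
      intro j
      simp_rw [cellFejer_apply, ← integral_const_mul]
      exact integral_finsetSum _ fun z _ => (integrable_coeff_mul_mFourier b z
        (integrable_cellCoeff a b z hψ) (continuous_oscillation R (s j))).const_mul _
    have hzero : (0 : Fin m → ℤ) ∈ fejerSupport m N := by
      by_contra h
      simpa [fejerWeight_zero] using fejerWeight_eq_zero h
    have hlim : ∫ x in Ω, cellCoeff a b 0 (ψ x) = ∑ z ∈ fejerSupport m N,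
        (fejerWeight N z : ℂ) * if z = 0 then ∫ x in Ω, cellCoeff a b 0 (ψ x) else 0 := by
      simp [hzero, fejerWeight_zero]
    simp_rw [hsum]
    rw [hlim]
    refine tendsto_finsetSum _ fun z _ => Tendsto.const_mul _ ?_
    split_ifs with hz
    · subst hz
      simp [mFourier_zero]
    · simp_rw [mFourier_cellProj_oscillating]
      refine tendsto_integral_mul_exp hs ?_ hΩ _
      -- The irrationality condition provides the nonzero frequency in `x` on which Riemann–Lebesgue
      -- acts.
      exact hR _ (freq_mem_dualLattice b z) (mt (freq_eq_zero_iff b).1 hz)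
  rw [Metric.tendsto_atTop]
  intro δ hδ
  obtain ⟨N, hN⟩ := (Metric.tendsto_atTop.1 happrox (δ / 2) (half_pos hδ))
  have hN := hN N le_rfl
  obtain ⟨J, hJ⟩ := Metric.tendsto_atTop.1 (htrig N) (δ / 2) (half_pos hδ)
  refine ⟨J, fun j hj => ?_⟩
  have hψN : Integrable (fun x => cellFejer a b N (ψ x)) (volume.restrict Ω) := by
    unfold cellFejer
    exact integrable_finsetSum _ fun z _ =>
      ((integrable_cellCoeff a b z hψ).const_mul _).smul_const _
  have h1 : dist (∫ x in Ω, ψ x (s j • R.toEuclideanLin x))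
      (∫ x in Ω, cellFejer a b N (ψ x) (s j • R.toEuclideanLin x)) < δ / 2 := by
    rw [dist_comm, dist_eq_norm, ← integral_sub (integrable_eval hψN (continuous_oscillation R _))
      (integrable_eval hψ (continuous_oscillation R _))]
    refine lt_of_le_of_lt ?_ (lt_of_le_of_lt (le_abs_self _) (by simpa [dist_eq_norm] using hN))
    refine norm_integral_le_of_norm_le (hψN.sub hψ).norm (ae_of_all _ fun x => ?_)
    exact (cellFejer a b N (ψ x) - ψ x).norm_coe_le_norm _
  calc _ ≤ _ := dist_triangle _ (∫ x in Ω, cellFejer a b N (ψ x) (s j • R.toEuclideanLin x)) _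
    _ < δ := by linarith [hJ j hj]

variable {b} in
theorem tendsto_integral_oscillating_real {R : Matrix (Fin m) (Fin n) ℝ}
    (hR : IrrationalityCondition R b)
    {s : ℕ → ℝ} (hs : Tendsto s atTop atTop) {Ω : Set (Eucl n)} (hΩ : MeasurableSet Ω)
    {ψ : Eucl n → BoundedContinuousFunction (Eucl m) ℝ} (hψ : Integrable ψ (volume.restrict Ω))
    (hper : ∀ x, CellPeriodic b (ψ x)) :
    Tendsto (fun j => ∫ x in Ω, ψ x (s j • R.toEuclideanLin x)) atTop
      (𝓝 (∫ x in Ω, ⨍ y in parallelotope a b, ψ x y)) := by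
  have h := tendsto_integral_oscillating a hR hs hΩ
    (ψ := fun x => Complex.ofRealCLM.compLeftContinuousBounded (Eucl m) (ψ x))
    ((Complex.ofRealCLM.compLeftContinuousBounded (Eucl m)).integrable_comp hψ)
    (fun x i y => by
      simp only [ContinuousLinearMap.compLeftContinuousBounded_apply]; rw [hper x i y])
  simp only [ContinuousLinearMap.compLeftContinuousBounded_apply, Complex.ofRealCLM_apply,
    average_cell_eq, integral_complex_ofReal] at h
  simpa [average_cell_eq, Function.comp_def] using (Complex.continuous_re.tendsto _).comp h

theorem integrable_integral_cellSection {μ : Measure (Eucl n)}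
    {ψ : Eucl n → BoundedContinuousFunction (Eucl m) ℝ} (hψ : Integrable ψ μ) :
    Integrable (fun x => ∫ t, ψ x (cellSection a b t)) μ := by
  have hc := integrable_cellCoeff a b 0
    ((Complex.ofRealCLM.compLeftContinuousBounded (Eucl m)).integrable_comp hψ)
  simpa [cellCoeff, mFourierCoeff, mFourier_zero, integral_complex_ofReal] using hc.re

/-- A component of a bounded continuous vector field. -/
def boundedComponent {d : ℕ} (l : Fin d) :
    BoundedContinuousFunction (Eucl m) (Eucl d) →L[ℝ] BoundedContinuousFunction (Eucl m) ℝ :=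
  (EuclideanSpace.proj l : Eucl d →L[ℝ] ℝ).compLeftContinuousBounded (Eucl m)

theorem boundedComponent_apply {d : ℕ} (l : Fin d)
    (f : BoundedContinuousFunction (Eucl m) (Eucl d)) (y : Eucl m) :
    boundedComponent l f y = f y l := rfl

theorem integrable_boundedComponent_mul {d : ℕ} {μ : Measure (Eucl n)} {p q : ℝ≥0∞}
    (hpq : p⁻¹ + q⁻¹ = 1) {U φ : Eucl n → BoundedContinuousFunction (Eucl m) (Eucl d)}
    (hU : MemLp U p μ) (hφ : MemLp φ q μ) (l : Fin d) :
    Integrable (fun x => boundedComponent l (U x) * boundedComponent l (φ x)) μ := by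
  have : ENNReal.HolderTriple p q 1 := ⟨by simpa using hpq⟩
  have h1 : MemLp (fun x => boundedComponent l (U x)) p μ := (boundedComponent l).comp_memLp' hU
  have h2 : MemLp (fun x => boundedComponent l (φ x)) q μ := (boundedComponent l).comp_memLp' hφ
  exact memLp_one_iff_integrable.1 (h2.mul' h1)

variable {b} in
/-- Mean values of products of oscillating functions. -/
theorem tendsto_integral_inner_oscillating {R : Matrix (Fin m) (Fin n) ℝ} {d : ℕ}
    (hR : IrrationalityCondition R b)
    {s : ℕ → ℝ} (hs : Tendsto s atTop atTop) {Ω : Set (Eucl n)} (hΩ : MeasurableSet Ω)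
    {p q : ℝ≥0∞} (hpq : p⁻¹ + q⁻¹ = 1)
    {U φ : Eucl n → BoundedContinuousFunction (Eucl m) (Eucl d)}
    (hU : MemLp U p (volume.restrict Ω)) (hUper : ∀ x, CellPeriodic b (U x))
    (hφ : MemLp φ q (volume.restrict Ω)) (hφper : ∀ x, CellPeriodic b (φ x)) :
    Tendsto (fun j => ∫ x in Ω, inner ℝ (U x (s j • R.toEuclideanLin x))
        (φ x (s j • R.toEuclideanLin x))) atTop
      (𝓝 (∫ x in Ω, ⨍ y in parallelotope a b, inner ℝ (U x y) (φ x y))) := by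
  -- Componentwise products stay in the algebra of bounded continuous functions, and Hölder puts
  -- them in `L¹(Ω; C_b)`, where the scalar statement applies.
  have hl : ∀ l, Integrable (fun x => boundedComponent l (U x) * boundedComponent l (φ x))
      (volume.restrict Ω) := integrable_boundedComponent_mul hpq hU hφ
  have hval : ∀ x y, inner ℝ (U x y) (φ x y) =
      ∑ l, (boundedComponent l (U x) * boundedComponent l (φ x)) y := by
    intro x y
    simp [boundedComponent_apply, PiLp.inner_apply, mul_comm]
  have hint : ∀ x l, Integrable fun t =>
      (boundedComponent l (U x) * boundedComponent l (φ x)) (cellSection a b t) := fun x l =>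
    Integrable.of_bound ((BoundedContinuousFunction.continuous _).measurable.comp
      (measurable_cellSection a b)).aestronglyMeasurable _
      (ae_of_all _ fun _ => BoundedContinuousFunction.norm_coe_le_norm _ _)
  have hsum := tendsto_finsetSum Finset.univ fun l _ =>
    tendsto_integral_oscillating_real a hR hs hΩ (hl l) fun x i y => by
      simp only [BoundedContinuousFunction.mul_apply, boundedComponent_apply, hUper x i y,
        hφper x i y]
  simp_rw [hval]
  refine (hsum.congr fun j => ?_).trans (le_of_eq ?_)
  · rw [← integral_finsetSum]
    exact fun l _ => integrable_eval (hl l) (continuous_oscillation R _)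
  · congr 1
    simp only [average_cell_eq]
    simp_rw [integral_finsetSum _ fun l _ => hint _ l]
    rw [integral_finsetSum]
    exact fun l _ => integrable_integral_cellSection a b (hl l)

end BoundedPeriodic

/-! ### Oscillating fields -/

section Oscillating

open BoundedContinuousFunction

variable {n m : ℕ} (a : Eucl m) {b : Module.Basis (Fin m) ℝ (Eucl m)}

/-- A continuous function of `(x, y)`, periodic in `y` and vanishing for `x` outside `K`. -/
structure IsOscillatingField {E : Type*} [NormedAddCommGroup E]
    (b : Module.Basis (Fin m) ℝ (Eucl m)) (K : Set (Eucl n)) (F : Eucl n × Eucl m → E) : Prop where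
  continuous : Continuous F
  periodic : ∀ x, CellPeriodic b fun y => F (x, y)
  eq_zero : ∀ x ∉ K, ∀ y, F (x, y) = 0

variable {E : Type*} [NormedAddCommGroup E] {K : Set (Eucl n)} {F : Eucl n × Eucl m → E}

theorem IsOscillatingField.exists_boundedFamily (hF : IsOscillatingField b K F) (hK : IsCompact K) :
    ∃ G : Eucl n → BoundedContinuousFunction (Eucl m) E, Continuous G ∧ HasCompactSupport G ∧
      ∀ x y, G x y = F (x, y) := by
  obtain ⟨G, hG, hGF⟩ := exists_continuous_boundedFamily b hF.continuous hF.periodic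
  refine ⟨G, hG, HasCompactSupport.intro hK fun x hx => ?_, hGF⟩
  ext y
  rw [hGF, hF.eq_zero x hx]; rfl

theorem IsOscillatingField.exists_bound (hF : IsOscillatingField b K F) (hK : IsCompact K) :
    ∃ C, 0 ≤ C ∧ ∀ z, ‖F z‖ ≤ C := by
  obtain ⟨G, hG, hGs, hGF⟩ := hF.exists_boundedFamily hK
  obtain ⟨C, hC⟩ := hGs.exists_bound_of_continuous hG
  refine ⟨C, (norm_nonneg _).trans (hC 0), fun z => ?_⟩
  rw [← Prod.mk.eta (p := z), ← hGF]
  exact ((G z.1).norm_coe_le_norm _).trans (hC _)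

/-- The function ‖F‖^p is again an oscillating field, so its mean value is the limit of the `p`-th
powers of the norms. This asymptotic isometry is what controls the diagonal sequence later. -/
theorem tendsto_eLpNorm_oscillating {R : Matrix (Fin m) (Fin n) ℝ}
    (hF : IsOscillatingField b K F) (hK : IsCompact K)
    (hR : IrrationalityCondition R b) {s : ℕ → ℝ} (hs : Tendsto s atTop atTop) {Ω : Set (Eucl n)}
    (hΩ : MeasurableSet Ω) {p : ℝ≥0∞} (hp : p ≠ 0) (hp' : p ≠ ⊤) :
    Tendsto (fun j => eLpNorm (fun x => F (x, s j • R.toEuclideanLin x)) p (volume.restrict Ω)) atTop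
      (𝓝 (eLpNorm (fun z : Eucl n × UnitAddTorus (Fin m) => F (z.1, cellSection a b z.2)) p
        ((volume.restrict Ω).prod volume))) := by
  have hpr : 0 < p.toReal := ENNReal.toReal_pos hp hp'
  have hpow : IsOscillatingField b K fun z => ‖F z‖ ^ p.toReal :=
    ⟨hF.continuous.norm.rpow_const fun _ => Or.inr hpr.le,
      fun x i y => by simp only [hF.periodic x i y],
      fun x hx y => by rw [hF.eq_zero x hx, norm_zero, Real.zero_rpow hpr.ne']⟩
  obtain ⟨G, hG, hGs, hGF⟩ := hpow.exists_boundedFamily hK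
  have hGi : Integrable G (volume.restrict Ω) :=
    (hG.integrable_of_hasCompactSupport hGs).restrict
  have hlim := tendsto_integral_oscillating_real a hR hs hΩ hGi fun x i y => by
    rw [hGF, hGF]; exact hpow.periodic x i y
  simp only [average_cell_eq] at hlim
  have henorm : ∀ z, ‖F z‖ₑ ^ p.toReal = ENNReal.ofReal (‖F z‖ ^ p.toReal) := fun z => by
    rw [← ofReal_norm, ENNReal.ofReal_rpow_of_nonneg (norm_nonneg _) hpr.le]
  have hleft : ∀ j, ENNReal.ofReal (∫ x in Ω, G x (s j • R.toEuclideanLin x)) =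
      ∫⁻ x in Ω, ‖F (x, s j • R.toEuclideanLin x)‖ₑ ^ p.toReal := by
    intro j
    rw [ofReal_integral_eq_lintegral_ofReal (integrable_eval hGi (continuous_oscillation R _))
      (ae_of_all _ fun x => by simp only [hGF, Pi.zero_apply]; positivity)]
    simp only [hGF, henorm]
  have hright : ENNReal.ofReal (∫ x in Ω, ∫ t, G x (cellSection a b t)) =
      ∫⁻ z : Eucl n × UnitAddTorus (Fin m), ‖F (z.1, cellSection a b z.2)‖ₑ ^ p.toReal
        ∂((volume.restrict Ω).prod volume) := by
    have hmeas : Measurable fun z : Eucl n × UnitAddTorus (Fin m) =>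
        ‖F (z.1, cellSection a b z.2)‖ₑ ^ p.toReal := by
      have : Measurable fun z : Eucl n × UnitAddTorus (Fin m) => (z.1, cellSection a b z.2) :=
        measurable_fst.prodMk ((measurable_cellSection a b).comp measurable_snd)
      exact ((continuous_enorm.comp hF.continuous).measurable.comp this).pow_const _
    rw [lintegral_prod _ hmeas.aemeasurable,
      ofReal_integral_eq_lintegral_ofReal (integrable_integral_cellSection a b hGi)
      (ae_of_all _ fun x => integral_nonneg fun t => by
        simp only [hGF, Pi.zero_apply]; positivity)]
    refine lintegral_congr fun x => ?_
    rw [ofReal_integral_eq_lintegral_ofReal]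
    · simp only [hGF, henorm]
    · exact Integrable.of_bound ((G x).continuous.measurable.comp
        (measurable_cellSection a b)).aestronglyMeasurable _
        (ae_of_all _ fun _ => BoundedContinuousFunction.norm_coe_le_norm _ _)
    · exact ae_of_all _ fun t => by simp only [hGF, Pi.zero_apply]; positivity
  simp only [eLpNorm_eq_lintegral_rpow_enorm_toReal hp hp']
  refine (ENNReal.continuous_rpow_const.tendsto _).comp ?_
  rw [← hright]
  exact (ENNReal.tendsto_ofReal hlim).congr hleft

/-! ### Potentials of rapidly oscillating gradients -/

/-- A smooth function of `(x, y)`, periodic in `y`, and supported in a compact subset of `Ω` with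
respect to `x`. -/
structure IsCellPotential (b : Module.Basis (Fin m) ℝ (Eucl m)) (Ω : Set (Eucl n))
    (Φ : Eucl n × Eucl m → ℝ) : Prop where
  contDiff : ContDiff ℝ ∞ Φ
  periodic : ∀ x, CellPeriodic b fun y => Φ (x, y)
  exists_compact : ∃ K ⊆ Ω, IsCompact K ∧ ∀ x ∉ K, ∀ y, Φ (x, y) = 0

/-- The field `R* ∇_y Φ`. -/
def cellGradient (R : Matrix (Fin m) (Fin n) ℝ) (Φ : Eucl n × Eucl m → ℝ) (z : Eucl n × Eucl m) :
    Eucl n :=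
  WithLp.toLp 2 fun l => fderiv ℝ Φ z (0, R.toEuclideanLin (EuclideanSpace.single l 1))

/-- The partial gradient `∇_x Φ`. -/
def slowGradient (Φ : Eucl n × Eucl m → ℝ) (z : Eucl n × Eucl m) : Eucl n :=
  WithLp.toLp 2 fun l => fderiv ℝ Φ z (EuclideanSpace.single l 1, 0)

variable {Ω : Set (Eucl n)} {Φ Ψ : Eucl n × Eucl m → ℝ}

theorem isCellPotential_zero : IsCellPotential b Ω (0 : Eucl n × Eucl m → ℝ) :=
  ⟨contDiff_const, fun _ _ _ => rfl, ∅, Set.empty_subset _, isCompact_empty, fun _ _ _ => rfl⟩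

theorem IsCellPotential.add (hΦ : IsCellPotential b Ω Φ) (hΨ : IsCellPotential b Ω Ψ) :
    IsCellPotential b Ω (Φ + Ψ) := by
  obtain ⟨K, hKΩ, hK, hΦK⟩ := hΦ.exists_compact
  obtain ⟨L, hLΩ, hL, hΨL⟩ := hΨ.exists_compact
  refine ⟨hΦ.contDiff.add hΨ.contDiff, fun x i y => ?_, K ∪ L, Set.union_subset hKΩ hLΩ, hK.union hL,
    fun x hx y => ?_⟩
  · simpa using congrArg₂ (· + ·) (hΦ.periodic x i y) (hΨ.periodic x i y)
  · rw [Set.mem_union, not_or] at hx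
    simp [hΦK x hx.1, hΨL x hx.2]

theorem IsCellPotential.sub (hΦ : IsCellPotential b Ω Φ) (hΨ : IsCellPotential b Ω Ψ) :
    IsCellPotential b Ω (Φ - Ψ) := by
  obtain ⟨K, hKΩ, hK, hΦK⟩ := hΦ.exists_compact
  obtain ⟨L, hLΩ, hL, hΨL⟩ := hΨ.exists_compact
  refine ⟨hΦ.contDiff.sub hΨ.contDiff, fun x i y => ?_, K ∪ L, Set.union_subset hKΩ hLΩ, hK.union hL,
    fun x hx y => ?_⟩
  · simpa using congrArg₂ (· - ·) (hΦ.periodic x i y) (hΨ.periodic x i y)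
  · rw [Set.mem_union, not_or] at hx
    simp [hΦK x hx.1, hΨL x hx.2]

theorem IsCellPotential.differentiable (hΦ : IsCellPotential b Ω Φ) : Differentiable ℝ Φ :=
  hΦ.contDiff.differentiable (by simp)

theorem cellGradient_add (R : Matrix (Fin m) (Fin n) ℝ) (hΦ : Differentiable ℝ Φ)
    (hΨ : Differentiable ℝ Ψ) (z : Eucl n × Eucl m) :
    cellGradient R (Φ + Ψ) z = cellGradient R Φ z + cellGradient R Ψ z := by
  ext l
  simp [cellGradient, fderiv_add (hΦ z) (hΨ z)]

theorem cellGradient_sub (R : Matrix (Fin m) (Fin n) ℝ) (hΦ : Differentiable ℝ Φ)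
    (hΨ : Differentiable ℝ Ψ) (z : Eucl n × Eucl m) :
    cellGradient R (Φ - Ψ) z = cellGradient R Φ z - cellGradient R Ψ z := by
  ext l
  simp [cellGradient, fderiv_sub (hΦ z) (hΨ z)]

theorem cellGradient_zero (R : Matrix (Fin m) (Fin n) ℝ) (z : Eucl n × Eucl m) :
    cellGradient R 0 z = 0 := by
  ext l
  simp [cellGradient]

/-- One argument serves both partial gradients, `v` selecting the directions. Closedness of `K`
makes `Φ` vanish near each point over the complement, hence its derivative as well. -/
theorem isOscillatingField_of_fderiv {Φ : Eucl n × Eucl m → ℝ} (hΦ : ContDiff ℝ ∞ Φ)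
    (hper : ∀ x, CellPeriodic b fun y => Φ (x, y)) (hK : IsClosed K)
    (hΦK : ∀ x ∉ K, ∀ y, Φ (x, y) = 0) (v : Fin n → Eucl n × Eucl m) :
    IsOscillatingField b K fun z => (WithLp.toLp 2 fun l => fderiv ℝ Φ z (v l) : Eucl n) := by
  refine ⟨?_, fun x i y => ?_, fun x hx y => ?_⟩
  · have h1 : Continuous (fderiv ℝ Φ) := hΦ.continuous_fderiv (by simp)
    exact (PiLp.continuous_toLp 2 _).comp (continuous_pi fun l => h1.clm_apply continuous_const)
  · have h1 : (fun z => Φ (z + (0, b i))) = Φ := by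
      funext z
      obtain ⟨x, y⟩ := z
      simpa using hper x i y
    have h2 : fderiv ℝ Φ ((x, y) + (0, b i)) = fderiv ℝ Φ (x, y) := by
      rw [← fderiv_comp_add_right, h1]
    have h3 : (x, y + b i) = (x, y) + ((0 : Eucl n), b i) := by simp
    simp only [h3, h2]
  · have h1 : Φ =ᶠ[𝓝 (x, y)] fun _ => (0 : ℝ) := by
      have : {z : Eucl n × Eucl m | z.1 ∈ Kᶜ} ∈ 𝓝 (x, y) :=
        (hK.isOpen_compl.preimage continuous_fst).mem_nhds hx
      filter_upwards [this] with z hz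
      exact hΦK z.1 hz z.2
    ext l
    simp [h1.fderiv_eq]

theorem IsCellPotential.exists_isOscillatingField (hΦ : IsCellPotential b Ω Φ)
    (R : Matrix (Fin m) (Fin n) ℝ) : ∃ K ⊆ Ω, IsCompact K ∧ IsOscillatingField b K Φ ∧
      IsOscillatingField b K (cellGradient R Φ) ∧ IsOscillatingField b K (slowGradient Φ) := by
  obtain ⟨K, hKΩ, hK, hΦK⟩ := hΦ.exists_compact
  exact ⟨K, hKΩ, hK, ⟨hΦ.contDiff.continuous, hΦ.periodic, hΦK⟩,
    isOscillatingField_of_fderiv hΦ.contDiff hΦ.periodic hK.isClosed hΦK _,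
    isOscillatingField_of_fderiv hΦ.contDiff hΦ.periodic hK.isClosed hΦK _⟩

/-! ### Weak gradients -/

theorem setIntegral_eq_integral_of_tsupport {Ω : Set (Eucl n)} {f φ : Eucl n → ℝ}
    (h : tsupport φ ⊆ Ω) (hf : ∀ x ∉ tsupport φ, f x = 0) : ∫ x in Ω, f x = ∫ x, f x :=
  setIntegral_eq_integral_of_forall_compl_eq_zero fun x hx => hf x fun hx' => hx (h hx')

theorem fderiv_eq_zero_of_notMem_tsupport {φ : Eucl n → ℝ} {x : Eucl n} (hx : x ∉ tsupport φ) :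
    fderiv ℝ φ x = 0 :=
  image_eq_zero_of_notMem_tsupport fun h => hx (tsupport_fderiv_subset ℝ h)

theorem hasWeakGradient_of_contDiff {f : Eucl n → ℝ} (hf : ContDiff ℝ ∞ f) (Ω : Set (Eucl n)) :
    HasWeakGradient Ω f fun x =>
      WithLp.toLp 2 fun l => fderiv ℝ f x (EuclideanSpace.single l 1) := by
  intro φ hφ hφc hφΩ i
  have hφ' : Continuous (fderiv ℝ φ) := hφ.continuous_fderiv (by simp)
  have hf' : Continuous (fderiv ℝ f) := hf.continuous_fderiv (by simp)
  rw [setIntegral_eq_integral_of_tsupport hφΩ fun x hx => by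
      rw [fderiv_eq_zero_of_notMem_tsupport hx]; simp,
    setIntegral_eq_integral_of_tsupport hφΩ fun x hx => by
      rw [image_eq_zero_of_notMem_tsupport hx, mul_zero]]
  refine integral_mul_fderiv_eq_neg_fderiv_mul_of_integrable ?_ ?_ ?_
    (fun x _ => (hf.differentiable (by simp)) x) (fun x _ => (hφ.differentiable (by simp)) x)
  · exact ((hf'.clm_apply continuous_const).mul hφ.continuous).integrable_of_hasCompactSupport
      hφc.mul_left
  · refine (hf.continuous.mul (hφ'.clm_apply continuous_const)).integrable_of_hasCompactSupport ?_
    exact HasCompactSupport.mul_left (hφc.fderiv_apply ℝ _)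
  · exact (hf.continuous.mul hφ.continuous).integrable_of_hasCompactSupport hφc.mul_left

theorem HasWeakGradient.add {Ω : Set (Eucl n)} {u u' : Eucl n → ℝ} {g g' : Eucl n → Eucl n}
    (hu : HasWeakGradient Ω u g) (hu' : HasWeakGradient Ω u' g')
    (hui : Integrable u (volume.restrict Ω)) (hui' : Integrable u' (volume.restrict Ω))
    (hgi : Integrable g (volume.restrict Ω)) (hgi' : Integrable g' (volume.restrict Ω)) :
    HasWeakGradient Ω (u + u') (g + g') := by
  intro φ hφ hφc hφΩ i
  have hφ' : Continuous fun x => fderiv ℝ φ x (EuclideanSpace.single i 1) :=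
    (hφ.continuous_fderiv (by simp)).clm_apply continuous_const
  obtain ⟨C, hC⟩ := hφc.exists_bound_of_continuous hφ.continuous
  obtain ⟨C', hC'⟩ := (hφc.fderiv_apply ℝ (EuclideanSpace.single i 1)).exists_bound_of_continuous hφ'
  have h1 : ∀ {w : Eucl n → ℝ}, Integrable w (volume.restrict Ω) → Integrable
      (fun x => w x * fderiv ℝ φ x (EuclideanSpace.single i 1)) (volume.restrict Ω) := fun hw =>
    hw.mul_bdd hφ'.aestronglyMeasurable (ae_of_all _ hC')
  have h2 : ∀ {w : Eucl n → Eucl n}, Integrable w (volume.restrict Ω) → Integrable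
      (fun x => w x i * φ x) (volume.restrict Ω) := fun hw =>
    ((EuclideanSpace.proj (𝕜 := ℝ) i).integrable_comp hw).mul_bdd
      hφ.continuous.aestronglyMeasurable (ae_of_all _ hC)
  simp only [Pi.add_apply, PiLp.add_apply, add_mul]
  rw [integral_add (h1 hui) (h1 hui'), integral_add (h2 hgi) (h2 hgi'), hu φ hφ hφc hφΩ i,
    hu' φ hφ hφc hφΩ i]
  ring

/-- The function `ε Φ(x, R x / ε)`. -/
def oscillatingPotential (R : Matrix (Fin m) (Fin n) ℝ) (ε : ℝ) (Φ : Eucl n × Eucl m → ℝ)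
    (x : Eucl n) : ℝ :=
  ε * Φ (x, ε⁻¹ • R.toEuclideanLin x)

/-- The gradient of `ε Φ(x, R x / ε)`. -/
def oscillatingGradient (R : Matrix (Fin m) (Fin n) ℝ) (ε : ℝ) (Φ : Eucl n × Eucl m → ℝ)
    (x : Eucl n) : Eucl n :=
  ε • slowGradient Φ (x, ε⁻¹ • R.toEuclideanLin x) + cellGradient R Φ (x, ε⁻¹ • R.toEuclideanLin x)

theorem contDiff_oscillatingPotential (hΦ : ContDiff ℝ ∞ Φ) (R : Matrix (Fin m) (Fin n) ℝ) (ε : ℝ) :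
    ContDiff ℝ ∞ (oscillatingPotential R ε Φ) := by
  have h1 : ContDiff ℝ ∞ fun x : Eucl n => ε⁻¹ • R.toEuclideanLin x :=
    (LinearMap.toContinuousLinearMap R.toEuclideanLin).contDiff.const_smul _
  exact contDiff_const.mul (hΦ.comp (contDiff_id.prodMk h1))

/-- Chain rule: the prefactor `ε` cancels the `ε⁻¹` from the fast variable and remains only on the
slow gradient. -/
theorem fderiv_oscillatingPotential (hΦ : ContDiff ℝ ∞ Φ) (R : Matrix (Fin m) (Fin n) ℝ) {ε : ℝ}
    (hε : ε ≠ 0) (x : Eucl n) (l : Fin n) :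
    fderiv ℝ (oscillatingPotential R ε Φ) x (EuclideanSpace.single l 1) =
      oscillatingGradient R ε Φ x l := by
  let A : Eucl n →L[ℝ] Eucl m := LinearMap.toContinuousLinearMap R.toEuclideanLin
  have h1 : HasFDerivAt (fun x : Eucl n => (x, ε⁻¹ • R.toEuclideanLin x))
      ((ContinuousLinearMap.id ℝ (Eucl n)).prod (ε⁻¹ • A)) x :=
    (hasFDerivAt_id x).prodMk (A.hasFDerivAt.const_smul ε⁻¹)
  have h2 := ((hΦ.differentiable (by simp) (x, ε⁻¹ • R.toEuclideanLin x)).hasFDerivAt.comp x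
    h1).const_mul ε
  have h3 : fderiv ℝ (oscillatingPotential R ε Φ) x = _ := h2.fderiv
  have hA : ∀ y, A y = R.toEuclideanLin y := fun _ => rfl
  rw [h3]
  simp only [_root_.smul_apply, ContinuousLinearMap.comp_apply,
    ContinuousLinearMap.prod_apply, ContinuousLinearMap.id_apply, smul_eq_mul, hA,
    oscillatingGradient, slowGradient, cellGradient, PiLp.add_apply, PiLp.smul_apply]
  have h4 : ((EuclideanSpace.single l 1 : Eucl n), ε⁻¹ • R.toEuclideanLin (EuclideanSpace.single l 1))
      = ((EuclideanSpace.single l 1 : Eucl n), (0 : Eucl m)) +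
        ε⁻¹ • ((0 : Eucl n), R.toEuclideanLin (EuclideanSpace.single l 1)) := by simp
  rw [h4, map_add, map_smul, smul_eq_mul, mul_add, mul_inv_cancel_left₀ hε]

theorem hasWeakGradient_oscillating (hΦ : ContDiff ℝ ∞ Φ) (R : Matrix (Fin m) (Fin n) ℝ) {ε : ℝ}
    (hε : ε ≠ 0) (Ω : Set (Eucl n)) :
    HasWeakGradient Ω (oscillatingPotential R ε Φ) (oscillatingGradient R ε Φ) := by
  have h := hasWeakGradient_of_contDiff (contDiff_oscillatingPotential hΦ R ε) Ω
  have : (fun x => WithLp.toLp 2 fun l => fderiv ℝ (oscillatingPotential R ε Φ) x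
      (EuclideanSpace.single l 1)) = oscillatingGradient R ε Φ := by
    funext x
    ext l
    exact fderiv_oscillatingPotential hΦ R hε x l
  rwa [this] at h

end Oscillating

/-! ### Approximation in `Lᵖ` -/

section Approximation

open UnitAddTorus

variable {n m : ℕ}

theorem exists_contDiff_cutoff {Ω K : Set (Eucl n)} (hΩ : IsOpen Ω) (hK : IsCompact K) (h : K ⊆ Ω) :
    ∃ χ : Eucl n → ℝ, ContDiff ℝ ∞ χ ∧ HasCompactSupport χ ∧ tsupport χ ⊆ Ω ∧
      (∀ x, χ x ∈ Set.Icc (0 : ℝ) 1) ∧ ∀ x ∈ K, χ x = 1 := by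
  obtain ⟨L, hL, hKL, hLΩ⟩ := exists_compact_between hK hΩ h
  obtain ⟨f, hf0, hf1, hf⟩ := exists_contMDiffMap_zero_one_of_isClosed (n := ⊤)
    (modelWithCornersSelf ℝ (Eucl n)) (s := (interior L)ᶜ) (t := K) isOpen_interior.isClosed_compl
    hK.isClosed (Set.disjoint_left.2 fun x hx hx' => hx (hKL hx'))
  have hsupp : Function.support f ⊆ L := fun x hx => by
    by_contra hxL
    exact hx (hf0 fun h => hxL (interior_subset h))
  have hts : tsupport f ⊆ L := closure_minimal hsupp hL.isClosed
  exact ⟨f, f.contMDiff.contDiff, hL.of_isClosed_subset (isClosed_tsupport _) hts, hts.trans hLΩ, hf,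
    fun x hx => hf1 hx⟩

/-- Smooth functions with compact support in `Ω` are dense in `Lᵖ(Ω)`. -/
theorem exists_contDiff_eLpNorm_sub_le {E : Type*} [NormedAddCommGroup E] [NormedSpace ℝ E]
    {Ω : Set (Eucl n)} (hΩ : IsOpen Ω) (hΩv : volume Ω ≠ ⊤) {p : ℝ≥0∞} (hp : 1 ≤ p) (hp' : p ≠ ⊤)
    {f : Eucl n → E} (hf : MemLp f p (volume.restrict Ω)) {δ : ℝ≥0∞} (hδ : δ ≠ 0) :
    ∃ g : Eucl n → E, ContDiff ℝ ∞ g ∧ HasCompactSupport g ∧ tsupport g ⊆ Ω ∧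
      eLpNorm (f - g) p (volume.restrict Ω) ≤ δ := by
  wlog hδt : δ ≠ ⊤ generalizing δ
  · obtain ⟨g, h1, h2, h3, h4⟩ := this one_ne_zero ENNReal.one_ne_top
    rw [not_not] at hδt
    exact ⟨g, h1, h2, h3, hδt ▸ le_top⟩
  have hδr : 0 < (δ / 2).toReal :=
    ENNReal.toReal_pos (ENNReal.half_pos hδ).ne' (ENNReal.div_ne_top hδt (by norm_num))
  obtain ⟨g, hgc, hg, hfg⟩ := hf.exist_eLpNorm_sub_le hp' hp hδr
  rw [ENNReal.ofReal_toReal (ENNReal.div_ne_top hδt (by norm_num))] at hfg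
  obtain ⟨C, hC⟩ := hgc.exists_bound_of_continuous hg.continuous
  have hp0 : p ≠ 0 := (zero_lt_one.trans_le hp).ne'
  have hpr : 0 < p.toReal := ENNReal.toReal_pos hp0 hp'
  -- Cutting `g`, bounded by `C`, off outside a compact `K` costs at most `C` times the measure of
  -- `Ω \ K` to the power 1/p; `η` is the measure that can be afforded.
  obtain ⟨η, hη, hηδ⟩ : ∃ η : ℝ≥0∞, 0 < η ∧ η ^ (1 / p.toReal) * ENNReal.ofReal C ≤ δ / 2 := by
    have : Tendsto (fun η : ℝ≥0∞ => η ^ (1 / p.toReal) * ENNReal.ofReal C) (𝓝[>] 0) (𝓝 0) := by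
      have h0 : Tendsto (fun η : ℝ≥0∞ => η ^ (1 / p.toReal)) (𝓝[>] 0) (𝓝 0) := by
        have := (ENNReal.continuous_rpow_const (y := 1 / p.toReal)).tendsto 0
        rw [ENNReal.zero_rpow_of_pos (by positivity)] at this
        exact this.mono_left nhdsWithin_le_nhds
      simpa using ENNReal.Tendsto.mul_const h0 (Or.inr ENNReal.ofReal_ne_top)
    have h1 := (ENNReal.tendsto_nhds_zero.1 this) (δ / 2) (ENNReal.half_pos hδ)
    obtain ⟨η, h2, h3⟩ := (h1.and self_mem_nhdsWithin).exists
    exact ⟨η, h3, h2⟩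
  obtain ⟨K, hKΩ, hK, hKη⟩ := hΩ.measurableSet.exists_isCompact_sdiff_lt hΩv hη.ne'
  obtain ⟨χ, hχ, hχc, hχΩ, hχ01, hχK⟩ := exists_contDiff_cutoff hΩ hK hKΩ
  refine ⟨fun x => χ x • g x, hχ.smul hg, hχc.smul_right, ?_, ?_⟩
  · refine (closure_mono fun x hx => ?_).trans hχΩ
    exact fun h => hx (by simp [h])
  have hdiff : eLpNorm (fun x => g x - χ x • g x) p (volume.restrict Ω) ≤ δ / 2 := by
    have hle : ∀ᵐ x ∂(volume.restrict Ω), ‖g x - χ x • g x‖ ≤ ‖(Ω \ K).indicator (fun _ => C) x‖ := by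
      filter_upwards [ae_restrict_mem hΩ.measurableSet] with x hx
      by_cases hxK : x ∈ K
      · simp [hχK x hxK]
      · rw [Set.indicator_of_mem (show x ∈ Ω \ K from ⟨hx, hxK⟩)]
        have h1 : g x - χ x • g x = (1 - χ x) • g x := by rw [sub_smul, one_smul]
        rw [h1, norm_smul, Real.norm_of_nonneg (by linarith [(hχ01 x).2])]
        have h2 : (1 - χ x) * ‖g x‖ ≤ 1 * ‖g x‖ :=
          mul_le_mul_of_nonneg_right (by linarith [(hχ01 x).1]) (norm_nonneg _)
        exact (h2.trans_eq (one_mul _)).trans ((hC x).trans (le_abs_self _))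
    refine (eLpNorm_mono_ae hle).trans ?_
    rw [eLpNorm_indicator_const (hΩ.measurableSet.diff hK.measurableSet) hp0 hp']
    refine le_trans ?_ hηδ
    have hC0 : 0 ≤ C := (norm_nonneg _).trans (hC 0)
    rw [mul_comm, Real.enorm_eq_ofReal hC0]
    gcongr
    exact (Measure.restrict_apply_le _ _).trans hKη.le
  have hsplit : f - (fun x => χ x • g x) = (f - g) + fun x => g x - χ x • g x := by
    ext x; simp
  rw [hsplit]
  refine (eLpNorm_add_le (hf.aestronglyMeasurable.sub hg.continuous.aestronglyMeasurable)
    (hg.continuous.sub (hχ.continuous.smul hg.continuous)).aestronglyMeasurable hp).trans ?_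
  exact (add_le_add hfg hdiff).trans_eq (ENNReal.add_halves δ)

/-! ### Fejér means in the second variable -/

variable {X : Type*} [MeasurableSpace X] {μ : Measure X}

theorem ae_memLp_prodMk_left {Y E : Type*} [MeasurableSpace Y] [NormedAddCommGroup E] {ν : Measure Y}
    [SFinite ν] {p : ℝ≥0∞} (hp : p ≠ 0) (hp' : p ≠ ⊤) {f : X × Y → E}
    (hf : MemLp f p (μ.prod ν)) : ∀ᵐ x ∂μ, MemLp (fun t => f (x, t)) p ν := by
  have hmeas : AEMeasurable (fun z => ‖f z‖ₑ ^ p.toReal) (μ.prod ν) :=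
    hf.aestronglyMeasurable.enorm.pow_const _
  have hfin := (eLpNorm_lt_top_iff_lintegral_rpow_enorm_lt_top hp hp').1 hf.eLpNorm_lt_top
  rw [lintegral_prod _ hmeas] at hfin
  filter_upwards [hf.aestronglyMeasurable.prodMk_left,
    ae_lt_top' hmeas.lintegral_prod_right' hfin.ne] with x h1 h2
  exact ⟨h1, (eLpNorm_lt_top_iff_lintegral_rpow_enorm_lt_top hp hp').2 h2⟩

theorem lintegral_eLpNorm_prodMk_left {Y E : Type*} [MeasurableSpace Y] [NormedAddCommGroup E]
    {ν : Measure Y} [SFinite ν] {p : ℝ≥0∞} (hp : p ≠ 0) (hp' : p ≠ ⊤) {f : X × Y → E}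
    (hf : AEStronglyMeasurable f (μ.prod ν)) :
    ∫⁻ x, eLpNorm (fun t => f (x, t)) p ν ^ p.toReal ∂μ = eLpNorm f p (μ.prod ν) ^ p.toReal := by
  have hpr : p.toReal ≠ 0 := (ENNReal.toReal_pos hp hp').ne'
  have key : ∀ {W : Type _} [MeasurableSpace W] (ρ : Measure W) (g : W → E),
      eLpNorm g p ρ ^ p.toReal = ∫⁻ w, ‖g w‖ₑ ^ p.toReal ∂ρ := by
    intro W _ ρ g
    rw [eLpNorm_eq_lintegral_rpow_enorm_toReal hp hp', ← ENNReal.rpow_mul, one_div,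
      inv_mul_cancel₀ hpr, ENNReal.rpow_one]
  rw [eLpNorm_eq_lintegral_rpow_enorm_toReal hp hp', ← ENNReal.rpow_mul, one_div,
      inv_mul_cancel₀ hpr, ENNReal.rpow_one, lintegral_prod _ (hf.enorm.pow_const _)]
  exact lintegral_congr fun x => key ν _

theorem aemeasurable_eLpNorm_prodMk_left {Y E : Type*} [MeasurableSpace Y] [NormedAddCommGroup E]
    {ν : Measure Y} [SFinite ν] {p : ℝ≥0∞} (hp : p ≠ 0) (hp' : p ≠ ⊤) {f : X × Y → E}
    (hf : AEStronglyMeasurable f (μ.prod ν)) :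
    AEMeasurable (fun x => eLpNorm (fun t => f (x, t)) p ν) μ := by
  simp only [eLpNorm_eq_lintegral_rpow_enorm_toReal hp hp']
  exact ((hf.enorm.pow_const _).lintegral_prod_right').pow_const _

theorem aestronglyMeasurable_mFourierCoeff {f : X × UnitAddTorus (Fin m) → ℂ}
    (hf : AEStronglyMeasurable f (μ.prod volume)) (z : Fin m → ℤ) :
    AEStronglyMeasurable (fun x => mFourierCoeff (fun t => f (x, t)) z) μ := by
  have : AEStronglyMeasurable (fun w : X × UnitAddTorus (Fin m) => mFourier (-z) w.2 • f w)
      (μ.prod volume) :=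
    (((mFourier (-z)).continuous.measurable.comp measurable_snd).aestronglyMeasurable).smul hf
  exact this.integral_prod_right'

/-- On a probability space, the coefficient of a slice is at most its `L¹` norm, hence its `L^p`
norm; Tonelli then integrates over the slices. -/
theorem memLp_mFourierCoeff {p : ℝ≥0∞} (hp : 1 ≤ p) (hp' : p ≠ ⊤)
    {f : X × UnitAddTorus (Fin m) → ℂ} (hf : MemLp f p (μ.prod volume)) (z : Fin m → ℤ) :
    MemLp (fun x => mFourierCoeff (fun t => f (x, t)) z) p μ := by
  have hp0 : p ≠ 0 := (zero_lt_one.trans_le hp).ne'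
  refine ⟨aestronglyMeasurable_mFourierCoeff hf.aestronglyMeasurable z, ?_⟩
  rw [eLpNorm_lt_top_iff_lintegral_rpow_enorm_lt_top hp0 hp']
  have hle : ∀ᵐ x ∂μ, ‖mFourierCoeff (fun t => f (x, t)) z‖ₑ ^ p.toReal ≤
      eLpNorm (fun t => f (x, t)) p volume ^ p.toReal := by
    filter_upwards [hf.aestronglyMeasurable.prodMk_left] with x hx
    refine ENNReal.rpow_le_rpow ?_ ENNReal.toReal_nonneg
    refine le_trans ?_ (eLpNorm_le_eLpNorm_of_exponent_le hp hx)
    rw [eLpNorm_one_eq_lintegral_enorm]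
    refine (enorm_integral_le_lintegral_enorm _).trans (lintegral_mono fun t => ?_)
    rw [enorm_smul]
    have h1 : ‖mFourier (-z) t‖ₑ ≤ 1 := by
      rw [← ofReal_norm, ← ENNReal.ofReal_one]
      exact ENNReal.ofReal_le_ofReal (((mFourier (-z)).norm_coe_le_norm t).trans_eq mFourier_norm)
    calc _ ≤ 1 * ‖f (x, t)‖ₑ := by gcongr
      _ = _ := one_mul _
  refine (lintegral_mono_ae hle).trans_lt ?_
  rw [lintegral_eLpNorm_prodMk_left hp0 hp' hf.aestronglyMeasurable]
  exact ENNReal.rpow_lt_top_of_nonneg ENNReal.toReal_nonneg hf.eLpNorm_ne_top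

theorem aestronglyMeasurable_fejerSum_prod [SFinite μ] {f : X × UnitAddTorus (Fin m) → ℂ}
    (hf : AEStronglyMeasurable f (μ.prod volume)) (N : ℕ) :
    AEStronglyMeasurable (fun w : X × UnitAddTorus (Fin m) => fejerSum N (fun t => f (w.1, t)) w.2)
      (μ.prod volume) := by
  simp only [fejerSum_apply]
  refine Finset.aestronglyMeasurable_fun_sum _ fun z _ => ?_
  exact (((aestronglyMeasurable_mFourierCoeff hf z).comp_fst).const_mul _).mul
    (((mFourier z).continuous.measurable.comp measurable_snd).aestronglyMeasurable)

/-- Almost every slice converges in `L^p` of the torus, and contractivity bounds the error by twice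
the norm of the slice; dominated convergence in `x` concludes. -/
theorem tendsto_eLpNorm_fejerSum_prod [SFinite μ] {p : ℝ≥0∞} (hp : 1 ≤ p) (hp' : p ≠ ⊤)
    {f : X × UnitAddTorus (Fin m) → ℂ} (hf : MemLp f p (μ.prod volume)) :
    Tendsto (fun N => eLpNorm (fun w : X × UnitAddTorus (Fin m) =>
      fejerSum N (fun t => f (w.1, t)) w.2 - f w) p (μ.prod volume)) atTop (𝓝 0) := by
  have hp0 : p ≠ 0 := (zero_lt_one.trans_le hp).ne'
  have hpr : 0 < p.toReal := ENNReal.toReal_pos hp0 hp'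
  have hm : ∀ N, AEStronglyMeasurable (fun w : X × UnitAddTorus (Fin m) =>
      fejerSum N (fun t => f (w.1, t)) w.2 - f w) (μ.prod volume) := fun N =>
    (aestronglyMeasurable_fejerSum_prod hf.aestronglyMeasurable N).sub hf.aestronglyMeasurable
  have hae := ae_memLp_prodMk_left hp0 hp' hf
  have hpow : Tendsto (fun N => eLpNorm (fun w : X × UnitAddTorus (Fin m) =>
      fejerSum N (fun t => f (w.1, t)) w.2 - f w) p (μ.prod volume) ^ p.toReal) atTop (𝓝 0) := by
    simp_rw [← lintegral_eLpNorm_prodMk_left hp0 hp' (hm _)]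
    rw [← lintegral_zero (μ := μ)]
    refine tendsto_lintegral_of_dominated_convergence'
      (fun x => (2 * eLpNorm (fun t => f (x, t)) p volume) ^ p.toReal)
      (fun N => (aemeasurable_eLpNorm_prodMk_left hp0 hp' (hm N)).pow_const _) (fun N => ?_) ?_ ?_
    · filter_upwards [hae] with x hx
      refine ENNReal.rpow_le_rpow ?_ hpr.le
      refine (eLpNorm_sub_le (ContinuousMap.continuous _).aestronglyMeasurable hx.aestronglyMeasurable
        hp).trans ?_
      rw [two_mul]
      gcongr
      exact eLpNorm_fejerSum_le N hp hp' hx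
    · simp_rw [ENNReal.mul_rpow_of_nonneg _ _ hpr.le]
      rw [lintegral_const_mul' _ _ (ENNReal.rpow_ne_top_of_nonneg hpr.le (by norm_num)),
        lintegral_eLpNorm_prodMk_left hp0 hp' hf.aestronglyMeasurable]
      exact ENNReal.mul_ne_top (ENNReal.rpow_ne_top_of_nonneg hpr.le (by norm_num))
        (ENNReal.rpow_ne_top_of_nonneg hpr.le hf.eLpNorm_ne_top)
    · filter_upwards [hae] with x hx
      have := ((ENNReal.continuous_rpow_const (y := p.toReal)).tendsto 0).comp
        (tendsto_eLpNorm_fejerSum_sub hp hp' hx)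
      rwa [ENNReal.zero_rpow_of_pos hpr] at this
  have := ((ENNReal.continuous_rpow_const (y := 1 / p.toReal)).tendsto 0).comp hpow
  rw [ENNReal.zero_rpow_of_pos (by positivity)] at this
  refine this.congr fun N => ?_
  rw [Function.comp_apply, ← ENNReal.rpow_mul, mul_one_div_cancel hpr.ne', ENNReal.rpow_one]

end Approximation

/-! ### Approximation of fields in `G_R^p` by gradients of potentials -/

section GradientApproximation

open UnitAddTorus

variable {n m : ℕ}

/-- `V` is a limit in `Lᵖ(Ω × Y)` of gradients `R* ∇_y Φ` of potentials. -/
def IsCellGradientLimit (R : Matrix (Fin m) (Fin n) ℝ) (a : Eucl m)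
    (b : Module.Basis (Fin m) ℝ (Eucl m)) (Ω : Set (Eucl n)) (p : ℝ≥0∞)
    (V : Eucl n × UnitAddTorus (Fin m) → Eucl n) : Prop :=
  AEStronglyMeasurable V ((volume.restrict Ω).prod volume) ∧ ∀ δ : ℝ≥0∞, δ ≠ 0 →
    ∃ Φ, IsCellPotential b Ω Φ ∧
      eLpNorm (fun z => V z - cellGradient R Φ (z.1, cellSection a b z.2)) p
        ((volume.restrict Ω).prod volume) ≤ δ

variable {R : Matrix (Fin m) (Fin n) ℝ} {a : Eucl m} {b : Module.Basis (Fin m) ℝ (Eucl m)}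
  {Ω : Set (Eucl n)} {p : ℝ≥0∞} {V W : Eucl n × UnitAddTorus (Fin m) → Eucl n}

theorem measurable_prod_cellSection (a : Eucl m) (b : Module.Basis (Fin m) ℝ (Eucl m)) :
    Measurable fun z : Eucl n × UnitAddTorus (Fin m) => (z.1, cellSection a b z.2) :=
  measurable_fst.prodMk ((measurable_cellSection a b).comp measurable_snd)

theorem IsCellPotential.aestronglyMeasurable_cellGradient {Φ : Eucl n × Eucl m → ℝ}
    (hΦ : IsCellPotential b Ω Φ) (R : Matrix (Fin m) (Fin n) ℝ) (a : Eucl m)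
    (ν : Measure (Eucl n × UnitAddTorus (Fin m))) :
    AEStronglyMeasurable (fun z : Eucl n × UnitAddTorus (Fin m) =>
      cellGradient R Φ (z.1, cellSection a b z.2)) ν := by
  obtain ⟨K, -, -, -, h, -⟩ := hΦ.exists_isOscillatingField R
  exact (h.continuous.measurable.comp (measurable_prod_cellSection a b)).aestronglyMeasurable

theorem isCellGradientLimit_zero : IsCellGradientLimit R a b Ω p 0 :=
  ⟨aestronglyMeasurable_const, fun δ _ => ⟨0, isCellPotential_zero, by simp [cellGradient_zero]⟩⟩

theorem IsCellGradientLimit.add (hp : 1 ≤ p) (hV : IsCellGradientLimit R a b Ω p V)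
    (hW : IsCellGradientLimit R a b Ω p W) : IsCellGradientLimit R a b Ω p (V + W) := by
  refine ⟨hV.1.add hW.1, fun δ hδ => ?_⟩
  obtain ⟨Φ, hΦ, hVΦ⟩ := hV.2 (δ / 2) (ENNReal.half_pos hδ).ne'
  obtain ⟨Ψ, hΨ, hWΨ⟩ := hW.2 (δ / 2) (ENNReal.half_pos hδ).ne'
  refine ⟨Φ + Ψ, hΦ.add hΨ, ?_⟩
  have hsplit : (fun z => (V + W) z - cellGradient R (Φ + Ψ) (z.1, cellSection a b z.2)) =
      (fun z => V z - cellGradient R Φ (z.1, cellSection a b z.2)) +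
        fun z => W z - cellGradient R Ψ (z.1, cellSection a b z.2) := by
    funext z
    simp only [Pi.add_apply, cellGradient_add R hΦ.differentiable hΨ.differentiable]
    abel
  rw [hsplit]
  refine (eLpNorm_add_le (hV.1.sub (hΦ.aestronglyMeasurable_cellGradient R a _))
    (hW.1.sub (hΨ.aestronglyMeasurable_cellGradient R a _)) hp).trans ?_
  exact (add_le_add hVΦ hWΨ).trans_eq (ENNReal.add_halves δ)

theorem IsCellGradientLimit.sum {ι : Type*} (hp : 1 ≤ p) (s : Finset ι)
    {V : ι → Eucl n × UnitAddTorus (Fin m) → Eucl n}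
    (hV : ∀ i ∈ s, IsCellGradientLimit R a b Ω p (V i)) :
    IsCellGradientLimit R a b Ω p (∑ i ∈ s, V i) :=
  Finset.sum_induction _ _ (fun _ _ h h' => h.add hp h') isCellGradientLimit_zero hV

/-- The class is closed in `L^p`, so it suffices to reach `V` through Fejér means. -/
theorem isCellGradientLimit_of_approx (hp : 1 ≤ p)
    (hV : AEStronglyMeasurable V ((volume.restrict Ω).prod volume))
    (h : ∀ δ : ℝ≥0∞, δ ≠ 0 → ∃ W, IsCellGradientLimit R a b Ω p W ∧
      eLpNorm (V - W) p ((volume.restrict Ω).prod volume) ≤ δ) :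
    IsCellGradientLimit R a b Ω p V := by
  refine ⟨hV, fun δ hδ => ?_⟩
  obtain ⟨W, hW, hVW⟩ := h (δ / 2) (ENNReal.half_pos hδ).ne'
  obtain ⟨Φ, hΦ, hWΦ⟩ := hW.2 (δ / 2) (ENNReal.half_pos hδ).ne'
  refine ⟨Φ, hΦ, ?_⟩
  have hsplit : (fun z => V z - cellGradient R Φ (z.1, cellSection a b z.2)) =
      (V - W) + fun z => W z - cellGradient R Φ (z.1, cellSection a b z.2) := by
    funext z
    simp
  rw [hsplit]
  refine (eLpNorm_add_le (hV.sub hW.1)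
    (hW.1.sub (hΦ.aestronglyMeasurable_cellGradient R a _)) hp).trans ?_
  exact (add_le_add hVW hWΦ).trans_eq (ENNReal.add_halves δ)

/-- The potential `Re (g(x) e^{2πi k·y} / (2πi))` with `k = freq b z`. -/
def modePotential (b : Module.Basis (Fin m) ℝ (Eucl m)) (z : Fin m → ℤ) (g : Eucl n → ℂ)
    (w : Eucl n × Eucl m) : ℝ :=
  (g w.1 * (2 * (Real.pi : ℂ) * Complex.I)⁻¹ *
    Complex.exp (2 * (Real.pi : ℂ) * Complex.I * ((inner ℝ (freq b z) w.2 : ℝ) : ℂ))).re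

theorem contDiff_modePotential (z : Fin m → ℤ) {g : Eucl n → ℂ} (hg : ContDiff ℝ ∞ g) :
    ContDiff ℝ ∞ (modePotential b z g) := by
  have h1 : ContDiff ℝ ∞ fun w : Eucl n × Eucl m => ((inner ℝ (freq b z) w.2 : ℝ) : ℂ) :=
    Complex.ofRealCLM.contDiff.comp (contDiff_const.inner ℝ contDiff_snd)
  exact Complex.reCLM.contDiff.comp (((hg.comp contDiff_fst).mul contDiff_const).mul
    (Complex.contDiff_exp.comp (contDiff_const.mul h1)))

theorem isCellPotential_modePotential (z : Fin m → ℤ) {g : Eucl n → ℂ} (hg : ContDiff ℝ ∞ g)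
    (hgc : HasCompactSupport g) (hgΩ : tsupport g ⊆ Ω) :
    IsCellPotential b Ω (modePotential b z g) := by
  refine ⟨contDiff_modePotential z hg, fun x i y => ?_, tsupport g, hgΩ, hgc, fun x hx y => ?_⟩
  · simp only [modePotential, ← mFourier_cellProj, cellProj_add_basis]
  · simp [modePotential, image_eq_zero_of_notMem_tsupport hx]

/-- The derivative along the line `y + t e` multiplies the exponential by `2πi` times its frequency
in the direction `e`, and the factor `(2πi)⁻¹` in the potential cancels `2πi`. -/
theorem cellGradient_modePotential (R : Matrix (Fin m) (Fin n) ℝ) (z : Fin m → ℤ) {g : Eucl n → ℂ}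
    (hg : ContDiff ℝ ∞ g) (x : Eucl n) (y : Eucl m) :
    cellGradient R (modePotential b z g) (x, y) =
      (g x * mFourier z (cellProj b y)).re • R.transpose.toEuclideanLin (freq b z) := by
  ext l
  set e : Eucl m := R.toEuclideanLin (EuclideanSpace.single l 1) with he
  have hdiff : DifferentiableAt ℝ (modePotential b z g) (x, y + (0 : ℝ) • e) :=
    (contDiff_modePotential z hg).differentiable (by simp) _
  have hline : HasDerivAt (fun t : ℝ => modePotential b z g (x, y + t • e))
      (fderiv ℝ (modePotential b z g) (x, y) (0, e)) 0 := by
    have hc : HasDerivAt (fun t : ℝ => (x, y + t • e)) ((0 : Eucl n), (1 : ℝ) • e) 0 :=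
      (hasDerivAt_const _ _).prodMk (((hasDerivAt_id (0 : ℝ)).smul_const e).const_add y)
    have := hdiff.hasFDerivAt.comp_hasDerivAt (0 : ℝ) hc
    simpa [Function.comp_def] using this
  have hval : HasDerivAt (fun t : ℝ => modePotential b z g (x, y + t • e))
      ((g x * mFourier z (cellProj b y)).re * inner ℝ (freq b z) e) 0 := by
    have h0 : HasDerivAt (fun t : ℝ => ((inner ℝ (freq b z) y + t * inner ℝ (freq b z) e : ℝ) : ℂ))
        ((1 * inner ℝ (freq b z) e : ℝ) : ℂ) 0 :=
      (((hasDerivAt_id (0 : ℝ)).mul_const _).const_add _).ofReal_comp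
    have h1 := ((h0.const_mul (2 * (Real.pi : ℂ) * Complex.I)).cexp).const_mul
      (g x * (2 * (Real.pi : ℂ) * Complex.I)⁻¹)
    have h2 := Complex.reCLM.hasFDerivAt.comp_hasDerivAt (0 : ℝ) h1
    have hpi : (2 * (Real.pi : ℂ) * Complex.I) ≠ 0 := Complex.two_pi_I_ne_zero
    have hfun : (fun t : ℝ => modePotential b z g (x, y + t • e)) = (Complex.reCLM ∘ fun t : ℝ =>
        g x * (2 * (Real.pi : ℂ) * Complex.I)⁻¹ * Complex.exp (2 * (Real.pi : ℂ) * Complex.I *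
          ((inner ℝ (freq b z) y + t * inner ℝ (freq b z) e : ℝ) : ℂ))) := by
      funext t
      simp [modePotential, inner_add_right, inner_smul_right]
    rw [hfun]
    refine h2.congr_deriv ?_
    rw [Complex.reCLM_apply, mFourier_cellProj, ← Complex.re_mul_ofReal]
    congr 1
    simp only [zero_mul, add_zero, one_mul]
    field_simp
  have hl : inner ℝ (freq b z) e = R.transpose.toEuclideanLin (freq b z) l := by
    rw [he, inner_toEuclideanLin]
    simp [EuclideanSpace.inner_single_right]
  rw [PiLp.smul_apply, smul_eq_mul, ← hl]
  exact hline.unique hval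

/-- Only the amplitude has to be smoothed. Characters have modulus 1, so replacing `α` by `g` costs
at most `‖ξ‖` times the `L^p` distance of the amplitudes. -/
theorem isCellGradientLimit_mode (hΩ : IsOpen Ω) (hΩv : volume Ω ≠ ⊤) (hp : 1 ≤ p) (hp' : p ≠ ⊤)
    {α : Eucl n → ℂ} (hα : MemLp α p (volume.restrict Ω)) (z : Fin m → ℤ) :
    IsCellGradientLimit R a b Ω p fun w =>
      (α w.1 * mFourier z w.2).re • R.transpose.toEuclideanLin (freq b z) := by
  set ξ := R.transpose.toEuclideanLin (freq b z) with hξ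
  have hfst : MeasurePreserving (Prod.fst : Eucl n × UnitAddTorus (Fin m) → Eucl n)
      ((volume.restrict Ω).prod volume) (volume.restrict Ω) :=
    ⟨measurable_fst, by simp⟩
  have hmF : AEStronglyMeasurable (fun w : Eucl n × UnitAddTorus (Fin m) => mFourier z w.2)
      ((volume.restrict Ω).prod volume) :=
    ((mFourier z).continuous.measurable.comp measurable_snd).aestronglyMeasurable
  refine ⟨(Complex.continuous_re.comp_aestronglyMeasurable
    ((hα.aestronglyMeasurable.comp_fst).mul hmF)).smul_const ξ, fun δ hδ => ?_⟩
  obtain ⟨η, hη, hηδ⟩ : ∃ η : ℝ≥0∞, η ≠ 0 ∧ ‖ξ‖ₑ * η ≤ δ := by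
    have h1 : Tendsto (fun η : ℝ≥0∞ => ‖ξ‖ₑ * η) (𝓝[>] 0) (𝓝 0) := by
      have : Tendsto (fun η : ℝ≥0∞ => ‖ξ‖ₑ * η) (𝓝 0) (𝓝 (‖ξ‖ₑ * 0)) :=
        ENNReal.Tendsto.const_mul tendsto_id (Or.inr enorm_ne_top)
      rw [mul_zero] at this
      exact this.mono_left nhdsWithin_le_nhds
    obtain ⟨η, h2, h3⟩ := ((ENNReal.tendsto_nhds_zero.1 h1 δ (pos_iff_ne_zero.2 hδ)).and
      self_mem_nhdsWithin).exists
    exact ⟨η, (show 0 < η from h3).ne', h2⟩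
  obtain ⟨g, hg, hgc, hgΩ, hgα⟩ := exists_contDiff_eLpNorm_sub_le hΩ hΩv hp hp' hα hη
  refine ⟨modePotential b z g, isCellPotential_modePotential z hg hgc hgΩ, ?_⟩
  have hle : ∀ w : Eucl n × UnitAddTorus (Fin m),
      ‖(α w.1 * mFourier z w.2).re • ξ - cellGradient R (modePotential b z g)
        (w.1, cellSection a b w.2)‖ ≤ ‖(((‖ξ‖ : ℝ) : ℂ) • (α - g)) w.1‖ := by
    intro w
    rw [cellGradient_modePotential R z hg, cellProj_cellSection, ← hξ, ← sub_smul, norm_smul,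
      ← Complex.sub_re, ← sub_mul, Pi.smul_apply, norm_smul, Complex.norm_real, norm_norm, mul_comm]
    refine mul_le_mul_of_nonneg_left ?_ (norm_nonneg _)
    refine (Complex.abs_re_le_norm _).trans ?_
    rw [norm_mul]
    exact (mul_le_of_le_one_right (norm_nonneg _)
      (((mFourier z).norm_coe_le_norm _).trans_eq mFourier_norm))
  refine (eLpNorm_mono hle).trans ?_
  have hsm : AEStronglyMeasurable (((‖ξ‖ : ℝ) : ℂ) • (α - g)) (volume.restrict Ω) :=
    (hα.aestronglyMeasurable.sub hg.continuous.aestronglyMeasurable).const_smul _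
  have hcomp := eLpNorm_comp_measurePreserving (p := p) hsm hfst
  simp only [Function.comp_def] at hcomp
  rw [hcomp, eLpNorm_const_smul]
  refine le_trans ?_ hηδ
  gcongr
  rw [← ofReal_norm, Complex.norm_real, norm_norm, ofReal_norm]

theorem norm_le_sum_abs {d : ℕ} (v : Eucl d) : ‖v‖ ≤ ∑ l, |v l| := by
  have : v = ∑ l, EuclideanSpace.single l (v l) := by
    ext i
    simp [Finset.sum_apply]
  calc ‖v‖ = ‖∑ l, EuclideanSpace.single l (v l)‖ := by rw [← this]
    _ ≤ ∑ l, ‖EuclideanSpace.single l (v l)‖ := norm_sum_le _ _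
    _ = ∑ l, |v l| := by simp

/-- Fields in `L^p(Ω; G_R^p)` are limits of gradients of potentials. -/
theorem isCellGradientLimit_of_mFourierCoeff (hΩ : IsOpen Ω) (hΩv : volume Ω ≠ ⊤) (hp : 1 ≤ p)
    (hp' : p ≠ ⊤) (hV : MemLp V p ((volume.restrict Ω).prod volume))
    (hc : ∀ᵐ x ∂(volume.restrict Ω), ∀ z : Fin m → ℤ, ∃ c : ℂ, ∀ l,
      mFourierCoeff (fun t => ((V (x, t) l : ℝ) : ℂ)) z =
        c * ((R.transpose.toEuclideanLin (freq b z) l : ℝ) : ℂ)) :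
    IsCellGradientLimit R a b Ω p V := by
  set ξ : (Fin m → ℤ) → Eucl n := fun z => R.transpose.toEuclideanLin (freq b z) with hξ
  let f : Fin n → Eucl n × UnitAddTorus (Fin m) → ℂ := fun l w => ((V w l : ℝ) : ℂ)
  have hf : ∀ l, MemLp (f l) p ((volume.restrict Ω).prod volume) := fun l =>
    (((EuclideanSpace.proj l : Eucl n →L[ℝ] ℝ).comp_memLp' hV).ofReal : _)
  -- A measurable choice of the scalar `c`, given only pointwise: project the coefficient vector on
  -- `ξ z` and divide by `‖ξ z‖ ^ 2`. If `ξ z = 0` this gives 0, which is harmless because the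
  -- coefficient then vanishes too.
  let α : (Fin m → ℤ) → Eucl n → ℂ := fun z x =>
    ∑ l, (((ξ z l * (‖ξ z‖ ^ 2)⁻¹ : ℝ)) : ℂ) * mFourierCoeff (fun t => f l (x, t)) z
  have hα : ∀ z, MemLp (α z) p (volume.restrict Ω) := fun z =>
    memLp_finsetSum _ fun l _ => (memLp_mFourierCoeff hp hp' (hf l) z).const_mul _
  let W : ℕ → Eucl n × UnitAddTorus (Fin m) → Eucl n := fun N =>
    ∑ z ∈ fejerSupport m N, fun w => (((fejerWeight N z : ℂ) * α z w.1) * mFourier z w.2).re • ξ z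
  have hW : ∀ N, IsCellGradientLimit R a b Ω p (W N) := fun N =>
    IsCellGradientLimit.sum hp _ fun z _ =>
      isCellGradientLimit_mode hΩ hΩv hp hp' ((hα z).const_mul _) z
  have hαξ : ∀ᵐ x ∂(volume.restrict Ω), ∀ z l,
      α z x * ((ξ z l : ℝ) : ℂ) = mFourierCoeff (fun t => f l (x, t)) z := by
    filter_upwards [hc] with x hx z l
    obtain ⟨c, hc⟩ := hx z
    have hc' : ∀ l, mFourierCoeff (fun t => f l (x, t)) z = c * ((ξ z l : ℝ) : ℂ) := hc
    simp only [α, hc']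
    by_cases h0 : ξ z = 0
    · simp [h0]
    · have hnorm : ∑ l, ((ξ z l : ℝ) : ℂ) ^ 2 = ((‖ξ z‖ ^ 2 : ℝ) : ℂ) := by
        rw [EuclideanSpace.norm_sq_eq]
        push_cast
        simp only [Real.norm_eq_abs, ← Complex.ofReal_pow, sq_abs]
      have hne : ((‖ξ z‖ ^ 2 : ℝ) : ℂ) ≠ 0 := by
        simpa using h0
      calc (∑ l, (((ξ z l * (‖ξ z‖ ^ 2)⁻¹ : ℝ)) : ℂ) * (c * ((ξ z l : ℝ) : ℂ))) * ((ξ z l : ℝ) : ℂ)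
          = ((∑ l, ((ξ z l : ℝ) : ℂ) ^ 2) * ((‖ξ z‖ ^ 2 : ℝ) : ℂ)⁻¹) * (c * ((ξ z l : ℝ) : ℂ)) := by
            rw [Finset.sum_mul, Finset.sum_mul, Finset.sum_mul]
            refine Finset.sum_congr rfl fun l' _ => ?_
            push_cast
            ring
        _ = c * ((ξ z l : ℝ) : ℂ) := by rw [hnorm, mul_inv_cancel₀ hne, one_mul]
  have hαξ' : ∀ᵐ w ∂((volume.restrict Ω).prod (volume : Measure (UnitAddTorus (Fin m)))), ∀ z l,
      α z w.1 * ((ξ z l : ℝ) : ℂ) = mFourierCoeff (fun t => f l (w.1, t)) z :=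
    Measure.quasiMeasurePreserving_fst.ae hαξ
  have hbound : ∀ N, eLpNorm (V - W N) p ((volume.restrict Ω).prod volume) ≤
      ∑ l, eLpNorm (fun w : Eucl n × UnitAddTorus (Fin m) =>
        fejerSum N (fun t => f l (w.1, t)) w.2 - f l w) p ((volume.restrict Ω).prod volume) := by
    intro N
    have hmeas : ∀ l, AEStronglyMeasurable (fun w : Eucl n × UnitAddTorus (Fin m) =>
        ‖fejerSum N (fun t => f l (w.1, t)) w.2 - f l w‖) ((volume.restrict Ω).prod volume) :=
      fun l => ((aestronglyMeasurable_fejerSum_prod (hf l).aestronglyMeasurable N).sub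
        (hf l).aestronglyMeasurable).norm
    calc eLpNorm (V - W N) p ((volume.restrict Ω).prod volume)
        ≤ eLpNorm (∑ l, fun w : Eucl n × UnitAddTorus (Fin m) =>
            ‖fejerSum N (fun t => f l (w.1, t)) w.2 - f l w‖) p ((volume.restrict Ω).prod volume) := by
          refine eLpNorm_mono_ae ?_
          filter_upwards [hαξ'] with w hw
          refine le_trans ?_ (le_abs_self _)
          rw [Finset.sum_apply]
          refine (norm_le_sum_abs _).trans (Finset.sum_le_sum fun l _ => ?_)
          -- The vectors `ξ z` are real, so they pass inside the real part, and `W N` is the real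
          -- part of the Fejér mean of `V`.
          have hWl : W N w l = (fejerSum N (fun t => f l (w.1, t)) w.2).re := by
            simp only [W, Finset.sum_apply, WithLp.ofLp_sum, PiLp.smul_apply, smul_eq_mul]
            rw [fejerSum_apply, Complex.re_sum]
            refine Finset.sum_congr rfl fun z _ => ?_
            rw [← hw z l, ← Complex.re_mul_ofReal]
            congr 1
            ring
          have hVl : V w l = (f l w).re := by simp [f]
          rw [Pi.sub_apply, PiLp.sub_apply, hWl, hVl, ← Complex.sub_re, norm_sub_rev]
          exact Complex.abs_re_le_norm _
      _ ≤ _ := by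
          refine (eLpNorm_sum_le (fun l _ => hmeas l) hp).trans_eq ?_
          exact Finset.sum_congr rfl fun l _ => eLpNorm_norm _
  have hlim : Tendsto (fun N => ∑ l, eLpNorm (fun w : Eucl n × UnitAddTorus (Fin m) =>
      fejerSum N (fun t => f l (w.1, t)) w.2 - f l w) p ((volume.restrict Ω).prod volume))
      atTop (𝓝 0) := by
    have := tendsto_finsetSum (Finset.univ : Finset (Fin n)) fun l _ =>
      tendsto_eLpNorm_fejerSum_prod hp hp' (hf l)
    simpa using this
  refine isCellGradientLimit_of_approx hp hV.aestronglyMeasurable fun δ hδ => ?_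
  obtain ⟨N, hN⟩ := (ENNReal.tendsto_nhds_zero.1 hlim δ (pos_iff_ne_zero.2 hδ)).exists
  exact ⟨W N, hW N, (hbound N).trans hN⟩

end GradientApproximation

/-! ### Pairings over `Ω × Y` -/

section Pairing

open BoundedContinuousFunction

variable {n m d : ℕ} {a : Eucl m} {b : Module.Basis (Fin m) ℝ (Eucl m)} {Ω : Set (Eucl n)}
  {p q : ℝ≥0∞}

theorem measurePreserving_prod_cellSection (μ : Measure (Eucl n)) [SFinite μ] :
    MeasurePreserving (fun w : Eucl n × UnitAddTorus (Fin m) => (w.1, cellSection a b w.2))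
      (μ.prod volume)
      ((volume (parallelotope a b))⁻¹ • μ.prod (volume.restrict (parallelotope a b))) := by
  have h : MeasurePreserving (cellSection a b) volume
      ((volume (parallelotope a b))⁻¹ • volume.restrict (parallelotope a b)) :=
    ⟨measurable_cellSection a b, map_cellSection a b⟩
  rw [← Measure.prod_smul_right]
  have hs : SFinite ((volume (parallelotope a b))⁻¹ • volume.restrict (parallelotope a b)) :=
    inferInstance
  exact (MeasurePreserving.id μ).prod h

theorem memLp_comp_cellSection {E : Type*} [NormedAddCommGroup E] {U : Eucl n × Eucl m → E}
    (hU : MemLp U p (prodMeasure Ω (parallelotope a b))) :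
    MemLp (fun w : Eucl n × UnitAddTorus (Fin m) => U (w.1, cellSection a b w.2)) p
      ((volume.restrict Ω).prod volume) :=
  (hU.smul_measure (ENNReal.inv_ne_top.2 (volume_parallelotope_pos a b))).comp_measurePreserving
    (measurePreserving_prod_cellSection _)

theorem ae_comp_cellSection {P : Eucl n × Eucl m → Prop}
    (hP : ∀ᵐ z ∂(prodMeasure Ω (parallelotope a b)), P z) :
    ∀ᵐ w ∂((volume.restrict Ω).prod (volume : Measure (UnitAddTorus (Fin m)))),
      P (w.1, cellSection a b w.2) :=
  (measurePreserving_prod_cellSection _).quasiMeasurePreserving.ae (Measure.ae_smul_measure hP _)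

theorem enorm_integral_inner_le {X E : Type*} [MeasurableSpace X] [NormedAddCommGroup E]
    [InnerProductSpace ℝ E] {μ : Measure X} (hpq : p⁻¹ + q⁻¹ = 1) {f g : X → E}
    (hf : AEStronglyMeasurable f μ) (hg : AEStronglyMeasurable g μ) :
    ‖∫ x, inner ℝ (f x) (g x) ∂μ‖ₑ ≤ eLpNorm f p μ * eLpNorm g q μ := by
  have : ENNReal.HolderTriple p q 1 := ⟨by simpa using hpq⟩
  refine (enorm_integral_le_lintegral_enorm _).trans ?_
  rw [← eLpNorm_one_eq_lintegral_enorm]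
  have := eLpNorm_le_eLpNorm_mul_eLpNorm_of_nnnorm (p := p) (q := q) (r := 1) hf hg
    (fun x y => inner ℝ x y) 1 (ae_of_all _ fun x => by
      rw [one_mul]; exact nnnorm_inner_le_nnnorm (𝕜 := ℝ) (f x) (g x))
  simpa using this

theorem integrable_inner_of_memLp {X E : Type*} [MeasurableSpace X] [NormedAddCommGroup E]
    [InnerProductSpace ℝ E] {μ : Measure X} (hpq : p⁻¹ + q⁻¹ = 1) {f g : X → E}
    (hf : MemLp f p μ) (hg : MemLp g q μ) : Integrable (fun x => inner ℝ (f x) (g x)) μ := by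
  have : ENNReal.HolderTriple p q 1 := ⟨by simpa using hpq⟩
  refine ⟨hf.aestronglyMeasurable.inner hg.aestronglyMeasurable, ?_⟩
  rw [hasFiniteIntegral_iff_enorm, ← eLpNorm_one_eq_lintegral_enorm]
  refine lt_of_le_of_lt (eLpNorm_le_eLpNorm_mul_eLpNorm_of_nnnorm (p := p) (q := q) (r := 1) hf.1 hg.1
    (fun x y => inner ℝ x y) 1 (ae_of_all _ fun x => by
      rw [one_mul]; exact nnnorm_inner_le_nnnorm (𝕜 := ℝ) (f x) (g x))) ?_
  simpa using ENNReal.mul_lt_top hf.2 hg.2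

variable {φ : Eucl n → BoundedContinuousFunction (Eucl m) (Eucl d)}

theorem IsTwoScaleTestFunction.memLp_prod (hφ : IsTwoScaleTestFunction Ω q b φ)
    (a : Eucl m) : MemLp (fun w : Eucl n × UnitAddTorus (Fin m) => φ w.1 (cellSection a b w.2)) q
      ((volume.restrict Ω).prod volume) := by
  refine (hφ.1.comp_fst volume).of_le ?_ (ae_of_all _ fun w => (φ w.1).norm_coe_le_norm _)
  exact (continuous_eval (F := BoundedContinuousFunction (Eucl m) (Eucl d))).comp_aestronglyMeasurable
    (hφ.1.aestronglyMeasurable.comp_fst.prodMk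
      ((measurable_cellSection a b).comp measurable_snd).aestronglyMeasurable)

theorem IsTwoScaleTestFunction.memLp_eval (hφ : IsTwoScaleTestFunction Ω q b φ) {g : Eucl n → Eucl m}
    (hg : Continuous g) : MemLp (fun x => φ x (g x)) q (volume.restrict Ω) :=
  hφ.1.of_le (aestronglyMeasurable_eval hφ.1.aestronglyMeasurable hg)
    (ae_of_all _ fun x => (φ x).norm_coe_le_norm _)

theorem IsTwoScaleTestFunction.eLpNorm_eval_le (φ : Eucl n → BoundedContinuousFunction (Eucl m) (Eucl d))
    (g : Eucl n → Eucl m) (q : ℝ≥0∞) (μ : Measure (Eucl n)) :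
    eLpNorm (fun x => φ x (g x)) q μ ≤ eLpNorm φ q μ :=
  eLpNorm_mono fun x => (φ x).norm_coe_le_norm _

/-- Writing the limit pairing as one integral over a product space makes Hölder's inequality there
directly applicable. -/
theorem setIntegral_average_inner_eq (hpq : p⁻¹ + q⁻¹ = 1) (hφ : IsTwoScaleTestFunction Ω q b φ)
    {U : Eucl n × Eucl m → Eucl d}
    (hU : MemLp (fun w : Eucl n × UnitAddTorus (Fin m) => U (w.1, cellSection a b w.2)) p
      ((volume.restrict Ω).prod volume)) :
    ∫ x in Ω, ⨍ y in parallelotope a b, inner ℝ (U (x, y)) (φ x y) =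
      ∫ w : Eucl n × UnitAddTorus (Fin m), inner ℝ (U (w.1, cellSection a b w.2))
        (φ w.1 (cellSection a b w.2)) ∂((volume.restrict Ω).prod volume) := by
  rw [integral_prod _ (integrable_inner_of_memLp hpq hU (hφ.memLp_prod a))]
  simp only [average_cell_eq]

/-! ### Asymptotics of oscillating gradients -/

variable {R : Matrix (Fin m) (Fin n) ℝ} {Φ Ψ : Eucl n × Eucl m → ℝ} {μ : Measure (Eucl n)}

theorem tendsto_eLpNorm_smul_oscillating [IsFiniteMeasure μ] {E : Type*} [NormedAddCommGroup E]
    [NormedSpace ℝ E] {K : Set (Eucl n)} {F : Eucl n × Eucl m → E} (hF : IsOscillatingField b K F)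
    (hK : IsCompact K) {ε : ℕ → ℝ} (hε : Tendsto ε atTop (𝓝 0)) (y : ℕ → Eucl n → Eucl m) :
    Tendsto (fun j => eLpNorm (fun x => ε j • F (x, y j x)) p μ) atTop (𝓝 0) := by
  obtain ⟨C, hC0, hC⟩ := hF.exists_bound hK
  have hlim : Tendsto (fun j => μ Set.univ ^ p.toReal⁻¹ * ENNReal.ofReal (|ε j| * C)) atTop (𝓝 0) := by
    have h1 : Tendsto (fun j => ENNReal.ofReal (|ε j| * C)) atTop (𝓝 0) := by
      have : Tendsto (fun j => |ε j| * C) atTop (𝓝 0) := by simpa using hε.abs.mul_const C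
      simpa using ENNReal.tendsto_ofReal this
    have h2 : μ Set.univ ^ p.toReal⁻¹ ≠ ⊤ :=
      ENNReal.rpow_ne_top_of_nonneg (by positivity) (measure_ne_top μ _)
    simpa using ENNReal.Tendsto.const_mul h1 (Or.inr h2)
  refine tendsto_of_tendsto_of_tendsto_of_le_of_le tendsto_const_nhds hlim (fun _ => zero_le)
    fun j => eLpNorm_le_of_ae_bound (ae_of_all _ fun x => ?_)
  rw [norm_smul, Real.norm_eq_abs]
  exact mul_le_mul_of_nonneg_left (hC _) (abs_nonneg _)

theorem slowGradient_sub (hΦ : Differentiable ℝ Φ) (hΨ : Differentiable ℝ Ψ) (z : Eucl n × Eucl m) :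
    slowGradient (Φ - Ψ) z = slowGradient Φ z - slowGradient Ψ z := by
  ext l
  simp [slowGradient, fderiv_sub (hΦ z) (hΨ z)]

theorem oscillatingGradient_sub (hΦ : Differentiable ℝ Φ) (hΨ : Differentiable ℝ Ψ) (ε : ℝ)
    (x : Eucl n) : oscillatingGradient R ε (Φ - Ψ) x =
      oscillatingGradient R ε Φ x - oscillatingGradient R ε Ψ x := by
  simp only [oscillatingGradient, slowGradient_sub hΦ hΨ, cellGradient_sub R hΦ hΨ, smul_sub]
  abel

theorem oscillatingGradient_zero (ε : ℝ) (x : Eucl n) :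
    oscillatingGradient R ε (0 : Eucl n × Eucl m → ℝ) x = 0 := by
  have : slowGradient (0 : Eucl n × Eucl m → ℝ) (x, ε⁻¹ • R.toEuclideanLin x) = 0 := by
    ext l; simp [slowGradient]
  rw [oscillatingGradient, this, cellGradient_zero, smul_zero, add_zero]

theorem continuous_pair_oscillation (R : Matrix (Fin m) (Fin n) ℝ) (s : ℝ) :
    Continuous fun x : Eucl n => (x, s • R.toEuclideanLin x) :=
  continuous_id.prodMk (continuous_oscillation R s)

theorem IsOscillatingField.memLp_comp [IsFiniteMeasure μ] {E : Type*} [NormedAddCommGroup E]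
    [SecondCountableTopology E]
    {K : Set (Eucl n)} {F : Eucl n × Eucl m → E} (hF : IsOscillatingField b K F)
    (hK : IsCompact K) {X : Type*} [MeasurableSpace X] {ν : Measure X} [IsFiniteMeasure ν]
    {g : X → Eucl n × Eucl m} (hg : Measurable g) : MemLp (fun x => F (g x)) p ν := by
  borelize E
  obtain ⟨C, -, hC⟩ := hF.exists_bound hK
  exact MemLp.of_bound (hF.continuous.measurable.comp hg).aestronglyMeasurable C
    (ae_of_all _ fun x => hC _)

theorem IsCellPotential.memLp_oscillatingPotential [IsFiniteMeasure μ]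
    (hΦ : IsCellPotential b Ω Φ) (R : Matrix (Fin m) (Fin n) ℝ) (ε : ℝ) :
    MemLp (oscillatingPotential R ε Φ) p μ := by
  obtain ⟨K, -, hK, h, -, -⟩ := hΦ.exists_isOscillatingField R
  exact (h.memLp_comp (μ := μ) hK (continuous_pair_oscillation R ε⁻¹).measurable).const_mul ε

theorem IsCellPotential.memLp_oscillatingGradient [IsFiniteMeasure μ]
    (hΦ : IsCellPotential b Ω Φ) (R : Matrix (Fin m) (Fin n) ℝ) (ε : ℝ) :
    MemLp (oscillatingGradient R ε Φ) p μ := by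
  obtain ⟨K, -, hK, -, h, h'⟩ := hΦ.exists_isOscillatingField R
  have hg := (continuous_pair_oscillation R ε⁻¹).measurable
  exact ((h'.memLp_comp (μ := μ) hK hg).const_smul ε).add (h.memLp_comp (μ := μ) hK hg)

theorem eventually_eLpNorm_oscillatingPotential_le [IsFiniteMeasure μ] (hΦ : IsCellPotential b Ω Φ)
    (R : Matrix (Fin m) (Fin n) ℝ) {ε : ℕ → ℝ} (hε : Tendsto ε atTop (𝓝 0)) {δ : ℝ≥0∞} (hδ : δ ≠ 0) :
    ∀ᶠ j in atTop, eLpNorm (oscillatingPotential R (ε j) Φ) p μ ≤ δ := by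
  obtain ⟨K, -, hK, h, -, -⟩ := hΦ.exists_isOscillatingField R
  exact ENNReal.tendsto_nhds_zero.1 (tendsto_eLpNorm_smul_oscillating h hK hε
    fun j x => (ε j)⁻¹ • R.toEuclideanLin x) δ (pos_iff_ne_zero.2 hδ)

theorem tendsto_inv_atTop_of_pos {ε : ℕ → ℝ} (hε : ∀ j, 0 < ε j) (hε_lim : Tendsto ε atTop (𝓝 0)) :
    Tendsto (fun j => (ε j)⁻¹) atTop atTop :=
  tendsto_inv_nhdsGT_zero.comp (tendsto_nhdsWithin_iff.2 ⟨hε_lim, Eventually.of_forall hε⟩)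

/-- The slow part carries a factor `ε` and vanishes in `L^p`; the fast part has asymptotically its
norm on the product with the torus. The slack `δ` turns the limit into an eventual inequality. -/
theorem eventually_eLpNorm_oscillatingGradient_le (a : Eucl m) (hΦ : IsCellPotential b Ω Φ)
    (hR : IrrationalityCondition R b) (hΩ : MeasurableSet Ω) (hΩv : volume Ω ≠ ⊤) (hp : 1 ≤ p)
    (hp' : p ≠ ⊤) {ε : ℕ → ℝ} (hε : ∀ j, 0 < ε j) (hε_lim : Tendsto ε atTop (𝓝 0)) {δ : ℝ≥0∞}
    (hδ : δ ≠ 0) :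
    ∀ᶠ j in atTop, eLpNorm (oscillatingGradient R (ε j) Φ) p (volume.restrict Ω) ≤
      eLpNorm (fun w : Eucl n × UnitAddTorus (Fin m) => cellGradient R Φ (w.1, cellSection a b w.2)) p
        ((volume.restrict Ω).prod volume) + δ := by
  have : IsFiniteMeasure (volume.restrict Ω) := isFiniteMeasure_restrict.2 hΩv
  obtain ⟨K, -, hK, -, h, h'⟩ := hΦ.exists_isOscillatingField R
  have h1 := tendsto_eLpNorm_oscillating a h hK hR (tendsto_inv_atTop_of_pos hε hε_lim) hΩ
    (zero_lt_one.trans_le hp).ne' hp'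
  have h2 := tendsto_eLpNorm_smul_oscillating (p := p) (μ := volume.restrict Ω) h' hK hε_lim
    fun j x => (ε j)⁻¹ • R.toEuclideanLin x
  have h3 := h2.add h1
  rw [zero_add] at h3
  have hfin : eLpNorm (fun w : Eucl n × UnitAddTorus (Fin m) =>
      cellGradient R Φ (w.1, cellSection a b w.2)) p ((volume.restrict Ω).prod volume) ≠ ⊤ :=
    (h.memLp_comp (μ := volume.restrict Ω) hK (measurable_prod_cellSection a b)).eLpNorm_ne_top
  filter_upwards [h3.eventually_lt_const (ENNReal.lt_add_right hfin hδ)] with j hj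
  refine le_trans (eLpNorm_add_le ?_ ?_ hp) hj.le
  · exact ((h'.continuous.comp (continuous_pair_oscillation R _)).const_smul (ε j)).aestronglyMeasurable
  · exact (h.continuous.comp (continuous_pair_oscillation R _)).aestronglyMeasurable

theorem tendsto_integral_inner_of_tendsto_eLpNorm {X E : Type*} [MeasurableSpace X]
    [NormedAddCommGroup E] [InnerProductSpace ℝ E] {μ : Measure X} (hpq : p⁻¹ + q⁻¹ = 1)
    {f g : ℕ → X → E} (hf : ∀ j, AEStronglyMeasurable (f j) μ)
    (hg : ∀ j, AEStronglyMeasurable (g j) μ)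
    (hf_lim : Tendsto (fun j => eLpNorm (f j) p μ) atTop (𝓝 0)) {C : ℝ≥0∞} (hC : C ≠ ⊤)
    (hgC : ∀ j, eLpNorm (g j) q μ ≤ C) :
    Tendsto (fun j => ∫ x, inner ℝ (f j x) (g j x) ∂μ) atTop (𝓝 0) := by
  rw [tendsto_zero_iff_enorm_tendsto_zero]
  have h := ENNReal.Tendsto.mul_const hf_lim (Or.inr hC)
  rw [zero_mul] at h
  exact tendsto_of_tendsto_of_tendsto_of_le_of_le tendsto_const_nhds h (fun _ => zero_le)
    fun j => (enorm_integral_inner_le hpq (hf j) (hg j)).trans (mul_le_mul_right (hgC j) _)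

/-- This lets a field depending on `x` alone, such as the gradient of `v₀`, enter the mean value
statement without being smooth. -/
theorem memLp_const_boundedContinuousFunction {X E : Type*} [MeasurableSpace X]
    [NormedAddCommGroup E] {μ : Measure X} {g : X → E} (hg : MemLp g p μ) :
    MemLp (fun x => BoundedContinuousFunction.const (Eucl m) (g x)) p μ := by
  refine hg.of_le ?_ (ae_of_all _ fun x => norm_const_le _)
  have : Continuous fun v : E => BoundedContinuousFunction.const (Eucl m) v :=
    (LipschitzWith.of_dist_le_mul (K := 1) fun v w => by
      rw [NNReal.coe_one, one_mul, BoundedContinuousFunction.dist_le dist_nonneg]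
      intro y; exact le_rfl).continuous
  exact this.comp_aestronglyMeasurable hg.aestronglyMeasurable

theorem tendsto_integral_inner_const (a : Eucl m) (hR : IrrationalityCondition R b)
    (hΩ : MeasurableSet Ω) (hpq : p⁻¹ + q⁻¹ = 1) {s : ℕ → ℝ} (hs : Tendsto s atTop atTop)
    {g : Eucl n → Eucl d} (hg : MemLp g p (volume.restrict Ω)) (hφ : IsTwoScaleTestFunction Ω q b φ) :
    Tendsto (fun j => ∫ x in Ω, inner ℝ (g x) (φ x (s j • R.toEuclideanLin x))) atTop
      (𝓝 (∫ w : Eucl n × UnitAddTorus (Fin m), inner ℝ (g w.1) (φ w.1 (cellSection a b w.2))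
          ∂((volume.restrict Ω).prod volume))) := by
  have h := tendsto_integral_inner_oscillating a hR hs hΩ hpq
    (memLp_const_boundedContinuousFunction hg) (fun _ _ _ => rfl) hφ.1 hφ.2
  simp only [const_apply] at h
  rwa [setIntegral_average_inner_eq (U := fun z => g z.1) hpq hφ (hg.comp_fst volume)] at h

theorem tendsto_integral_inner_oscillatingField (a : Eucl m) (hR : IrrationalityCondition R b)
    (hΩ : MeasurableSet Ω) (hΩv : volume Ω ≠ ⊤) (hpq : p⁻¹ + q⁻¹ = 1) {s : ℕ → ℝ}
    (hs : Tendsto s atTop atTop) {K : Set (Eucl n)} (hK : IsCompact K)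
    {F : Eucl n × Eucl m → Eucl d} (hF : IsOscillatingField b K F)
    (hφ : IsTwoScaleTestFunction Ω q b φ) :
    Tendsto (fun j => ∫ x in Ω, inner ℝ (F (x, s j • R.toEuclideanLin x))
        (φ x (s j • R.toEuclideanLin x))) atTop
      (𝓝 (∫ w : Eucl n × UnitAddTorus (Fin m),
        inner ℝ (F (w.1, cellSection a b w.2)) (φ w.1 (cellSection a b w.2))
          ∂((volume.restrict Ω).prod volume))) := by
  have : IsFiniteMeasure (volume.restrict Ω) := isFiniteMeasure_restrict.2 hΩv
  obtain ⟨G, hG, hGc, hGF⟩ := hF.exists_boundedFamily hK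
  have h := tendsto_integral_inner_oscillating a hR hs hΩ hpq
    (hG.memLp_of_hasCompactSupport (p := p) (μ := volume.restrict Ω) hGc)
    (fun x i y => by simp only [hGF]; exact hF.periodic x i y) hφ.1 hφ.2
  simp only [hGF] at h
  rwa [setIntegral_average_inner_eq hpq hφ
    (hF.memLp_comp (μ := volume.restrict Ω) hK (measurable_prod_cellSection a b))] at h

/-- A fixed function plus a rapidly oscillating gradient two-scale converges. -/
theorem tendsto_integral_inner_oscillatingGradient (a : Eucl m) {Φ : Eucl n × Eucl m → ℝ}
    {φ : Eucl n → BoundedContinuousFunction (Eucl m) (Eucl n)}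
    (hΦ : IsCellPotential b Ω Φ) (hR : IrrationalityCondition R b) (hΩ : MeasurableSet Ω)
    (hΩv : volume Ω ≠ ⊤) (hpq : p⁻¹ + q⁻¹ = 1) {ε : ℕ → ℝ} (hε : ∀ j, 0 < ε j)
    (hε_lim : Tendsto ε atTop (𝓝 0)) {g : Eucl n → Eucl n} (hg : MemLp g p (volume.restrict Ω))
    (hφ : IsTwoScaleTestFunction Ω q b φ) :
    Tendsto (fun j => ∫ x in Ω, inner ℝ (g x + oscillatingGradient R (ε j) Φ x)
        (φ x ((ε j)⁻¹ • R.toEuclideanLin x))) atTop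
      (𝓝 (∫ w : Eucl n × UnitAddTorus (Fin m),
        inner ℝ (g w.1 + cellGradient R Φ (w.1, cellSection a b w.2)) (φ w.1 (cellSection a b w.2))
          ∂((volume.restrict Ω).prod volume))) := by
  have : IsFiniteMeasure (volume.restrict Ω) := isFiniteMeasure_restrict.2 hΩv
  obtain ⟨K, -, hK, -, h, h'⟩ := hΦ.exists_isOscillatingField R
  have hs := tendsto_inv_atTop_of_pos hε hε_lim
  have hφj := fun j => hφ.memLp_eval (continuous_oscillation R (ε j)⁻¹)
  have hhj : ∀ j, MemLp (fun x => cellGradient R Φ (x, (ε j)⁻¹ • R.toEuclideanLin x)) p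
      (volume.restrict Ω) := fun j =>
    h.memLp_comp (μ := volume.restrict Ω) hK (continuous_pair_oscillation R (ε j)⁻¹).measurable
  have hh'j : ∀ j, MemLp (fun x => ε j • slowGradient Φ (x, (ε j)⁻¹ • R.toEuclideanLin x)) p
      (volume.restrict Ω) := fun j =>
    (h'.memLp_comp (μ := volume.restrict Ω) hK
      (continuous_pair_oscillation R (ε j)⁻¹).measurable).const_smul (ε j)
  have h1 := tendsto_integral_inner_const a hR hΩ hpq hs hg hφ
  have h2 := tendsto_integral_inner_oscillatingField a hR hΩ hΩv hpq hs hK h hφ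
  have h3 := tendsto_integral_inner_of_tendsto_eLpNorm hpq (fun j => (hh'j j).1)
    (fun j => (hφj j).1) (tendsto_eLpNorm_smul_oscillating (μ := volume.restrict Ω) h' hK hε_lim _)
    hφ.1.eLpNorm_ne_top (fun j => IsTwoScaleTestFunction.eLpNorm_eval_le _ _ _ _)
  have h4 := (h1.add h2).add h3
  rw [add_zero, ← integral_add (integrable_inner_of_memLp hpq (hg.comp_fst volume) (hφ.memLp_prod a))
    (integrable_inner_of_memLp hpq
      (h.memLp_comp (μ := volume.restrict Ω) hK (measurable_prod_cellSection a b))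
      (hφ.memLp_prod a))] at h4
  simp only [inner_add_left]
  refine h4.congr fun j => ?_
  have i1 := integrable_inner_of_memLp hpq hg (hφj j)
  have i2 := integrable_inner_of_memLp hpq (hhj j) (hφj j)
  have i3 := integrable_inner_of_memLp hpq (hh'j j) (hφj j)
  rw [← integral_add i1 i2]
  refine (integral_add (i1.add i2) i3).symm.trans ?_
  refine integral_congr_ae (ae_of_all _ fun x => ?_)
  simp only [oscillatingGradient, inner_add_left, Pi.add_apply]
  ring

end Pairing

/-! ### Recovery sequences -/

section Recovery

variable {n m : ℕ} {a : Eucl m} {b : Module.Basis (Fin m) ℝ (Eucl m)} {Ω : Set (Eucl n)}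
  {p q : ℝ≥0∞} {R : Matrix (Fin m) (Fin n) ℝ}

/-- Diagonal selection: take the largest `N ≤ j` for which `P N j` holds. Level 0 is always
admissible, and each level `M` is eventually available. -/
theorem exists_tendsto_atTop_of_eventually {P : ℕ → ℕ → Prop} (h0 : ∀ j, P 0 j)
    (h : ∀ N, ∀ᶠ j in atTop, P N j) : ∃ N : ℕ → ℕ, Tendsto N atTop atTop ∧ ∀ j, P (N j) j := by
  classical
  refine ⟨fun j => Nat.findGreatest (fun N => P N j) j, tendsto_atTop.2 fun M => ?_, fun j =>
    Nat.findGreatest_spec (P := fun N => P N j) (Nat.zero_le j) (h0 j)⟩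
  filter_upwards [h M, eventually_ge_atTop M] with j hj hMj
  exact Nat.le_findGreatest hMj hj

/-- Comparison with a frozen level `M`: the diagonal sequence stays within `E (N j) + E M` of a
sequence whose limit is known and lies within `E M` of `l`. -/
theorem tendsto_of_enorm_sub_le {I : ℕ → ℝ} {l : ℝ} {J : ℕ → ℕ → ℝ} {L : ℕ → ℝ} {N : ℕ → ℕ}
    (hN : Tendsto N atTop atTop) {E : ℕ → ℝ≥0∞} (hE : Tendsto E atTop (𝓝 0))
    (hJ : ∀ M, Tendsto (J M) atTop (𝓝 (L M)))
    (hI : ∀ M, ∀ᶠ j in atTop, ‖I j - J M j‖ₑ ≤ E (N j) + E M) (hL : ∀ M, ‖L M - l‖ₑ ≤ E M) :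
    Tendsto I atTop (𝓝 l) := by
  rw [tendsto_iff_edist_tendsto_0, ENNReal.tendsto_nhds_zero]
  intro δ hδ
  have hδ4 : 0 < δ / 4 := ENNReal.div_pos hδ.ne' (by norm_num)
  obtain ⟨M, hM⟩ := (ENNReal.tendsto_nhds_zero.1 hE _ hδ4).exists
  filter_upwards [hI M, hN.eventually (ENNReal.tendsto_nhds_zero.1 hE _ hδ4),
    ENNReal.tendsto_nhds_zero.1 (tendsto_iff_edist_tendsto_0.1 (hJ M)) _ hδ4] with j h1 h2 h3
  calc edist (I j) l ≤ edist (I j) (J M j) + edist (J M j) (L M) + edist (L M) l :=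
        edist_triangle4 _ _ _ _
    _ ≤ (δ / 4 + δ / 4) + δ / 4 + δ / 4 := by
        refine add_le_add (add_le_add ?_ h3) ?_
        · rw [edist_eq_enorm_sub]; exact h1.trans (add_le_add h2 hM)
        · rw [edist_eq_enorm_sub]; exact (hL M).trans hM
    _ = 4 * (δ / 4) := by ring
    _ = δ := ENNReal.mul_div_cancel (by norm_num) (by norm_num)

theorem enorm_integral_inner_sub_le {X E : Type*} [MeasurableSpace X] [NormedAddCommGroup E]
    [InnerProductSpace ℝ E] {μ : Measure X} (hpq : p⁻¹ + q⁻¹ = 1) {f f' g : X → E}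
    (hf : MemLp f p μ) (hf' : MemLp f' p μ) (hg : MemLp g q μ) :
    ‖∫ x, inner ℝ (f x) (g x) ∂μ - ∫ x, inner ℝ (f' x) (g x) ∂μ‖ₑ ≤
      eLpNorm (f - f') p μ * eLpNorm g q μ := by
  rw [← integral_sub (integrable_inner_of_memLp hpq hf hg) (integrable_inner_of_memLp hpq hf' hg)]
  simp only [← inner_sub_left]
  exact enorm_integral_inner_le hpq (hf.1.sub hf'.1) hg.1

variable {V : Eucl n × UnitAddTorus (Fin m) → Eucl n}

/-- The requirement `Φ 0 = 0` provides the always admissible starting level for the diagonal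
selection. -/
theorem IsCellGradientLimit.exists_seq (hV : IsCellGradientLimit R a b Ω p V) :
    ∃ Φ : ℕ → Eucl n × Eucl m → ℝ, Φ 0 = 0 ∧ (∀ N, IsCellPotential b Ω (Φ N)) ∧
      Tendsto (fun N => eLpNorm (fun w => V w - cellGradient R (Φ N) (w.1, cellSection a b w.2)) p
        ((volume.restrict Ω).prod volume)) atTop (𝓝 0) := by
  have hδ : ∀ N : ℕ, ((N : ℝ≥0∞))⁻¹ ≠ 0 := fun N => ENNReal.inv_ne_zero.2 (ENNReal.natCast_ne_top N)
  choose Φ hΦ hΦV using fun N : ℕ => hV.2 _ (hδ N)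
  refine ⟨fun N => if N = 0 then 0 else Φ N, if_pos rfl, fun N => ?_, ?_⟩
  · dsimp only
    split_ifs
    exacts [isCellPotential_zero, hΦ N]
  · refine tendsto_of_tendsto_of_tendsto_of_le_of_le' tendsto_const_nhds
      ENNReal.tendsto_inv_nat_nhds_zero (Eventually.of_forall fun _ => zero_le) ?_
    filter_upwards [eventually_ne_atTop 0] with N hN
    simpa only [if_neg hN] using hΦV N

/-- For each `j` the potential level `N j` grows so slowly that its oscillating gradient remains
close, in `L^p(Ω)`, to those of all lower levels. Comparison with level 0 bounds the sequence;
comparison with a fixed level `M` identifies the two-scale limit. -/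
theorem exists_recovery_sequence (hR : IrrationalityCondition R b) (hΩ : MeasurableSet Ω)
    (hΩv : volume Ω ≠ ⊤) (hp : 1 ≤ p) (hp' : p ≠ ⊤) (hpq : p⁻¹ + q⁻¹ = 1) {ε : ℕ → ℝ}
    (hε : ∀ j, 0 < ε j) (hε_lim : Tendsto ε atTop (𝓝 0)) {v₀ : Eucl n → ℝ} {g₀ : Eucl n → Eucl n}
    (h₀ : IsSobolevWithGradient Ω p v₀ g₀) (hV : MemLp V p ((volume.restrict Ω).prod volume))
    (hVR : IsCellGradientLimit R a b Ω p V) :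
    ∃ (vε : ℕ → Eucl n → ℝ) (gε : ℕ → Eucl n → Eucl n), IsBoundedSobolevSeq Ω p vε gε ∧
      ∀ φ : Eucl n → BoundedContinuousFunction (Eucl m) (Eucl n), IsTwoScaleTestFunction Ω q b φ →
        Tendsto (fun j => ∫ x in Ω, inner ℝ (gε j x) (φ x ((ε j)⁻¹ • R.toEuclideanLin x))) atTop
          (𝓝 (∫ w : Eucl n × UnitAddTorus (Fin m), inner ℝ (g₀ w.1 + V w)
            (φ w.1 (cellSection a b w.2)) ∂((volume.restrict Ω).prod volume))) := by
  have : IsFiniteMeasure (volume.restrict Ω) := isFiniteMeasure_restrict.2 hΩv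
  obtain ⟨Φ, hΦ0, hΦ, hD⟩ := hVR.exists_seq
  set D : ℕ → ℝ≥0∞ := fun N => eLpNorm (fun w => V w -
    cellGradient R (Φ N) (w.1, cellSection a b w.2)) p ((volume.restrict Ω).prod volume) with hDdef
  have hfield : ∀ N, AEStronglyMeasurable (fun w : Eucl n × UnitAddTorus (Fin m) =>
      cellGradient R (Φ N) (w.1, cellSection a b w.2)) ((volume.restrict Ω).prod volume) :=
    fun N => (hΦ N).aestronglyMeasurable_cellGradient R a _
  have hfieldp : ∀ N, MemLp (fun w : Eucl n × UnitAddTorus (Fin m) =>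
      cellGradient R (Φ N) (w.1, cellSection a b w.2)) p ((volume.restrict Ω).prod volume) := by
    intro N
    obtain ⟨K, -, hK, -, h, -⟩ := (hΦ N).exists_isOscillatingField R
    exact h.memLp_comp (μ := volume.restrict Ω) hK (measurable_prod_cellSection a b)
  have hD0 : D 0 = eLpNorm V p ((volume.restrict Ω).prod volume) := by
    simp only [hDdef, hΦ0, cellGradient_zero, sub_zero]
  have hdiff : ∀ N M, eLpNorm (fun w : Eucl n × UnitAddTorus (Fin m) =>
      cellGradient R (Φ N - Φ M) (w.1, cellSection a b w.2)) p ((volume.restrict Ω).prod volume) ≤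
        D N + D M := by
    intro N M
    have h := eLpNorm_sub_le (hV.1.sub (hfield M)) (hV.1.sub (hfield N)) hp
    refine le_trans (le_of_eq ?_) (h.trans (le_of_eq (add_comm _ _)))
    congr 1
    ext1 w
    rw [cellGradient_sub R (hΦ N).differentiable (hΦ M).differentiable]
    simp only [Pi.sub_apply]
    abel
  let e : ℕ → ℝ≥0∞ := fun N => ((N : ℝ≥0∞) + 1)⁻¹
  have he : ∀ N, e N ≠ 0 := fun N => by simp [e]
  have he1 : ∀ N, e N ≤ 1 := fun N => by simp [e]
  have he_lim : Tendsto e atTop (𝓝 0) := by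
    have := (tendsto_add_atTop_iff_nat 1).2 ENNReal.tendsto_inv_nat_nhds_zero
    simpa [e] using this
  -- The bound `D N + D M` is the triangle inequality through `V` on the product space. The positive
  -- `e N` absorbs the error of the asymptotic isometry. Only finitely many `M` are involved, so
  -- each level is eventually admissible.
  let P : ℕ → ℕ → Prop := fun N j =>
    eLpNorm (oscillatingPotential R (ε j) (Φ N)) p (volume.restrict Ω) ≤ 1 ∧ ∀ M ≤ N,
      eLpNorm (oscillatingGradient R (ε j) (Φ N - Φ M)) p (volume.restrict Ω) ≤ D N + D M + e N
  have hzero : ∀ j, oscillatingGradient R (ε j) (0 : Eucl n × Eucl m → ℝ) = 0 := fun j => by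
    ext1 x; exact oscillatingGradient_zero _ _
  have hP0 : ∀ j, P 0 j := by
    intro j
    refine ⟨?_, fun M hM => ?_⟩
    · have : oscillatingPotential R (ε j) (Φ 0) = 0 := by
        ext1 x; simp [oscillatingPotential, hΦ0]
      rw [this]; simp
    · rw [Nat.le_zero.1 hM, sub_self, hzero]; simp
  have hP : ∀ N, ∀ᶠ j in atTop, P N j := by
    intro N
    refine (eventually_eLpNorm_oscillatingPotential_le (hΦ N) R hε_lim one_ne_zero).and ?_
    have : ∀ M ∈ Set.Iic N, ∀ᶠ j in atTop,
        eLpNorm (oscillatingGradient R (ε j) (Φ N - Φ M)) p (volume.restrict Ω) ≤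
          D N + D M + e N := by
      intro M _
      filter_upwards [eventually_eLpNorm_oscillatingGradient_le a ((hΦ N).sub (hΦ M)) hR hΩ hΩv hp
        hp' hε hε_lim (he N)] with j hj
      exact hj.trans (by gcongr; exact hdiff N M)
    exact (Set.finite_Iic N).eventually_all.2 this
  obtain ⟨N, hN, hNP⟩ := exists_tendsto_atTop_of_eventually hP0 hP
  have hgradp : ∀ M j, MemLp (oscillatingGradient R (ε j) (Φ M)) p (volume.restrict Ω) :=
    fun M j => (hΦ M).memLp_oscillatingGradient R (ε j)
  have hpotp : ∀ M j, MemLp (oscillatingPotential R (ε j) (Φ M)) p (volume.restrict Ω) :=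
    fun M j => (hΦ M).memLp_oscillatingPotential R (ε j)
  have hsub : ∀ M M' j, oscillatingGradient R (ε j) (Φ M - Φ M') =
      oscillatingGradient R (ε j) (Φ M) - oscillatingGradient R (ε j) (Φ M') := fun M M' j => by
    ext1 x
    exact oscillatingGradient_sub (hΦ M).differentiable (hΦ M').differentiable _ _
  refine ⟨fun j => v₀ + oscillatingPotential R (ε j) (Φ (N j)),
    fun j => g₀ + oscillatingGradient R (ε j) (Φ (N j)), ⟨fun j => ⟨h₀.memLp.add (hpotp _ _),
      h₀.memLp_gradient.add (hgradp _ _), ?_⟩, ?_⟩, fun φ hφ => ?_⟩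
  · exact h₀.hasWeakGradient.add (hasWeakGradient_oscillating (hΦ _).contDiff R (hε j).ne' Ω)
      (h₀.memLp.integrable hp) ((hpotp _ _).integrable hp) (h₀.memLp_gradient.integrable hp)
      ((hgradp _ _).integrable hp)
  -- The distances `D` are all finite and tend to 0, hence are bounded: by 1 beyond `N₀`, by a
  -- finite sum before.
  · obtain ⟨B, hB⟩ : ∃ B : ℝ≥0, ∀ j, D (N j) ≤ B := by
      obtain ⟨N₀, hN₀⟩ := eventually_atTop.1 (ENNReal.tendsto_nhds_zero.1 hD 1 one_pos)
      have hDtop : ∀ M, D M ≠ ⊤ := fun M => (hV.sub (hfieldp M)).eLpNorm_ne_top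
      refine ⟨(1 + ∑ M ∈ Finset.range N₀, D M).toNNReal, fun j => ?_⟩
      rw [ENNReal.coe_toNNReal (ENNReal.add_ne_top.2
        ⟨ENNReal.one_ne_top, ENNReal.sum_ne_top.2 fun M _ => hDtop M⟩)]
      rcases le_or_gt N₀ (N j) with h | h
      · exact (hN₀ _ h).trans le_self_add
      · exact (Finset.single_le_sum (f := D) (fun _ _ => zero_le) (Finset.mem_range.2 h)).trans
          le_add_self
    have hfin : (eLpNorm v₀ p (volume.restrict Ω) + 1) + (eLpNorm g₀ p (volume.restrict Ω) +
        (B + D 0 + 1)) ≠ ⊤ := by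
      rw [hD0]
      simp only [ne_eq, ENNReal.add_eq_top, not_or]
      exact ⟨⟨h₀.memLp.eLpNorm_ne_top, ENNReal.one_ne_top⟩, h₀.memLp_gradient.eLpNorm_ne_top,
        ⟨ENNReal.coe_ne_top, hV.eLpNorm_ne_top⟩, ENNReal.one_ne_top⟩
    refine ⟨ENNReal.toNNReal _, fun j => le_trans ?_ (ENNReal.coe_toNNReal hfin).ge⟩
    refine add_le_add ((eLpNorm_add_le h₀.memLp.1 (hpotp _ _).1 hp).trans ?_)
      ((eLpNorm_add_le h₀.memLp_gradient.1 (hgradp _ _).1 hp).trans ?_)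
    · gcongr
      exact (hNP j).1
    · gcongr
      -- Level 0 carries the zero potential, so this comparison bounds the oscillating gradient
      -- itself.
      have h := (hNP j).2 0 (Nat.zero_le _)
      rw [hΦ0, sub_zero] at h
      exact h.trans (by gcongr; exacts [hB j, he1 _])
  · have hφtop := hφ.1.eLpNorm_ne_top
    have hφj := fun j => hφ.memLp_eval (continuous_oscillation R (ε j)⁻¹)
    have hφjle := fun j => IsTwoScaleTestFunction.eLpNorm_eval_le φ
      (fun x => (ε j)⁻¹ • R.toEuclideanLin x) q (volume.restrict Ω)
    have hφw := hφ.memLp_prod a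
    have hφwle : eLpNorm (fun w : Eucl n × UnitAddTorus (Fin m) => φ w.1 (cellSection a b w.2)) q
        ((volume.restrict Ω).prod volume) ≤ eLpNorm φ q (volume.restrict Ω) := by
      have h := eLpNorm_mono (p := q) (μ := (volume.restrict Ω).prod volume)
        (f := fun w : Eucl n × UnitAddTorus (Fin m) => φ w.1 (cellSection a b w.2))
        (g := fun w => φ w.1) fun w => (φ w.1).norm_coe_le_norm _
      refine h.trans (le_of_eq ?_)
      exact eLpNorm_comp_measurePreserving hφ.1.1 measurePreserving_fst
    refine tendsto_of_enorm_sub_le (E := fun M => (D M + e M) * eLpNorm φ q (volume.restrict Ω)) hN ?_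
      (fun M => tendsto_integral_inner_oscillatingGradient a (hΦ M) hR hΩ hΩv hpq hε hε_lim
        h₀.memLp_gradient hφ) (fun M => ?_) (fun M => ?_)
    · have h := ENNReal.Tendsto.mul_const (hD.add he_lim) (Or.inr hφtop)
      simpa using h
    -- Once `N j ≥ M`, the frozen level `M` is among those compared in `P`.
    · filter_upwards [hN.eventually_ge_atTop M] with j hj
      rw [← add_mul]
      refine (enorm_integral_inner_sub_le hpq (h₀.memLp_gradient.add (hgradp (N j) j))
        (h₀.memLp_gradient.add (hgradp M j)) (hφj j)).trans (mul_le_mul' ?_ (hφjle j))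
      rw [add_sub_add_left_eq_sub, ← hsub]
      refine ((hNP j).2 M hj).trans ?_
      rw [add_right_comm]
      exact add_le_add_right le_self_add _
    · refine (enorm_integral_inner_sub_le hpq
        ((h₀.memLp_gradient.comp_fst volume).add (hfieldp M))
        ((h₀.memLp_gradient.comp_fst volume).add hV) hφw).trans (mul_le_mul' ?_ hφwle)
      rw [add_sub_add_left_eq_sub, ← eLpNorm_neg]
      refine le_trans (le_of_eq ?_) le_self_add
      simp only [hDdef]
      congr 1
      ext1 w
      simp

end Recovery

/-! ### Decomposed fields are two-scale limits of gradients -/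

section Sufficiency

variable {n m : ℕ} {a : Eucl m} {b : Module.Basis (Fin m) ℝ (Eucl m)} {Ω : Set (Eucl n)}
  {p q : ℝ≥0∞} {R : Matrix (Fin m) (Fin n) ℝ}

theorem MemLpGR.isCellGradientLimit (hΩ : IsOpen Ω) (hΩv : volume Ω ≠ ⊤) (hp : 1 ≤ p) (hp' : p ≠ ⊤)
    {v₁ : Eucl n × Eucl m → Eucl n} (h : MemLpGR Ω p R a b v₁) :
    IsCellGradientLimit R a b Ω p fun w => v₁ (w.1, cellSection a b w.2) := by
  refine isCellGradientLimit_of_mFourierCoeff hΩ hΩv hp hp' (memLp_comp_cellSection h.1) ?_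
  filter_upwards [h.2] with x hx z
  obtain ⟨-, c, -, hc⟩ := hx
  refine ⟨c (freq b z), fun l => ?_⟩
  rw [← hc _ (freq_mem_dualLattice b z) l, cellFourierCoeff_freq a b]

theorem exists_twoScaleConverges_of_decomposition (hΩ : IsOpen Ω) (hΩv : volume Ω ≠ ⊤) (hp : 1 ≤ p)
    (hp' : p ≠ ⊤) (hpq : p⁻¹ + q⁻¹ = 1) (hR : IrrationalityCondition R b) {ε : ℕ → ℝ}
    (hε : ∀ j, 0 < ε j) (hε_lim : Tendsto ε atTop (𝓝 0)) {v : Eucl n × Eucl m → Eucl n}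
    (hv : MemLp v p (prodMeasure Ω (parallelotope a b))) {v₀ : Eucl n → ℝ} {g₀ : Eucl n → Eucl n}
    {v₁ : Eucl n × Eucl m → Eucl n} (h₀ : IsSobolevWithGradient Ω p v₀ g₀)
    (h₁ : MemLpGR Ω p R a b v₁)
    (h : ∀ᵐ z ∂(prodMeasure Ω (parallelotope a b)), v z = g₀ z.1 + v₁ z) :
    ∃ (vε : ℕ → Eucl n → ℝ) (gε : ℕ → Eucl n → Eucl n),
      IsBoundedSobolevSeq Ω p vε gε ∧ RTwoScaleConverges Ω p q R a b ε gε v := by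
  obtain ⟨vε, gε, hb, hlim⟩ := exists_recovery_sequence hR hΩ.measurableSet hΩv hp hp' hpq hε hε_lim
    h₀ (memLp_comp_cellSection h₁.1) (h₁.isCellGradientLimit hΩ hΩv hp hp')
  refine ⟨vε, gε, hb, fun j => (hb.1 j).memLp_gradient, hv, fun φ hφ => ?_⟩
  rw [setIntegral_average_inner_eq hpq hφ (memLp_comp_cellSection hv)]
  convert hlim φ hφ using 2
  refine integral_congr_ae ?_
  filter_upwards [ae_comp_cellSection h] with w hw
  rw [hw]

end Sufficiency

/-! ### Weak limits of bounded sequences in `L^p` -/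

section WeakLimit

variable {ι α : Type*} [MeasurableSpace α] {μ : Measure α} {U : Ultrafilter ι}

theorem Ultrafilter.exists_tendsto_ennreal (U : Ultrafilter ι) (f : ι → ℝ≥0∞) :
    ∃ x, Tendsto f U (𝓝 x) := by
  obtain ⟨x, -, hx⟩ := isCompact_univ.ultrafilter_le_nhds (U.map f) (by simp)
  exact ⟨x, hx⟩

/-- Setwise limits of equi-absolutely continuous measures are measures. -/
theorem exists_measure_tendsto [IsFiniteMeasure μ] (U : Ultrafilter ι) {ν : ι → Measure α}
    {η : ℝ≥0∞ → ℝ≥0∞} (hη : Tendsto η (𝓝 0) (𝓝 0))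
    (h : ∀ j A, MeasurableSet A → ν j A ≤ η (μ A)) :
    ∃ ν' : Measure α, ∀ A, MeasurableSet A → Tendsto (fun j => ν j A) U (𝓝 (ν' A)) := by
  -- Compactness of `[0, ∞]` gives a limit along the ultrafilter for every set at once, so no
  -- subsequence has to be extracted.
  choose L hL using fun A : Set α => U.exists_tendsto_ennreal fun j => ν j A
  have hLη : ∀ A, MeasurableSet A → L A ≤ η (μ A) := fun A hA =>
    le_of_tendsto' (hL A) fun j => h j A hA
  have h0 : L ∅ = 0 := tendsto_nhds_unique (hL ∅) (by simp)
  have hU : ∀ ⦃f : ℕ → Set α⦄, (∀ i, MeasurableSet (f i)) → Pairwise (Function.onFun Disjoint f) →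
      L (⋃ i, f i) = ∑' i, L (f i) := by
    intro f hf hd
    have hsplit : ∀ (κ : Measure α) (s : Finset ℕ), κ (⋃ i, f i) =
        ∑ i ∈ s, κ (f i) + κ (⋃ i : {i // i ∉ s}, f i) := by
      intro κ s
      have hd' : Pairwise (Function.onFun Disjoint fun i : {i // i ∉ s} => f i) :=
        fun i j hij => hd fun h => hij (Subtype.ext h)
      have h := ENNReal.sum_add_tsum_compl s fun i => κ (f i)
      rw [measure_iUnion hd hf, measure_iUnion hd' fun i => hf i]
      exact h.symm
    have hsum : ∀ s : Finset ℕ, L (⋃ i, f i) =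
        ∑ i ∈ s, L (f i) + L (⋃ i : {i // i ∉ s}, f i) := by
      intro s
      refine tendsto_nhds_unique (hL _) ?_
      simp only [fun j => hsplit (ν j) s]
      exact (tendsto_finsetSum _ fun i _ => hL (f i)).add (hL _)
    -- Finite additivity passes to the limit directly. Countable additivity is where equi-absolute
    -- continuity enters: the tails have small `μ`-measure, hence small limit mass.
    have hrest : Tendsto (fun s : Finset ℕ => L (⋃ i : {i // i ∉ s}, f i)) atTop (𝓝 0) := by
      have hμ : Tendsto (fun s : Finset ℕ => μ (⋃ i : {i // i ∉ s}, f i)) atTop (𝓝 0) := by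
        have hfin : ∑' i, μ (f i) ≠ ⊤ := by
          rw [← measure_iUnion hd hf]; exact measure_ne_top μ _
        refine (ENNReal.tendsto_tsum_compl_atTop_zero hfin).congr fun s => ?_
        have hd' : Pairwise (Function.onFun Disjoint fun i : {i // i ∉ s} => f i) :=
          fun i j hij => hd fun h => hij (Subtype.ext h)
        rw [measure_iUnion hd' fun i => hf i]
      exact tendsto_of_tendsto_of_tendsto_of_le_of_le tendsto_const_nhds (hη.comp hμ)
        (fun _ => zero_le) fun s => hLη _ (MeasurableSet.iUnion fun i => hf i)
    have hs : Tendsto (fun s : Finset ℕ => ∑ i ∈ s, L (f i)) atTop (𝓝 (∑' i, L (f i))) :=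
      ENNReal.summable.hasSum
    replace hs := hs.add hrest
    rw [add_zero] at hs
    exact tendsto_nhds_unique (tendsto_const_nhds.congr hsum) hs
  refine ⟨Measure.ofMeasurable (fun A _ => L A) h0 hU, fun A hA => ?_⟩
  rw [Measure.ofMeasurable_apply A hA]
  exact hL A

theorem SimpleFunc.tendsto_lintegral_measure {l : Filter ι} {ν : ι → Measure α} {ν' : Measure α}
    (h : ∀ A, MeasurableSet A → Tendsto (fun j => ν j A) l (𝓝 (ν' A))) (g : SimpleFunc α ℝ≥0∞)
    (hg : ∀ x, g x ≠ ⊤) : Tendsto (fun j => ∫⁻ x, g x ∂(ν j)) l (𝓝 (∫⁻ x, g x ∂ν')) := by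
  refine Tendsto.congr (fun j => (g.lintegral_eq_lintegral (ν j)).symm) ?_
  rw [g.lintegral_eq_lintegral]
  refine tendsto_finsetSum _ fun c hc => ENNReal.Tendsto.const_mul
    (h _ (g.measurableSet_preimage _)) (Or.inr ?_)
  obtain ⟨x, rfl⟩ := SimpleFunc.mem_range.1 hc
  exact hg x

variable {P Q : ℝ}

/-- Converse of Hölder's inequality, tested with the power `P - 1` of the truncation of `f` at `k`.
The truncation makes the integral `I` finite, so that `I ^ (1 / Q)` can be divided out; monotone
convergence removes it. -/
theorem lintegral_rpow_le_of_lintegral_mul_le [IsFiniteMeasure μ] (hPQ : P.HolderConjugate Q)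
    {f : α → ℝ≥0∞} (hf : Measurable f) {C : ℝ≥0∞}
    (h : ∀ g : α → ℝ≥0∞, Measurable g → ∫⁻ x, f x * g x ∂μ ≤ C * (∫⁻ x, g x ^ Q ∂μ) ^ (1 / Q)) :
    (∫⁻ x, f x ^ P ∂μ) ^ (1 / P) ≤ C := by
  have hP := hPQ.pos
  have hQ := hPQ.symm.pos
  have hP1 : 0 < P - 1 := hPQ.sub_one_pos
  have hk : ∀ k : ℕ, ∫⁻ x, (min (f x) k) ^ P ∂μ ≤ C ^ P := by
    intro k
    have hmin : Measurable fun x => min (f x) (k : ℝ≥0∞) := hf.min measurable_const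
    have hfin : ∫⁻ x, (min (f x) k) ^ P ∂μ ≠ ⊤ := by
      refine ne_top_of_le_ne_top (b := ∫⁻ _, (k : ℝ≥0∞) ^ P ∂μ) ?_
        (lintegral_mono fun x => ENNReal.rpow_le_rpow (min_le_right _ _) hP.le)
      rw [lintegral_const]
      exact ENNReal.mul_ne_top (ENNReal.rpow_ne_top_of_nonneg hP.le (ENNReal.natCast_ne_top k))
        (measure_ne_top μ _)
    set I := ∫⁻ x, (min (f x) k) ^ P ∂μ with hI
    have h1 : I ≤ C * I ^ (1 / Q) := by
      refine le_trans ?_ ((h (fun x => (min (f x) k) ^ (P - 1)) (hmin.pow_const _)).trans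
        (le_of_eq ?_))
      · refine lintegral_mono fun x => ?_
        dsimp only
        calc (min (f x) k) ^ P = min (f x) k * (min (f x) k) ^ (P - 1) := by
              conv_lhs => rw [← add_sub_cancel 1 P]
              rw [ENNReal.rpow_add_of_nonneg _ _ zero_le_one hP1.le, ENNReal.rpow_one]
          _ ≤ _ := by gcongr; exact min_le_left _ _
      · simp only [← ENNReal.rpow_mul, hPQ.sub_one_mul_conj, hI]
    rcases eq_or_ne I 0 with h0 | h0
    · rw [h0]; exact zero_le
    · have hIQ0 : I ^ (1 / Q) ≠ 0 := by simp [h0, hfin]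
      have hIQt : I ^ (1 / Q) ≠ ⊤ := ENNReal.rpow_ne_top_of_nonneg (by positivity) hfin
      have h2 : I ^ (1 / P) ≤ C := by
        rw [← ENNReal.mul_le_mul_iff_left hIQ0 hIQt]
        refine le_trans (le_of_eq ?_) h1
        rw [← ENNReal.rpow_add _ _ h0 hfin]
        have : 1 / P + 1 / Q = 1 := by simpa using hPQ.inv_add_inv_eq_one
        rw [this, ENNReal.rpow_one]
      calc I = (I ^ (1 / P)) ^ P := by
            rw [← ENNReal.rpow_mul, one_div, inv_mul_cancel₀ hP.ne', ENNReal.rpow_one]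
        _ ≤ C ^ P := ENNReal.rpow_le_rpow h2 hP.le
  have hsup : ∫⁻ x, f x ^ P ∂μ ≤ C ^ P := by
    have hpt : ∀ x, f x ^ P = ⨆ k : ℕ, (min (f x) k) ^ P := by
      intro x
      refine le_antisymm (le_of_tendsto' (x := atTop) (f := fun k : ℕ => (min (f x) k) ^ P) ?_
        fun k => le_iSup (fun k : ℕ => (min (f x) (k : ℝ≥0∞)) ^ P) k)
        (iSup_le fun k => ENNReal.rpow_le_rpow (min_le_left _ _) hP.le)
      have : Tendsto (fun k : ℕ => min (f x) (k : ℝ≥0∞)) atTop (𝓝 (min (f x) ⊤)) :=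
        tendsto_const_nhds.min ENNReal.tendsto_nat_nhds_top
      rw [min_top_right] at this
      exact (ENNReal.continuous_rpow_const.tendsto _).comp this
    simp only [hpt]
    rw [lintegral_iSup (fun k => (hf.min measurable_const).pow_const _)
      (fun i j hij x => ENNReal.rpow_le_rpow (min_le_min le_rfl (by exact_mod_cast hij)) hP.le)]
    exact iSup_le hk
  calc _ ≤ (C ^ P) ^ (1 / P) := ENNReal.rpow_le_rpow hsup (by positivity)
    _ = C := by rw [← ENNReal.rpow_mul, mul_one_div, div_self hP.ne', ENNReal.rpow_one]

/-- By Hölder, the measures with densities `f j` are bounded on `A` by `C` times `μ A ^ (1 / Q)`.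
They therefore converge setwise to a measure absolutely continuous for `μ`, and its Radon–Nikodym
density is the limit. -/
theorem exists_setLIntegral_tendsto [IsFiniteMeasure μ] (U : Ultrafilter ι)
    (hPQ : P.HolderConjugate Q) {f : ι → α → ℝ≥0∞} (hf : ∀ j, AEMeasurable (f j) μ) {C : ℝ≥0∞}
    (hC : C ≠ ⊤) (hfC : ∀ j, (∫⁻ x, f j x ^ P ∂μ) ^ (1 / P) ≤ C) :
    ∃ f' : α → ℝ≥0∞, Measurable f' ∧ (∫⁻ x, f' x ^ P ∂μ) ^ (1 / P) ≤ C ∧ ∀ A, MeasurableSet A →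
      Tendsto (fun j => ∫⁻ x in A, f j x ∂μ) U (𝓝 (∫⁻ x in A, f' x ∂μ)) := by
  have hQ := hPQ.symm.pos
  have hHolder : ∀ j, ∀ g : α → ℝ≥0∞, AEMeasurable g μ →
      ∫⁻ x, f j x * g x ∂μ ≤ C * (∫⁻ x, g x ^ Q ∂μ) ^ (1 / Q) := fun j g hg =>
    (ENNReal.lintegral_mul_le_Lp_mul_Lq μ hPQ (hf j) hg).trans (mul_le_mul_left (hfC j) _)
  obtain ⟨ν', hν'⟩ := exists_measure_tendsto (μ := μ) (ν := fun j => μ.withDensity (f j)) U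
    (η := fun t => C * t ^ (1 / Q)) (by
      have : Tendsto (fun t : ℝ≥0∞ => C * t ^ (1 / Q)) (𝓝 0) (𝓝 (C * 0 ^ (1 / Q))) :=
        ENNReal.Tendsto.const_mul (ENNReal.continuous_rpow_const.tendsto 0) (Or.inr hC)
      simpa [hQ] using this) (fun j A hA => by
      rw [withDensity_apply _ hA]
      have h := hHolder j (A.indicator 1) ((measurable_one.indicator hA).aemeasurable)
      have h1 : ∀ x, f j x * A.indicator 1 x = A.indicator (f j) x := fun x => by
        by_cases hx : x ∈ A <;> simp [hx]
      have h2 : ∀ x, (A.indicator 1 x : ℝ≥0∞) ^ Q = A.indicator 1 x := fun x => by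
        by_cases hx : x ∈ A <;> simp [hx, hQ]
      simp only [h1, h2] at h
      rwa [lintegral_indicator hA, lintegral_indicator_one hA] at h)
  have hν'_univ : ν' Set.univ < ⊤ := by
    have hle := le_of_tendsto' (hν' _ MeasurableSet.univ) (b := C * μ Set.univ ^ (1 / Q)) fun j => by
      rw [withDensity_apply _ MeasurableSet.univ, setLIntegral_univ]
      simpa using hHolder j 1 aemeasurable_const
    exact hle.trans_lt (ENNReal.mul_lt_top hC.lt_top
      (ENNReal.rpow_lt_top_of_nonneg (by positivity) (measure_ne_top μ _)))
  have : IsFiniteMeasure ν' := ⟨hν'_univ⟩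
  have hac : ν' ≪ μ := by
    refine Measure.AbsolutelyContinuous.mk fun A hA hA0 => ?_
    refine tendsto_nhds_unique (hν' A hA) ?_
    simp only [fun j => withDensity_absolutelyContinuous μ (f j) hA0]
    exact tendsto_const_nhds
  have hfm := Measure.measurable_rnDeriv ν' μ
  have hd : μ.withDensity (ν'.rnDeriv μ) = ν' := Measure.withDensity_rnDeriv_eq _ _ hac
  refine ⟨ν'.rnDeriv μ, hfm, ?_, fun A hA => ?_⟩
  · refine lintegral_rpow_le_of_lintegral_mul_le hPQ hfm fun g hg => ?_
    have hmul : ∀ s : α → ℝ≥0∞, Measurable s → ∫⁻ x, ν'.rnDeriv μ x * s x ∂μ = ∫⁻ x, s x ∂ν' :=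
      fun s hs => by
        conv_rhs => rw [← hd]
        exact (lintegral_withDensity_eq_lintegral_mul μ hfm hs).symm
    -- Setwise convergence only controls simple functions, so the dual bound is passed to the limit
    -- on simple approximations of `g` from below.
    rw [hmul g hg, lintegral_eq_iSup_eapprox_lintegral hg]
    refine iSup_le fun k => ?_
    rw [← (SimpleFunc.eapprox g k).lintegral_eq_lintegral ν']
    refine le_of_tendsto' (SimpleFunc.tendsto_lintegral_measure hν' (SimpleFunc.eapprox g k)
      fun x => (SimpleFunc.eapprox_lt_top g k x).ne) fun j => ?_
    rw [lintegral_withDensity_eq_lintegral_mul₀ (hf j) (SimpleFunc.measurable _).aemeasurable]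
    refine (hHolder j _ (SimpleFunc.measurable _).aemeasurable).trans ?_
    gcongr with x
    rw [← SimpleFunc.iSup_eapprox_apply hg x]
    exact le_iSup (fun i => SimpleFunc.eapprox g i x) k
  · rw [← withDensity_apply _ hA, hd]
    simp only [← withDensity_apply _ hA]
    exact hν' A hA

end WeakLimit

/-! ### Weak limits of real-valued functions -/

section WeakLimitReal

variable {ι α : Type*} [MeasurableSpace α] {μ : Measure α} {U : Ultrafilter ι} {p q : ℝ≥0∞}

theorem enorm_integral_mul_le (hpq : p⁻¹ + q⁻¹ = 1) {f g : α → ℝ}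
    (hf : AEStronglyMeasurable f μ) (hg : AEStronglyMeasurable g μ) :
    ‖∫ x, f x * g x ∂μ‖ₑ ≤ eLpNorm f p μ * eLpNorm g q μ := by
  simpa [mul_comm] using enorm_integral_inner_le hpq hf hg

theorem integrable_mul_of_memLp (hpq : p⁻¹ + q⁻¹ = 1) {f g : α → ℝ}
    (hf : MemLp f p μ) (hg : MemLp g q μ) : Integrable (fun x => f x * g x) μ := by
  simpa [mul_comm] using integrable_inner_of_memLp hpq hf hg

theorem enorm_integral_mul_sub_le (hpq : p⁻¹ + q⁻¹ = 1) {f g g' : α → ℝ}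
    (hf : MemLp f p μ) (hg : MemLp g q μ) (hg' : MemLp g' q μ) :
    ‖∫ x, f x * g x ∂μ - ∫ x, f x * g' x ∂μ‖ₑ ≤ eLpNorm f p μ * eLpNorm (g - g') q μ := by
  rw [← integral_sub (integrable_mul_of_memLp hpq hf hg) (integrable_mul_of_memLp hpq hf hg')]
  simp only [← mul_sub]
  exact enorm_integral_mul_le hpq hf.1 (hg.1.sub hg'.1)

theorem holderConjugate_toReal (hp : 1 < p) (hp' : p ≠ ⊤) (hpq : p⁻¹ + q⁻¹ = 1) :
    p.toReal.HolderConjugate q.toReal := by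
  rw [Real.holderConjugate_iff]
  refine ⟨by simpa using (ENNReal.toReal_lt_toReal ENNReal.one_ne_top hp').2 hp, ?_⟩
  rw [← ENNReal.toReal_inv, ← ENNReal.toReal_inv, ← ENNReal.toReal_add, hpq, ENNReal.toReal_one]
  · exact fun h => by simp [h] at hpq
  · exact fun h => by simp [h] at hpq

theorem conjExponent_ne_top (hp : 1 < p) (hpq : p⁻¹ + q⁻¹ = 1) : q ≠ ⊤ := by
  rintro rfl
  rw [ENNReal.inv_top, add_zero, ENNReal.inv_eq_one] at hpq
  exact hp.ne' hpq

/-- If the integrals over measurable sets converge, so do the integrals against `L^q` functions. -/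
theorem tendsto_integral_mul_of_tendsto_setIntegral [IsFiniteMeasure μ] {l : Filter ι}
    (hq : q ≠ ⊤) (hpq : p⁻¹ + q⁻¹ = 1)
    {u : ι → α → ℝ} {u' : α → ℝ} (hu : ∀ j, MemLp (u j) p μ) (hu' : MemLp u' p μ) {C : ℝ≥0∞}
    (hC : C ≠ ⊤) (huC : ∀ j, eLpNorm (u j) p μ ≤ C)
    (h : ∀ A, MeasurableSet A → Tendsto (fun j => ∫ x in A, u j x ∂μ) l (𝓝 (∫ x in A, u' x ∂μ)))
    {φ : α → ℝ} (hφ : MemLp φ q μ) :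
    Tendsto (fun j => ∫ x, u j x * φ x ∂μ) l (𝓝 (∫ x, u' x * φ x ∂μ)) := by
  have hsm : ∀ g : SimpleFunc α ℝ, MemLp g q μ := fun g => g.memLp_of_isFiniteMeasure q μ
  have hsimple : ∀ g : SimpleFunc α ℝ,
      Tendsto (fun j => ∫ x, u j x * g x ∂μ) l (𝓝 (∫ x, u' x * g x ∂μ)) := by
    intro g
    induction g using SimpleFunc.induction with
    | @const c s hs =>
      have hw : ∀ w : α → ℝ, ∫ x, w x * (SimpleFunc.piecewise s hs (SimpleFunc.const α c)
          (SimpleFunc.const α 0)) x ∂μ = (∫ x in s, w x ∂μ) * c := by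
        intro w
        rw [← integral_mul_const, ← integral_indicator hs]
        refine integral_congr_ae (ae_of_all _ fun x => ?_)
        by_cases hx : x ∈ s <;> simp [hx]
      simp only [hw]
      exact (h s hs).mul_const c
    | @add f g hd hf hg =>
      have hw : ∀ w : α → ℝ, MemLp w p μ → ∫ x, w x * (f + g) x ∂μ =
          ∫ x, w x * f x ∂μ + ∫ x, w x * g x ∂μ := by
        intro w hw
        rw [← integral_add (integrable_mul_of_memLp hpq hw (hsm f))
          (integrable_mul_of_memLp hpq hw (hsm g))]
        simp [mul_add]
      rw [hw u' hu']
      exact (hf.add hg).congr fun j => (hw _ (hu j)).symm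
  rw [tendsto_iff_edist_tendsto_0, ENNReal.tendsto_nhds_zero]
  intro δ hδ
  have hδ3 : 0 < δ / 3 := ENNReal.div_pos hδ.ne' (by norm_num)
  -- `B` dominates all the norms involved; the summand 1 keeps it nonzero, so that dividing by it is
  -- harmless.
  set B := C + eLpNorm u' p μ + 1 with hB
  have hBt : B ≠ ⊤ := by
    simp [hB, hC, hu'.eLpNorm_ne_top]
  have hB0 : B ≠ 0 := by simp [hB]
  have hδ' : δ / 3 / B ≠ 0 := (ENNReal.div_pos hδ3.ne' hBt).ne'
  obtain ⟨g, hg, -⟩ := hφ.exists_simpleFunc_eLpNorm_sub_lt hq hδ'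
  have hBg : ∀ w : α → ℝ, MemLp w p μ → eLpNorm w p μ ≤ B →
      ‖∫ x, w x * φ x ∂μ - ∫ x, w x * g x ∂μ‖ₑ ≤ δ / 3 := fun w hw hwB =>
    (enorm_integral_mul_sub_le hpq hw hφ (hsm g)).trans
      ((mul_le_mul' hwB hg.le).trans (ENNReal.mul_div_cancel hB0 hBt).le)
  filter_upwards [ENNReal.tendsto_nhds_zero.1 (tendsto_iff_edist_tendsto_0.1 (hsimple g)) _ hδ3]
    with j hj
  calc _ ≤ edist (∫ x, u j x * φ x ∂μ) (∫ x, u j x * g x ∂μ) +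
        edist (∫ x, u j x * g x ∂μ) (∫ x, u' x * g x ∂μ) +
        edist (∫ x, u' x * g x ∂μ) (∫ x, u' x * φ x ∂μ) := edist_triangle4 _ _ _ _
    _ ≤ δ / 3 + δ / 3 + δ / 3 := by
        refine add_le_add (add_le_add ?_ hj) ?_
        · rw [edist_eq_enorm_sub]
          exact hBg _ (hu j) ((huC j).trans (by rw [hB, add_assoc]; exact le_self_add))
        · rw [edist_comm, edist_eq_enorm_sub]
          exact hBg _ hu' (by rw [hB, add_right_comm]; exact le_add_self)
    _ = 3 * (δ / 3) := by ring
    _ = δ := ENNReal.mul_div_cancel (by norm_num) (by norm_num)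

/-- Bounded families in `L^p`, `1 < p < ∞`, converge weakly along ultrafilters. -/
theorem exists_weakLimit [IsFiniteMeasure μ] (U : Ultrafilter ι) (hp : 1 < p) (hp' : p ≠ ⊤)
    (hpq : p⁻¹ + q⁻¹ = 1) {u : ι → α → ℝ} (hu : ∀ j, MemLp (u j) p μ) {C : ℝ≥0∞} (hC : C ≠ ⊤)
    (huC : ∀ j, eLpNorm (u j) p μ ≤ C) :
    ∃ u' : α → ℝ, MemLp u' p μ ∧ ∀ φ : α → ℝ, MemLp φ q μ →
      Tendsto (fun j => ∫ x, u j x * φ x ∂μ) U (𝓝 (∫ x, u' x * φ x ∂μ)) := by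
  have hp0 : p ≠ 0 := (zero_lt_one.trans hp).ne'
  have hPQ := holderConjugate_toReal hp hp' hpq
  have hle : ∀ w : ι → α → ℝ, (∀ j, eLpNorm (w j) p μ ≤ C) → ∀ j,
      (∫⁻ x, ENNReal.ofReal (w j x) ^ p.toReal ∂μ) ^ (1 / p.toReal) ≤ C := by
    intro w hw j
    refine le_trans ?_ (hw j)
    rw [eLpNorm_eq_lintegral_rpow_enorm_toReal hp0 hp']
    gcongr with x
    exact Real.ofReal_le_enorm _
  -- Positive and negative parts converge separately. The limits `f` and `g` may overlap; only their
  -- difference is used.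
  obtain ⟨f, hf, hfC, hflim⟩ := exists_setLIntegral_tendsto U hPQ
    (fun j => (hu j).1.aemeasurable.ennreal_ofReal) hC (hle u huC)
  obtain ⟨g, hg, hgC, hglim⟩ := exists_setLIntegral_tendsto U hPQ
    (fun j => (hu j).neg.1.aemeasurable.ennreal_ofReal) hC
    (hle (fun j => -u j) fun j => by rw [eLpNorm_neg]; exact huC j)
  have hmem : ∀ w : α → ℝ≥0∞, Measurable w → (∫⁻ x, w x ^ p.toReal ∂μ) ^ (1 / p.toReal) ≤ C →
      MemLp (fun x => (w x).toReal) p μ := by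
    intro w hw hwC
    refine ⟨hw.ennreal_toReal.aestronglyMeasurable, lt_of_le_of_lt ?_ hC.lt_top⟩
    refine le_trans ?_ hwC
    rw [eLpNorm_eq_lintegral_rpow_enorm_toReal hp0 hp']
    gcongr with x
    rw [Real.enorm_eq_ofReal ENNReal.toReal_nonneg]
    exact ENNReal.ofReal_toReal_le
  have hfin : ∀ w : α → ℝ≥0∞, Measurable w → (∫⁻ x, w x ^ p.toReal ∂μ) ^ (1 / p.toReal) ≤ C →
      ∀ᵐ x ∂μ, w x < ⊤ := by
    intro w hw hwC
    have h1 : ∫⁻ x, w x ^ p.toReal ∂μ ≠ ⊤ := by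
      intro h
      rw [h, ENNReal.top_rpow_of_pos (one_div_pos.2 hPQ.pos)] at hwC
      exact hC (top_le_iff.1 hwC)
    filter_upwards [ae_lt_top (hw.pow_const _) h1] with x hx
    exact lt_of_not_ge fun h => by
      rw [top_le_iff.1 h, ENNReal.top_rpow_of_pos hPQ.pos] at hx
      exact lt_irrefl _ hx
  have hint : ∀ w : α → ℝ, Integrable w μ → ∀ A : Set α, ∫⁻ x in A, ENNReal.ofReal (w x) ∂μ ≠ ⊤ :=
    fun w hw A => ne_top_of_le_ne_top hw.lintegral_lt_top.ne (setLIntegral_le_lintegral _ _)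
  have hlim : ∀ w : α → ℝ≥0∞, Measurable w → (∫⁻ x, w x ^ p.toReal ∂μ) ^ (1 / p.toReal) ≤ C →
      ∀ w' : ι → α → ℝ, ∀ A : Set α,
      Tendsto (fun j => ∫⁻ x in A, ENNReal.ofReal (w' j x) ∂μ) U (𝓝 (∫⁻ x in A, w x ∂μ)) →
      Tendsto (fun j => (∫⁻ x in A, ENNReal.ofReal (w' j x) ∂μ).toReal) U
        (𝓝 (∫ x in A, (w x).toReal ∂μ)) := by
    intro w hw hwC w' A h
    rw [integral_toReal hw.aemeasurable (ae_restrict_of_ae (hfin w hw hwC))]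
    refine (ENNReal.tendsto_toReal ?_).comp h
    have h1 := ((hmem w hw hwC).integrable hp.le).lintegral_lt_top.ne
    refine ne_top_of_le_ne_top h1 ((setLIntegral_le_lintegral _ _).trans (lintegral_mono_ae ?_))
    filter_upwards [hfin w hw hwC] with x hx
    rw [ENNReal.ofReal_toReal hx.ne]
  refine ⟨fun x => (f x).toReal - (g x).toReal, (hmem f hf hfC).sub (hmem g hg hgC), fun φ hφ =>
    tendsto_integral_mul_of_tendsto_setIntegral (conjExponent_ne_top hp hpq) hpq hu
      ((hmem f hf hfC).sub (hmem g hg hgC)) hC huC (fun A hA => ?_) hφ⟩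
  have h1 := (hlim f hf hfC _ A (hflim A hA)).sub (hlim g hg hgC _ A (hglim A hA))
  rw [← integral_sub ((hmem f hf hfC).integrable hp.le).integrableOn
    ((hmem g hg hgC).integrable hp.le).integrableOn] at h1
  refine h1.congr fun j => ?_
  exact (integral_eq_lintegral_pos_part_sub_lintegral_neg_part
    ((hu j).integrable hp.le).integrableOn).symm

end WeakLimitReal

/-! ### Weak gradients tested against plane waves -/

section PlaneWave

variable {n : ℕ} {Ω : Set (Eucl n)} {p q : ℝ≥0∞}

/-- `φ ∈ C_c^∞(Ω)`. -/
structure IsTestFunction (Ω : Set (Eucl n)) (φ : Eucl n → ℝ) : Prop where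
  contDiff : ContDiff ℝ ∞ φ
  hasCompactSupport : HasCompactSupport φ
  tsupport_subset : tsupport φ ⊆ Ω

variable {φ : Eucl n → ℝ}

theorem IsTestFunction.mul (hφ : IsTestFunction Ω φ) {f : Eucl n → ℝ} (hf : ContDiff ℝ ∞ f) :
    IsTestFunction Ω fun x => φ x * f x :=
  ⟨hφ.contDiff.mul hf, hφ.hasCompactSupport.mul_right,
    (tsupport_mul_subset_left (f := φ) (g := f)).trans hφ.tsupport_subset⟩

theorem IsTestFunction.fderiv_apply (hφ : IsTestFunction Ω φ) (h : Eucl n) :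
    IsTestFunction Ω fun x => fderiv ℝ φ x h :=
  ⟨(hφ.contDiff.fderiv_right (by simp)).clm_apply contDiff_const,
    hφ.hasCompactSupport.fderiv_apply ℝ h,
    (tsupport_fderiv_apply_subset ℝ h).trans hφ.tsupport_subset⟩

theorem IsTestFunction.exists_bound (hφ : IsTestFunction Ω φ) : ∃ C, ∀ x, ‖φ x‖ ≤ C :=
  hφ.hasCompactSupport.exists_bound_of_continuous hφ.contDiff.continuous

theorem IsTestFunction.memLp (hφ : IsTestFunction Ω φ) (q : ℝ≥0∞) (μ : Measure (Eucl n))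
    [IsFiniteMeasureOnCompacts μ] : MemLp φ q μ :=
  hφ.contDiff.continuous.memLp_of_hasCompactSupport hφ.hasCompactSupport

theorem IsTestFunction.integrable_mul (hφ : IsTestFunction Ω φ) {μ : Measure (Eucl n)}
    {w : Eucl n → ℝ} (hw : Integrable w μ) : Integrable (fun x => w x * φ x) μ := by
  obtain ⟨C, hC⟩ := hφ.exists_bound
  exact hw.mul_bdd hφ.contDiff.continuous.aestronglyMeasurable (ae_of_all _ hC)

theorem HasWeakGradient.integral_mul_fderiv {u : Eucl n → ℝ} {g : Eucl n → Eucl n}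
    (hu : HasWeakGradient Ω u g) (hui : Integrable u (volume.restrict Ω))
    (hgi : Integrable g (volume.restrict Ω)) (hφ : IsTestFunction Ω φ) (h : Eucl n) :
    ∫ x in Ω, u x * fderiv ℝ φ x h = - ∫ x in Ω, inner ℝ h (g x) * φ x := by
  have h1 : ∀ x, fderiv ℝ φ x h = ∑ i, h i * fderiv ℝ φ x (EuclideanSpace.single i 1) := by
    intro x
    conv_lhs => rw [← (EuclideanSpace.basisFun (Fin n) ℝ).sum_repr h]
    simp
  have h2 : ∀ x, inner ℝ h (g x) = ∑ i, h i * g x i := by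
    intro x
    simp [PiLp.inner_apply, mul_comm]
  simp only [h1, h2, Finset.mul_sum, Finset.sum_mul]
  have hgi' : ∀ i, Integrable (fun x => g x i) (volume.restrict Ω) := fun i =>
    (EuclideanSpace.proj (𝕜 := ℝ) i).integrable_comp hgi
  rw [integral_finsetSum, integral_finsetSum, ← Finset.sum_neg_distrib]
  · refine Finset.sum_congr rfl fun i _ => ?_
    have := hu φ hφ.contDiff hφ.hasCompactSupport hφ.tsupport_subset i
    simp only [mul_left_comm _ (h i), mul_assoc, integral_const_mul, this, mul_neg]
  · intro i _
    simp only [mul_assoc]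
    exact (hφ.integrable_mul (hgi' i)).const_mul _
  · intro i _
    simp only [mul_left_comm _ (h i)]
    exact ((hφ.fderiv_apply _).integrable_mul hui).const_mul _

/-- The real part of `w exp (2 π i s ξ · x)`. -/
def planeWave (ξ : Eucl n) (s : ℝ) (w : ℂ) (x : Eucl n) : ℝ :=
  w.re * Real.cos (2 * Real.pi * s * inner ℝ ξ x) - w.im * Real.sin (2 * Real.pi * s * inner ℝ ξ x)

theorem planeWave_eq_re (ξ : Eucl n) (s : ℝ) (w : ℂ) (x : Eucl n) :
    planeWave ξ s w x = (w * Complex.exp (2 * (Real.pi : ℂ) * Complex.I *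
      ((inner ℝ ξ (s • x) : ℝ) : ℂ))).re := by
  have : 2 * (Real.pi : ℂ) * Complex.I * ((inner ℝ ξ (s • x) : ℝ) : ℂ) =
      ((2 * Real.pi * s * inner ℝ ξ x : ℝ) : ℂ) * Complex.I := by
    rw [inner_smul_right]
    push_cast
    ring
  rw [this, Complex.mul_re, Complex.exp_ofReal_mul_I_re, Complex.exp_ofReal_mul_I_im, planeWave]

theorem contDiff_planeWave (ξ : Eucl n) (s : ℝ) (w : ℂ) : ContDiff ℝ ∞ (planeWave ξ s w) := by
  unfold planeWave
  have : ContDiff ℝ ∞ fun x : Eucl n => 2 * Real.pi * s * inner ℝ ξ x :=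
    contDiff_const.mul (contDiff_const.inner ℝ contDiff_id)
  exact (contDiff_const.mul this.cos).sub (contDiff_const.mul this.sin)

/-- Differentiation multiplies the complex amplitude by `I`, so the real plane waves are closed
under it and complex test functions are avoided. -/
theorem fderiv_planeWave (ξ : Eucl n) (s : ℝ) (w : ℂ) (x h : Eucl n) :
    fderiv ℝ (planeWave ξ s w) x h =
      2 * Real.pi * s * inner ℝ ξ h * planeWave ξ s (Complex.I * w) x := by
  have hθ : HasFDerivAt (fun x : Eucl n => 2 * Real.pi * s * inner ℝ ξ x)
      ((2 * Real.pi * s) • innerSL ℝ ξ) x := (innerSL ℝ ξ).hasFDerivAt.const_mul (2 * Real.pi * s)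
  have hd : HasFDerivAt (planeWave ξ s w) _ x :=
    (hθ.cos.const_mul w.re).sub (hθ.sin.const_mul w.im)
  rw [hd.fderiv]
  simp [planeWave]
  ring

theorem norm_planeWave_le (ξ : Eucl n) (s : ℝ) (w : ℂ) (x : Eucl n) :
    ‖planeWave ξ s w x‖ ≤ ‖w‖ := by
  rw [planeWave_eq_re, Real.norm_eq_abs]
  refine (Complex.abs_re_le_norm _).trans ?_
  have : 2 * (Real.pi : ℂ) * Complex.I * ((inner ℝ ξ (s • x) : ℝ) : ℂ) =
      ((2 * Real.pi * inner ℝ ξ (s • x) : ℝ) : ℂ) * Complex.I := by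
    push_cast
    ring
  rw [norm_mul, this, Complex.norm_exp_ofReal_mul_I, mul_one]

theorem fderiv_mul_planeWave (hφ : IsTestFunction Ω φ) (ξ : Eucl n) (s : ℝ) (w : ℂ) (x h : Eucl n) :
    fderiv ℝ (fun x => φ x * planeWave ξ s w x) x h =
      fderiv ℝ φ x h * planeWave ξ s w x +
        2 * Real.pi * s * inner ℝ ξ h * (φ x * planeWave ξ s (Complex.I * w) x) := by
  rw [fderiv_fun_mul (hφ.contDiff.differentiable (by simp) x)
    ((contDiff_planeWave ξ s w).differentiable (by simp) x)]
  simp only [add_apply, smul_apply, fderiv_planeWave,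
    smul_eq_mul]
  ring

theorem tendsto_mul_integral_mul {X : Type*} [MeasurableSpace X] {μ : Measure X} [IsFiniteMeasure μ]
    (hpq : p⁻¹ + q⁻¹ = 1) {f θ : ℕ → X → ℝ} (hf : ∀ j, AEStronglyMeasurable (f j) μ) {C : ℝ≥0∞}
    (hC : C ≠ ⊤) (hfC : ∀ j, eLpNorm (f j) p μ ≤ C) (hθ : ∀ j, AEStronglyMeasurable (θ j) μ) {B : ℝ}
    (hθB : ∀ j x, ‖θ j x‖ ≤ B) {ε : ℕ → ℝ} (hε : Tendsto ε atTop (𝓝 0)) :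
    Tendsto (fun j => ε j * ∫ x, f j x * θ j x ∂μ) atTop (𝓝 0) := by
  set D := C * (μ Set.univ ^ q.toReal⁻¹ * ENNReal.ofReal B)
  have hD : D ≠ ⊤ := ENNReal.mul_ne_top hC (ENNReal.mul_ne_top
    (ENNReal.rpow_ne_top_of_nonneg (by positivity) (measure_ne_top μ _)) ENNReal.ofReal_ne_top)
  rw [tendsto_zero_iff_enorm_tendsto_zero]
  have h := ENNReal.Tendsto.mul_const (tendsto_zero_iff_enorm_tendsto_zero.1 hε) (Or.inr hD)
  rw [zero_mul] at h
  refine tendsto_of_tendsto_of_tendsto_of_le_of_le tendsto_const_nhds h (fun _ => zero_le)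
    fun j => ?_
  rw [enorm_mul]
  gcongr
  refine (enorm_integral_mul_le hpq (hf j) (hθ j)).trans (mul_le_mul' (hfC j) ?_)
  exact eLpNorm_le_of_ae_bound (ae_of_all _ (hθB j))

/-! ### Bounded Sobolev sequences against plane waves -/

section

variable {u : ℕ → Eucl n → ℝ} {g : ℕ → Eucl n → Eucl n} {ε : ℕ → ℝ}

/-- The wave is `ε j` times a derivative along `ξ`, up to a constant. Integrating by parts moves the
derivative to `u j` and `φ`, which leaves `ε j` times a bounded quantity. -/
theorem IsBoundedSobolevSeq.tendsto_integral_mul_planeWave (hu : IsBoundedSobolevSeq Ω p u g)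
    (hΩv : volume Ω ≠ ⊤) (hp : 1 ≤ p) (hpq : p⁻¹ + q⁻¹ = 1) (hε : ∀ j, 0 < ε j)
    (hε_lim : Tendsto ε atTop (𝓝 0)) (hφ : IsTestFunction Ω φ) {ξ : Eucl n} (hξ : ξ ≠ 0) (w : ℂ) :
    Tendsto (fun j => ∫ x in Ω, u j x * (φ x * planeWave ξ (ε j)⁻¹ w x)) atTop (𝓝 0) := by
  have : IsFiniteMeasure (volume.restrict Ω) := isFiniteMeasure_restrict.2 hΩv
  obtain ⟨hS, C, hC⟩ := hu
  set κ := 2 * Real.pi * inner ℝ ξ ξ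
  have hκ : κ ≠ 0 := mul_ne_zero (by positivity) (inner_self_ne_zero.2 hξ)
  -- With this amplitude, the derivative along `ξ` of the wave of amplitude `w'` is `κ / ε j` times
  -- the wave of amplitude `w`.
  set w' := -Complex.I * w
  have hw' : Complex.I * w' = w := by
    simp only [w', ← mul_assoc, mul_neg, Complex.I_mul_I, neg_neg, one_mul]
  have hbound : ∀ {ψ : Eucl n → ℝ}, IsTestFunction Ω ψ → ∃ B, ∀ j x,
      ‖ψ x * planeWave ξ (ε j)⁻¹ w' x‖ ≤ B := by
    intro ψ hψ
    obtain ⟨B, hB⟩ := hψ.exists_bound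
    refine ⟨B * ‖w'‖, fun j x => ?_⟩
    rw [norm_mul]
    exact mul_le_mul (hB x) (norm_planeWave_le _ _ _ _) (norm_nonneg _)
      ((norm_nonneg _).trans (hB x))
  have hφ' := hφ.fderiv_apply ξ
  obtain ⟨B, hB⟩ := hbound hφ
  obtain ⟨B', hB'⟩ := hbound hφ'
  have hgξ : ∀ j, eLpNorm (fun x => inner ℝ ξ (g j x)) p (volume.restrict Ω) ≤ ‖ξ‖₊ * C := by
    intro j
    refine (eLpNorm_le_nnreal_smul_eLpNorm_of_ae_le_mul (g := g j) (c := ‖ξ‖₊)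
      (ae_of_all _ fun x => nnnorm_inner_le_nnnorm ξ (g j x)) p).trans ?_
    rw [ENNReal.smul_def, smul_eq_mul]
    gcongr
    exact le_add_self.trans (hC j)
  have hw : ∀ {ψ : Eucl n → ℝ}, IsTestFunction Ω ψ → ∀ j, AEStronglyMeasurable
      (fun x => ψ x * planeWave ξ (ε j)⁻¹ w' x) (volume.restrict Ω) := fun hψ j =>
    (hψ.mul (contDiff_planeWave ξ _ w')).contDiff.continuous.aestronglyMeasurable
  have h1 := tendsto_mul_integral_mul hpq (fun j => ((hS j).memLp_gradient.const_inner ξ).1)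
    (by finiteness) hgξ (hw hφ) hB hε_lim
  have h2 := tendsto_mul_integral_mul hpq (fun j => (hS j).memLp.1) ENNReal.coe_ne_top
    (fun j => le_self_add.trans (hC j)) (hw hφ') hB' hε_lim
  have h3 := (h1.add h2).const_mul (-κ⁻¹)
  rw [add_zero, mul_zero] at h3
  refine h3.congr fun j => ?_
  have hui := (hS j).memLp.integrable hp
  have h4 := (hS j).hasWeakGradient.integral_mul_fderiv hui
    ((hS j).memLp_gradient.integrable hp) (hφ.mul (contDiff_planeWave ξ (ε j)⁻¹ w')) ξ
  simp only [fderiv_mul_planeWave hφ, hw', mul_add, mul_left_comm (u j _) (2 * _ * _ * _)] at h4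
  rw [integral_add ((hφ'.mul (contDiff_planeWave ξ _ w')).integrable_mul hui)
    (((hφ.mul (contDiff_planeWave ξ _ w)).integrable_mul hui).const_mul _),
    integral_const_mul] at h4
  rw [← mul_add, ← neg_eq_iff_eq_neg.2 h4]
  have := (hε j).ne'
  simp only [κ] at hκ ⊢
  field_simp
  ring

/-- The wave is constant along `η`, so integration by parts differentiates only `φ`; the previous
lemma then applies to the test function `∂_η φ`. -/
theorem IsBoundedSobolevSeq.tendsto_integral_inner_mul_planeWave
    (hu : IsBoundedSobolevSeq Ω p u g)
    (hΩv : volume Ω ≠ ⊤) (hp : 1 ≤ p) (hpq : p⁻¹ + q⁻¹ = 1) (hε : ∀ j, 0 < ε j)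
    (hε_lim : Tendsto ε atTop (𝓝 0)) (hφ : IsTestFunction Ω φ) {ξ η : Eucl n} (hξ : ξ ≠ 0)
    (hη : inner ℝ ξ η = 0) (w : ℂ) :
    Tendsto (fun j => ∫ x in Ω, inner ℝ η (g j x) * (φ x * planeWave ξ (ε j)⁻¹ w x)) atTop
      (𝓝 0) := by
  have : IsFiniteMeasure (volume.restrict Ω) := isFiniteMeasure_restrict.2 hΩv
  have h := (hu.tendsto_integral_mul_planeWave hΩv hp hpq hε hε_lim (hφ.fderiv_apply η) hξ w).neg
  rw [neg_zero] at h
  refine h.congr fun j => ?_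
  have h4 := (hu.1 j).hasWeakGradient.integral_mul_fderiv ((hu.1 j).memLp.integrable hp)
    ((hu.1 j).memLp_gradient.integrable hp) (hφ.mul (contDiff_planeWave ξ (ε j)⁻¹ w)) η
  simp only [fderiv_mul_planeWave hφ, hη, mul_zero, zero_mul, add_zero] at h4
  rw [h4, neg_neg]

end

end PlaneWave

/-! ### Two-scale limits of bounded gradients decompose -/

section LimitDecomposition

open UnitAddTorus

variable {n m : ℕ} {a : Eucl m} {b : Module.Basis (Fin m) ℝ (Eucl m)} {Ω : Set (Eucl n)}
  {p q : ℝ≥0∞} {R : Matrix (Fin m) (Fin n) ℝ}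

theorem freq_neg (z : Fin m → ℤ) : freq b (-z) = -freq b z := by
  refine ext_inner_right ℝ fun y => ?_
  simp [inner_freq, inner_neg_left]

theorem memLp_add_measure {X E : Type*} [MeasurableSpace X] [NormedAddCommGroup E]
    {μ ν : Measure X} (hp : p ≠ 0) (hp' : p ≠ ⊤) {f : X → E} (hμ : MemLp f p μ) (hν : MemLp f p ν) :
    MemLp f p (μ + ν) := by
  refine ⟨hμ.1.add_measure hν.1, ?_⟩
  rw [eLpNorm_lt_top_iff_lintegral_rpow_enorm_lt_top hp hp', lintegral_add_measure,
    ENNReal.add_lt_top]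
  exact ⟨(eLpNorm_lt_top_iff_lintegral_rpow_enorm_lt_top hp hp').1 hμ.2,
    (eLpNorm_lt_top_iff_lintegral_rpow_enorm_lt_top hp hp').1 hν.2⟩

theorem exists_parallelotope_mem_nhds (b : Module.Basis (Fin m) ℝ (Eucl m)) (y : Eucl m) :
    ∃ a, parallelotope a b ∈ 𝓝 y := by
  refine ⟨y - ∑ i, (1 / 2 : ℝ) • b i, ?_⟩
  have h : ∀ i, b.repr (y - ∑ i, (1 / 2 : ℝ) • b i) i = b.repr y i - 1 / 2 := by
    intro i
    simp [Finsupp.single_apply]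
  have h1 : ∀ i, ∀ᶠ y' in 𝓝 y, b.repr y' i ∈ Set.Ioo (b.repr y i - 1 / 2) (b.repr y i + 1 / 2) :=
    fun i => (continuous_basis_repr b i).continuousAt.eventually_mem
      (Ioo_mem_nhds (by linarith) (by linarith))
  filter_upwards [eventually_all.2 h1] with y' hy'
  rw [mem_parallelotope_iff]
  intro i
  rw [h]
  exact ⟨(hy' i).1.le, by linarith [(hy' i).2]⟩

/-- Periodic extensions of `L^p` functions on the torus are locally in `L^p`. -/
theorem memLp_comp_cellProj {E : Type*} [NormedAddCommGroup E] (hp : p ≠ 0) (hp' : p ≠ ⊤)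
    {f : UnitAddTorus (Fin m) → E} (hf : MemLp f p volume) {K : Set (Eucl m)} (hK : IsCompact K) :
    MemLp (fun y => f (cellProj b y)) p (volume.restrict K) := by
  have hcell : ∀ a, MemLp (fun y => f (cellProj b y)) p (volume.restrict (parallelotope a b)) := by
    intro a
    obtain ⟨c, -, hc, hmap⟩ := exists_map_cellProj a b
    have h : MemLp f p (c • volume) := hf.smul_measure hc
    rw [← hmap] at h
    exact (memLp_map_measure_iff h.1 (continuous_cellProj b).measurable.aemeasurable).1 h
  -- A compact set is covered by finitely many cells, each with its own corner, so integrability on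
  -- every cell suffices.
  refine hK.induction_on (p := fun s => MemLp (fun y => f (cellProj b y)) p (volume.restrict s))
    (by simp) (fun s t hst h => h.mono_measure (Measure.restrict_mono hst le_rfl))
    (fun s t hs ht => (memLp_add_measure hp hp' hs ht).mono_measure (Measure.restrict_union_le s t))
    fun y _ => ?_
  obtain ⟨a, ha⟩ := exists_parallelotope_mem_nhds b y
  exact ⟨_, mem_nhdsWithin_of_mem_nhds ha, hcell a⟩

theorem IsOscillatingField.exists_testFunction {d : ℕ} {K : Set (Eucl n)}
    {F : Eucl n × Eucl m → Eucl d} (hF : IsOscillatingField b K F) (hK : IsCompact K)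
    (Ω : Set (Eucl n)) (q : ℝ≥0∞) :
    ∃ G : Eucl n → BoundedContinuousFunction (Eucl m) (Eucl d),
      IsTwoScaleTestFunction Ω q b G ∧ ∀ x y, G x y = F (x, y) := by
  obtain ⟨G, hG, hGc, hGF⟩ := hF.exists_boundedFamily hK
  exact ⟨G, ⟨hG.memLp_of_hasCompactSupport hGc, fun x i y => by
    simp only [hGF]; exact hF.periodic x i y⟩, hGF⟩

theorem IsTestFunction.isOscillatingField_mode {φ : Eucl n → ℝ} (hφ : IsTestFunction Ω φ)
    {d : ℕ} (z : Fin m → ℤ) (w : ℂ) (η : Eucl d) :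
    IsOscillatingField b (tsupport φ) fun x : Eucl n × Eucl m =>
      (φ x.1 * (w * mFourier z (cellProj b x.2)).re) • η where
  continuous := by
    have h1 : Continuous fun x : Eucl n × Eucl m => mFourier z (cellProj b x.2) :=
      (mFourier z).continuous.comp ((continuous_cellProj b).comp continuous_snd)
    exact ((hφ.contDiff.continuous.comp continuous_fst).mul
      (Complex.continuous_re.comp (continuous_const.mul h1))).smul continuous_const
  periodic x i y := by simp only [cellProj_add_basis]
  eq_zero x hx y := by simp only [image_eq_zero_of_notMem_tsupport hx, zero_mul, zero_smul]

variable {ε : ℕ → ℝ} {u : ℕ → Eucl n → ℝ} {g : ℕ → Eucl n → Eucl n}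
  {v : Eucl n × Eucl m → Eucl n}

/-- The limit of a two-scale convergent sequence tested against a single Fourier mode. -/
theorem RTwoScaleConverges.tendsto_integral_mode {d : ℕ} {g : ℕ → Eucl n → Eucl d}
    {v : Eucl n × Eucl m → Eucl d} (h : RTwoScaleConverges Ω p q R a b ε g v)
    (hp : 1 ≤ p) (hp' : p ≠ ⊤) {φ : Eucl n → ℝ} (hφ : IsTestFunction Ω φ) (z : Fin m → ℤ) (w : ℂ)
    (η : Eucl d) :
    Tendsto (fun j => ∫ x in Ω, inner ℝ η (g j x) *
      (φ x * planeWave (R.transpose.toEuclideanLin (freq b (-z))) (ε j)⁻¹ w x)) atTop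
      (𝓝 (∫ x in Ω, φ x *
        (w * mFourierCoeff (fun t => ((inner ℝ η (v (x, cellSection a b t)) : ℝ) : ℂ)) z).re)) := by
  -- The mode `-z` is tested because `mFourierCoeff` at `z` integrates against `mFourier (-z)`.
  obtain ⟨G, hG, hGF⟩ := (hφ.isOscillatingField_mode (b := b) (-z) w η).exists_testFunction
    hφ.hasCompactSupport Ω q
  have hlim := h.2.2 G hG
  simp only [hGF, mFourier_cellProj_oscillating, ← planeWave_eq_re] at hlim
  simp only [inner_smul_right, average_cell_eq, cellProj_cellSection] at hlim
  have hV := memLp_comp_cellSection h.2.1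
  convert hlim using 2 with j
  · refine integral_congr_ae (ae_of_all _ fun x => ?_)
    simp only [real_inner_comm, mul_comm]
  · refine integral_congr_ae ?_
    filter_upwards [ae_memLp_prodMk_left (zero_lt_one.trans_le hp).ne' hp' hV] with x hx
    have hint : Integrable (fun t => ((inner ℝ η (v (x, cellSection a b t)) : ℝ) : ℂ)) :=
      ((hx.integrable hp).const_inner η).ofReal
    rw [mFourierCoeff, ← integral_const_mul]
    have h1 := (integrable_mFourier_smul (-z) hint).const_mul w
    have h2 := (Complex.reCLM.integral_comp_comm h1).symm
    simp only [Complex.reCLM_apply] at h2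
    rw [h2, ← integral_const_mul]
    refine integral_congr_ae (ae_of_all _ fun t => ?_)
    dsimp only
    rw [smul_eq_mul, ← mul_assoc, Complex.re_mul_ofReal, real_inner_comm η]
    ring

/-- The components of the Fourier coefficients of the limit orthogonal to `R* k` vanish. -/
theorem RTwoScaleConverges.ae_mFourierCoeff_inner_eq_zero (hu : IsBoundedSobolevSeq Ω p u g)
    (h : RTwoScaleConverges Ω p q R a b ε g v) (hR : IrrationalityCondition R b) (hΩ : IsOpen Ω)
    (hΩv : volume Ω ≠ ⊤) (hp : 1 ≤ p) (hp' : p ≠ ⊤) (hpq : p⁻¹ + q⁻¹ = 1) (hε : ∀ j, 0 < ε j)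
    (hε_lim : Tendsto ε atTop (𝓝 0)) {z : Fin m → ℤ} (hz : z ≠ 0) {η : Eucl n}
    (hη : inner ℝ (R.transpose.toEuclideanLin (freq b z)) η = 0) :
    ∀ᵐ x ∂(volume.restrict Ω),
      mFourierCoeff (fun t => ((inner ℝ η (v (x, cellSection a b t)) : ℝ) : ℂ)) z = 0 := by
  have : IsFiniteMeasure (volume.restrict Ω) := isFiniteMeasure_restrict.2 hΩv
  have hξ : R.transpose.toEuclideanLin (freq b (-z)) ≠ 0 :=
    hR _ (freq_mem_dualLattice b _) (by rw [ne_eq, freq_eq_zero_iff, neg_eq_zero]; exact hz)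
  have hη' : inner ℝ (R.transpose.toEuclideanLin (freq b (-z))) η = 0 := by
    rw [freq_neg, map_neg, inner_neg_left, hη, neg_zero]
  set c : Eucl n → ℂ := fun x =>
    mFourierCoeff (fun t => ((inner ℝ η (v (x, cellSection a b t)) : ℝ) : ℂ)) z
  have hc : MemLp c p (volume.restrict Ω) :=
    memLp_mFourierCoeff hp hp' ((memLp_comp_cellSection h.2.1).const_inner η).ofReal z
  -- Real test fields see only the real part of `w * c x`; the choices `w = 1` and `w = I` recover
  -- both parts of the coefficient.
  have hre : ∀ w : ℂ, ∀ᵐ x ∂(volume.restrict Ω), (w * c x).re = 0 := by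
    intro w
    rw [ae_restrict_iff' hΩ.measurableSet]
    refine hΩ.ae_eq_zero_of_integral_contDiff_smul_eq_zero
      (IntegrableOn.locallyIntegrableOn ((hc.integrable hp).const_mul w).re) ?_
    intro φ h1 h2 h3
    have hφ : IsTestFunction Ω φ := ⟨h1, h2, h3⟩
    rw [← setIntegral_eq_integral_of_tsupport h3 fun x hx => by
      rw [image_eq_zero_of_notMem_tsupport hx, zero_smul]]
    exact tendsto_nhds_unique (h.tendsto_integral_mode hp hp' hφ z w η)
      (hu.tendsto_integral_inner_mul_planeWave hΩv hp hpq hε hε_lim hφ hξ hη' w)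
  filter_upwards [hre 1, hre Complex.I] with x hx hx'
  refine Complex.ext (by simpa using hx) (by simpa using hx')

theorem mFourierCoeff_ofReal_combination {f g : UnitAddTorus (Fin m) → ℝ} (hf : Integrable f)
    (hg : Integrable g) (r s : ℝ) (z : Fin m → ℤ) :
    mFourierCoeff (fun t => ((r * f t - s * g t : ℝ) : ℂ)) z =
      r * mFourierCoeff (fun t => (f t : ℂ)) z - s * mFourierCoeff (fun t => (g t : ℂ)) z := by
  have h := mFourierCoeff_sub (hf.ofReal (𝕜 := ℂ).const_mul (r : ℂ))
    (hg.ofReal (𝕜 := ℂ).const_mul (s : ℂ)) z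
  have hmul : ∀ (r : ℂ) (f : UnitAddTorus (Fin m) → ℂ),
      mFourierCoeff (fun t => r * f t) z = r * mFourierCoeff f z := fun r f => by
    simp only [mFourierCoeff, smul_eq_mul, mul_left_comm _ r, integral_const_mul]
  rw [hmul, hmul] at h
  refine Eq.trans ?_ h
  congr 1
  ext t
  simp

/-- The Fourier coefficients of the two-scale limit of a bounded sequence of gradients. -/
theorem RTwoScaleConverges.ae_exists_mFourierCoeff_eq (hu : IsBoundedSobolevSeq Ω p u g)
    (h : RTwoScaleConverges Ω p q R a b ε g v) (hR : IrrationalityCondition R b) (hΩ : IsOpen Ω)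
    (hΩv : volume Ω ≠ ⊤) (hp : 1 ≤ p) (hp' : p ≠ ⊤) (hpq : p⁻¹ + q⁻¹ = 1) (hε : ∀ j, 0 < ε j)
    (hε_lim : Tendsto ε atTop (𝓝 0)) :
    ∀ᵐ x ∂(volume.restrict Ω), ∀ z : Fin m → ℤ, z ≠ 0 → ∃ c : ℂ, ∀ l,
      mFourierCoeff (fun t => ((v (x, cellSection a b t) l : ℝ) : ℂ)) z =
        c * ((R.transpose.toEuclideanLin (freq b z) l : ℝ) : ℂ) := by
  refine ae_all_iff.2 fun z => ?_
  by_cases hz : z = 0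
  · exact ae_of_all _ fun x hz' => absurd hz hz'
  set ξ := R.transpose.toEuclideanLin (freq b z)
  have hξ : ξ ≠ 0 := hR _ (freq_mem_dualLattice b _) (by rwa [ne_eq, freq_eq_zero_iff])
  obtain ⟨i, hi⟩ : ∃ i, ξ i ≠ 0 := by
    by_contra! h0
    exact hξ (PiLp.ext h0)
  -- The vectors ξ_i e_l - ξ_l e_i, with `i` fixed and ξ_i ≠ 0, span the orthogonal complement of
  -- `ξ`. Finitely many of them suffice, so one null set serves all.
  have hl : ∀ l, ∀ᵐ x ∂(volume.restrict Ω), mFourierCoeff (fun t => ((inner ℝ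
      (ξ i • EuclideanSpace.single l (1 : ℝ) - ξ l • EuclideanSpace.single i (1 : ℝ) : Eucl n)
      (v (x, cellSection a b t)) : ℝ) : ℂ)) z = 0 := fun l =>
    h.ae_mFourierCoeff_inner_eq_zero hu hR hΩ hΩv hp hp' hpq hε hε_lim hz (by
      simp only [inner_sub_right, inner_smul_right, EuclideanSpace.inner_single_right]
      simp [ξ, mul_comm])
  filter_upwards [ae_all_iff.2 hl, ae_memLp_prodMk_left (zero_lt_one.trans_le hp).ne' hp'
    (memLp_comp_cellSection h.2.1)] with x hx hxp _
  have hint : ∀ l, Integrable fun t => v (x, cellSection a b t) l := fun l =>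
    (EuclideanSpace.proj (𝕜 := ℝ) l).integrable_comp (hxp.integrable hp)
  refine ⟨mFourierCoeff (fun t => ((v (x, cellSection a b t) i : ℝ) : ℂ)) z / (ξ i : ℂ), fun l => ?_⟩
  have h1 := hx l
  simp only [inner_sub_left, real_inner_smul_left, EuclideanSpace.inner_single_left, map_one,
    one_mul] at h1
  rw [mFourierCoeff_ofReal_combination (hint l) (hint i), sub_eq_zero] at h1
  have hi' : (ξ i : ℂ) ≠ 0 := Complex.ofReal_ne_zero.2 hi
  field_simp
  rw [mul_comm, h1, mul_comm]

theorem memLp_toLp_of_components {X : Type*} [MeasurableSpace X] {μ : Measure X} {d : ℕ}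
    {f : X → Fin d → ℝ} (hf : ∀ l, MemLp (fun x => f x l) p μ) :
    MemLp (fun x => (WithLp.toLp 2 (f x) : Eucl d)) p μ := by
  have h : ∀ x, (WithLp.toLp 2 (f x) : Eucl d) =
      ∑ l, f x l • (EuclideanSpace.single l 1 : Eucl d) := fun x => by
    ext i
    simp [Pi.single_apply]
  simp only [h]
  exact memLp_finsetSum _ fun l _ =>
    (ContinuousLinearMap.toSpanSingleton ℝ (EuclideanSpace.single l 1 : Eucl d)).comp_memLp' (hf l)

/-- The cell average `x ↦ ⨍ v(x, y) dy`. -/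
def cellMean (a : Eucl m) (b : Module.Basis (Fin m) ℝ (Eucl m)) (v : Eucl n × Eucl m → Eucl n)
    (x : Eucl n) : Eucl n :=
  WithLp.toLp 2 fun l => (mFourierCoeff (fun t => ((v (x, cellSection a b t) l : ℝ) : ℂ)) 0).re

theorem memLp_cellMean (hp : 1 ≤ p) (hp' : p ≠ ⊤)
    (hv : MemLp v p (prodMeasure Ω (parallelotope a b))) :
    MemLp (cellMean a b v) p (volume.restrict Ω) :=
  memLp_toLp_of_components fun l => (memLp_mFourierCoeff hp hp'
    ((EuclideanSpace.proj (𝕜 := ℝ) l).comp_memLp' (memLp_comp_cellSection hv)).ofReal 0).re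

theorem mFourierCoeff_cellMean (x : Eucl n) (l : Fin n) :
    ((cellMean a b v x l : ℝ) : ℂ) =
      mFourierCoeff (fun t => ((v (x, cellSection a b t) l : ℝ) : ℂ)) 0 := by
  refine Complex.ext (by simp [cellMean]) ?_
  simp only [mFourierCoeff, neg_zero, mFourier_zero, ContinuousMap.one_apply, one_smul,
    integral_complex_ofReal, Complex.ofReal_im]

/-- The mean of the two-scale limit is the gradient of a weak limit. -/
theorem exists_isSobolevWithGradient_cellMean (hu : IsBoundedSobolevSeq Ω p u g)
    (h : RTwoScaleConverges Ω p q R a b ε g v) (hΩv : volume Ω ≠ ⊤) (hp : 1 < p) (hp' : p ≠ ⊤)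
    (hpq : p⁻¹ + q⁻¹ = 1) : ∃ v₀, IsSobolevWithGradient Ω p v₀ (cellMean a b v) := by
  have : IsFiniteMeasure (volume.restrict Ω) := isFiniteMeasure_restrict.2 hΩv
  obtain ⟨C, hC⟩ := hu.2
  -- The gradients already converge along the whole sequence, so a weak limit of the functions along
  -- any free ultrafilter can be paired with their limit.
  obtain ⟨v₀, hv₀, hlim⟩ := exists_weakLimit (hyperfilter ℕ) hp hp' hpq (fun j => (hu.1 j).memLp)
    ENNReal.coe_ne_top fun j => le_self_add.trans (hC j)
  refine ⟨v₀, hv₀, memLp_cellMean hp.le hp' h.2.1, fun φ h1 h2 h3 i => ?_⟩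
  have hφ : IsTestFunction Ω φ := ⟨h1, h2, h3⟩
  have hl := hlim _ ((hφ.fderiv_apply (EuclideanSpace.single i 1)).memLp q (volume.restrict Ω))
  have hr := ((h.tendsto_integral_mode hp.le hp' hφ 0 1 (EuclideanSpace.single i 1)).neg).mono_left
    Nat.hyperfilter_le_atTop
  -- At frequency zero the wave is constant, and two-scale convergence reduces to convergence
  -- against functions of `x` alone.
  have hwave : ∀ s x, planeWave (0 : Eucl n) s 1 x = 1 := fun s x => by simp [planeWave]
  simp only [neg_zero, freq_zero, map_zero, hwave, mul_one, one_mul,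
    EuclideanSpace.inner_single_left, map_one] at hr
  refine (tendsto_nhds_unique hl (hr.congr fun j => ?_)).trans ?_
  · exact ((hu.1 j).hasWeakGradient φ h1 h2 h3 i).symm
  · congr 1
    refine integral_congr_ae (ae_of_all _ fun x => ?_)
    dsimp only
    rw [mul_comm]
    rfl

/-- The oscillating part of the limit, extended periodically. -/
def cellOscillation (a : Eucl m) (b : Module.Basis (Fin m) ℝ (Eucl m))
    (v : Eucl n × Eucl m → Eucl n) (z : Eucl n × Eucl m) : Eucl n :=
  v (z.1, cellSection a b (cellProj b z.2)) - cellMean a b v z.1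

theorem ae_eq_cellMean_add_cellOscillation (v : Eucl n × Eucl m → Eucl n) :
    ∀ᵐ z ∂(prodMeasure Ω (parallelotope a b)),
      v z = cellMean a b v z.1 + cellOscillation a b v z := by
  filter_upwards [Measure.quasiMeasurePreserving_snd.ae
    (ae_restrict_mem (measurableSet_parallelotope a b))] with z hz
  rw [cellOscillation, cellSection_cellProj a b hz, add_sub_cancel]

theorem mFourierCoeff_const (c : ℂ) (z : Fin m → ℤ) :
    mFourierCoeff (fun _ : UnitAddTorus (Fin m) => c) z = if z = 0 then c else 0 := by
  simp only [mFourierCoeff, smul_eq_mul, integral_mul_const, integral_mFourier, neg_eq_zero,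
    ite_mul, one_mul, zero_mul]

/-- Subtracting the mean annihilates the zeroth coefficient, as `c 0 = 0` demands, and leaves the
others, already known to be multiples of R*k. -/
theorem memLpGR_cellOscillation (hu : IsBoundedSobolevSeq Ω p u g)
    (h : RTwoScaleConverges Ω p q R a b ε g v) (hR : IrrationalityCondition R b) (hΩ : IsOpen Ω)
    (hΩv : volume Ω ≠ ⊤) (hp : 1 ≤ p) (hp' : p ≠ ⊤) (hpq : p⁻¹ + q⁻¹ = 1) (hε : ∀ j, 0 < ε j)
    (hε_lim : Tendsto ε atTop (𝓝 0)) : MemLpGR Ω p R a b (cellOscillation a b v) := by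
  have hp0 : p ≠ 0 := (zero_lt_one.trans_le hp).ne'
  have hY : IsFiniteMeasure (volume.restrict (parallelotope a b)) :=
    isFiniteMeasure_restrict.2 (volume_parallelotope_ne_top a b)
  refine ⟨?_, ?_⟩
  · refine (h.2.1.sub ((memLp_cellMean hp hp' h.2.1).comp_fst _)).ae_eq ?_
    filter_upwards [ae_eq_cellMean_add_cellOscillation v] with z hz
    rw [Pi.sub_apply, hz, add_sub_cancel_left]
  filter_upwards [h.ae_exists_mFourierCoeff_eq hu hR hΩ hΩv hp hp' hpq hε hε_lim,
    ae_memLp_prodMk_left hp0 hp' (memLp_comp_cellSection h.2.1)] with x hx hxp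
  refine ⟨⟨cellPeriodic_comp_cellProj b fun t => v (x, cellSection a b t) - cellMean a b v x,
    fun K hK => memLp_comp_cellProj hp0 hp' (hxp.sub (memLp_const (cellMean a b v x))) hK⟩, ?_⟩
  have hcoeff : ∀ (z : Fin m → ℤ) (l : Fin n), cellFourierCoeff (parallelotope a b)
      (fun y => cellOscillation a b v (x, y)) (freq b z) l =
        mFourierCoeff (fun t => ((v (x, cellSection a b t) l : ℝ) : ℂ)) z -
          if z = 0 then ((cellMean a b v x l : ℝ) : ℂ) else 0 := by
    intro z l
    have hint : Integrable fun t => ((v (x, cellSection a b t) l : ℝ) : ℂ) :=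
      ((EuclideanSpace.proj (𝕜 := ℝ) l).integrable_comp (hxp.integrable hp)).ofReal
    rw [cellFourierCoeff_freq, ← mFourierCoeff_const, ← mFourierCoeff_sub hint (integrable_const _)]
    congr 1
    ext t
    simp [cellOscillation, cellProj_cellSection]
  -- The scalars must form a function on all of ℝᵐ vanishing at 0, so off the dual lattice they are
  -- set to 0.
  have hc : ∀ k : Eucl m, ∃ c : ℂ, (k = 0 → c = 0) ∧ (k ∈ dualLattice b → ∀ l : Fin n,
      cellFourierCoeff (parallelotope a b) (fun y => cellOscillation a b v (x, y)) k l =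
        c * ((R.transpose.toEuclideanLin k l : ℝ) : ℂ)) := by
    intro k
    by_cases hk : k ∈ dualLattice b
    · obtain ⟨z, rfl⟩ := exists_freq_eq b hk
      by_cases hz : z = 0
      · refine ⟨0, fun _ => rfl, fun _ l => ?_⟩
        rw [hcoeff, if_pos hz, hz, mFourierCoeff_cellMean, sub_self, zero_mul]
      · obtain ⟨c, hc⟩ := hx z hz
        refine ⟨c, fun h0 => absurd ((freq_eq_zero_iff b).1 h0) hz, fun _ l => ?_⟩
        rw [hcoeff, if_neg hz, sub_zero, hc]
    · exact ⟨0, fun _ => rfl, fun hk' => absurd hk' hk⟩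
  choose c hc0 hc using hc
  exact ⟨c, hc0 0 rfl, fun k hk l => hc k hk l⟩

end LimitDecomposition

end

/-! ### The characterization of two-scale limits of gradients -/

theorem theorem1p3 {n m : ℕ} (hnm : n < m)
    (Ω : Set (Eucl n)) (hΩ : IsOpen Ω) (hΩb : Bornology.IsBounded Ω)
    (p q : ℝ≥0∞) (hp : 1 < p) (hp_top : p < ⊤) (hpq : p⁻¹ + q⁻¹ = 1)
    (a : Eucl m) (b : Module.Basis (Fin m) ℝ (Eucl m))
    (R : Matrix (Fin m) (Fin n) ℝ) (hR : IrrationalityCondition R b)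
    (ε : ℕ → ℝ) (hε : ∀ j, 0 < ε j) (hε_lim : Tendsto ε atTop (𝓝 0))
    (v : Eucl n × Eucl m → Eucl n) (hv : MemLp v p (prodMeasure Ω (parallelotope a b))) :
    (∃ (vε : ℕ → Eucl n → ℝ) (gε : ℕ → Eucl n → Eucl n),
        IsBoundedSobolevSeq Ω p vε gε ∧ RTwoScaleConverges Ω p q R a b ε gε v) ↔
      ∃ (v₀ : Eucl n → ℝ) (g₀ : Eucl n → Eucl n) (v₁ : Eucl n × Eucl m → Eucl n),
        IsSobolevWithGradient Ω p v₀ g₀ ∧ MemLpGR Ω p R a b v₁ ∧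
          ∀ᵐ z ∂(prodMeasure Ω (parallelotope a b)), v z = g₀ z.1 + v₁ z := by
  have hΩv : volume Ω ≠ ⊤ := hΩb.measure_lt_top.ne
  constructor
  · rintro ⟨vε, gε, hu, h⟩
    obtain ⟨v₀, hv₀⟩ := exists_isSobolevWithGradient_cellMean hu h hΩv hp hp_top.ne hpq
    exact ⟨v₀, cellMean a b v, cellOscillation a b v, hv₀,
      memLpGR_cellOscillation hu h hR hΩ hΩv hp.le hp_top.ne hpq hε hε_lim,
      ae_eq_cellMean_add_cellOscillation v⟩
  · rintro ⟨v₀, g₀, v₁, h₀, h₁, h⟩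
    exact exists_twoScaleConverges_of_decomposition hΩ hΩv hp.le hp_top.ne hpq hR hε hε_lim hv h₀ h₁ h
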